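/- For every $\epsilon\in(0,2]$ there is a constant $\delta=\delta(\epsilon)\in(0,1)$, depending only on $\epsilon$, with the following property. Let $n\in\mathbb N$ and let $\Gamma\subset\mathbb R^n$ be a simple closed regular $C^1$ curve whose total curvature (the supremum of the sums of the exterior angles of inscribed closed polygons) is at most $(4-\epsilon)\pi$. Let $M$ be a compact smooth surface with smooth boundary $\partial M$, and let $u:M\to\mathbb R^n$ be a branched immersion which is injective on $\partial M$ and satisfies $u(\partial M)=\Gamma$. Here a branched immersion is a $C^1$ map such that at every $q\in M$ (boundary points included) either $du_q$ has rank $2$, or $q$ is a branch point: for some integer $m\ge 2$, in a local coordinate $z$ of $M$ with values in $\mathbb C$ and centred at $q$, and up to a rigid motion of $\mathbb R^n\simeq\mathbb C\times\mathbb R^{n-2}$, one has $u=(z^m,f(z))$ near $q$, with $f(z)=o(|z|^m)$ as $z\to0$. Let $dA=\sqrt{\det(du^*du)}\,d\mathcal H^2$ be the area measure of $u$ on $M$. Suppose that $u$ has mean curvature vector $H$, that is, $H:M\to\mathbb R^n$ is an integrable vector field normal to $u$ with $\int_M \operatorname{div}_M X\,dA=\int_M X\cdot H\,dA$ for all $C^1$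 vector fields $X$ with compact support in $\mathbb R^n\setminus\Gamma$, and suppose that the divergence identity $$\int_M \operatorname{div}_M X\,dA=\int_M X\cdot H\,dA+\int_\Gamma X\cdot\nu_M\,d\mathcal H^1$$ holds for every $C^1$ vector field $X$ on $\mathbb R^n$, where $\nu_M$ is the outward unit conormal of $M$ along $\Gamma$. Let $p\in(2,\infty]$ and $H\in L^p(M)$, and let $r_0=\max_{x,y\in u(M)}|x-y|$. Put $C(p)=\frac{2p}{p-2}\left(\frac2\pi\right)^{1/p}$ and $\alpha=1-\frac2p$ if $p<\infty$, and $C(\infty)=1$, $\alpha=1$ if $p=\infty$. If $$C(p)\,\|H\|_{L^p(M)}\,r_0^{\alpha}<\delta,$$ then $M$ is embedded up to and including the boundary: $u$ is a homeomorphism onto its image, and $du_q$ has rank $2$ for every $q\in M$, boundary points included. -/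

import Mathlib

open scoped Manifold ContDiff ENNReal
open MeasureTheory

noncomputable section

namespace BranchedSurface

/-- The ambient Euclidean space `ℝⁿ`. -/
abbrev E (n : ℕ) : Type := EuclideanSpace ℝ (Fin n)

/-! ### Closed curves and total curvature -/

/-- `γ` is a (1-periodic, regular) parametrization of a simple closed `C¹` curve. -/
structure IsC1ClosedCurve {n : ℕ} (γ : ℝ → E n) : Prop where
  contDiff : ContDiff ℝ 1 γ
  periodic : Function.Periodic γ 1
  regular : ∀ t, deriv γ t ≠ 0
  simple : Set.InjOn γ (Set.Ico 0 1)

/-- The sum of the exterior angles of the closed polygon with vertices `v 0, …, v (k + 2)`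
(indices are cyclic). -/
def polygonCurvature {n k : ℕ} (v : Fin (k + 3) → E n) : ℝ :=
  ∑ i, InnerProductGeometry.angle (v (i + 1) - v i) (v (i + 2) - v (i + 1))

/-- Total curvature of a closed curve: the supremum of the total curvatures of the inscribed
closed polygons. -/
def totalCurvature {n : ℕ} (γ : ℝ → E n) : ℝ≥0∞ :=
  ⨆ (k : ℕ) (t : Fin (k + 3) → ℝ) (_ : StrictMono t) (_ : ∀ i, t i ∈ Set.Ico (0 : ℝ) 1),
    ENNReal.ofReal (polygonCurvature fun i => γ (t i))

/-! ### Maps of a surface with boundary into `ℝⁿ` -/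

section Surface

variable {n : ℕ} {M : Type*} [TopologicalSpace M] [ChartedSpace (EuclideanHalfSpace 2) M]

/-- The differential `du_q : T_q M → ℝⁿ`; the tangent space is identified with `ℝ²` through the
preferred chart at `q`, whose values lie in the half plane `{x | 0 ≤ x 0}`. -/
def du (u : M → E n) (q : M) : E 2 →L[ℝ] E n :=
  mfderiv (𝓡∂ 2) 𝓘(ℝ, E n) u q

/-- The image of the tangent plane at `q` in `ℝⁿ`. -/
def tangentPlane (u : M → E n) (q : M) : Submodule ℝ (E n) :=
  LinearMap.range (du u q).toLinearMap

/-- `u` has a branch point at `p`: for some `m ≥ 2`, up to a rigid motion of `ℝⁿ` and in a local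
coordinate `z` of `M` centred at `p`, one has `u = (z ^ m, f z) ∈ ℂ × ℝⁿ⁻²` with
`f z = o(|z| ^ m)`. The isometric embedding `P` is the inclusion of the factor `ℂ`, and `f` takes
values in its orthogonal complement. At a boundary point, `z` maps a neighbourhood of `p` onto a
one-sided neighbourhood of `0` in `ℂ`. -/
def IsBranchPoint (u : M → E n) (p : M) : Prop :=
  ∃ (m : ℕ) (z : M → ℂ) (P : ℂ →ₗᵢ[ℝ] E n) (f : ℂ → E n),
    2 ≤ m ∧
    ContMDiffAt (𝓡∂ 2) 𝓘(ℝ, ℂ) 1 z p ∧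
    z p = 0 ∧
    Function.Injective (mfderiv (𝓡∂ 2) 𝓘(ℝ, ℂ) z p) ∧
    (∀ w w', inner ℝ (P w) (f w') = 0) ∧
    Asymptotics.IsLittleO (nhds 0) f (fun w => ‖w‖ ^ m) ∧
    ∀ᶠ q in nhds p, u q = u p + P (z q ^ m) + f (z q)

/-- A branched immersion: a `C¹` map which at every point (boundary points included) either is an
immersion or has a branch point. -/
structure IsBranchedImmersion (u : M → E n) : Prop where
  contMDiff : ContMDiff (𝓡∂ 2) 𝓘(ℝ, E n) 1 u
  immersed_or_branch : ∀ p, Function.Injective (du u p) ∨ IsBranchPoint u p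

/-- `u` is an embedding of the surface, boundary included: an immersion at every point and a
homeomorphism onto its image. -/
structure IsEmbedded (u : M → E n) : Prop where
  isEmbedding : Topology.IsEmbedding u
  immersion : ∀ p, Function.Injective (du u p)

/-- The boundary curve `Γ = u(∂M)`. -/
def boundaryCurve (u : M → E n) : Set (E n) :=
  u '' (𝓡∂ 2).boundary M

/-! ### Area -/

/-- The Jacobian `√det(D* D)` of a linear map. -/
def jacobian (D : E 2 →L[ℝ] E n) : ℝ :=
  Real.sqrt (ContinuousLinearMap.det (ContinuousLinearMap.adjoint D ∘L D))

/-- The area of `u` inside the chart at `p`, as a measure on `M`: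
`A ↦ ∫_{φ(A)} J(u ∘ φ⁻¹) dx`, where `φ` is the chart at `p`. -/
def chartArea [MeasurableSpace M] (u : M → E n) (p : M) : Measure M :=
  ((volume.restrict (extChartAt (𝓡∂ 2) p).target).withDensity fun x =>
      ENNReal.ofReal (jacobian
        (fderivWithin ℝ (u ∘ (extChartAt (𝓡∂ 2) p).symm) (Set.range (𝓡∂ 2)) x))).map
    (extChartAt (𝓡∂ 2) p).symm

/-- The area measure `dA = Ju dℋ²` on `M`. The measures in the single charts agree on overlaps, so
their supremum is the measure on `M` that restricts to each of them. -/
def area [MeasurableSpace M] (u : M → E n) : Measure M :=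
  ⨆ p : M, chartArea u p

/-! ### Divergence, conormal, mean curvature -/

/-- The tangential divergence `div_M X` at `q`: the trace of `DX` over the tangent plane. -/
def tangentialDiv (u : M → E n) (X : E n → E n) (q : M) : ℝ :=
  LinearMap.trace ℝ (E n)
    ((tangentPlane u q).starProjection ∘L fderiv ℝ X (u q)).toLinearMap

/-- The outward unit conormal at a boundary point `q`: the outward vector `du(-e₀)` is made
orthogonal to the tangent `du(e₁)` of the boundary curve and normalized. -/
def conormal (u : M → E n) (q : M) : E n :=
  let w := (ℝ ∙ du u q (EuclideanSpace.single 1 1))ᗮ.starProjection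
    (-du u q (EuclideanSpace.single 0 1))
  ‖w‖⁻¹ • w

open Classical in
/-- The outward unit conormal `ν_M` as a function of the point `x = u q` of the boundary curve
(`u` is injective on the boundary). -/
def boundaryConormal (u : M → E n) (x : E n) : E n :=
  if h : ∃ q, q ∈ (𝓡∂ 2).boundary M ∧ u q = x then conormal u h.choose else 0

/-- `H` is the mean curvature vector of the branched immersion `u`. -/
structure IsMeanCurvature [MeasurableSpace M] (u : M → E n) (H : M → E n) : Prop where
  integrable : Integrable H (area u)
  normal : ∀ᵐ q ∂area u, H q ∈ (tangentPlane u q)ᗮ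
  firstVariation : ∀ X : E n → E n, ContDiff ℝ 1 X → HasCompactSupport X →
    tsupport X ⊆ (boundaryCurve u)ᶜ →
    ∫ q, tangentialDiv u X q ∂area u = ∫ q, inner ℝ (X (u q)) (H q) ∂area u

/-- The divergence identity up to the boundary. -/
def DivergenceIdentity [MeasurableSpace M] (u : M → E n) (H : M → E n) : Prop :=
  ∀ X : E n → E n, ContDiff ℝ 1 X →
    ∫ q, tangentialDiv u X q ∂area u =
      ∫ q, inner ℝ (X (u q)) (H q) ∂area u +
        ∫ x in boundaryCurve u, inner ℝ (X x) (boundaryConormal u x) ∂μH[1]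

end Surface

/-- The constant `C(p)`. -/
def constC (p : ℝ≥0∞) : ℝ :=
  if p = ⊤ then 1 else 2 * p.toReal / (p.toReal - 2) * (2 / Real.pi) ^ (1 / p.toReal)

/-- The exponent `α = 1 - 2/p`. -/
def expAlpha (p : ℝ≥0∞) : ℝ :=
  if p = ⊤ then 1 else 1 - 2 / p.toReal

end BranchedSurface

end

/-! The proof is a density comparison. Fix a centre `x₀` and a scale `s > 0`, write `w = x - x₀` and
`ρ = s² + |w|²`, and test the divergence identity with the field `w / ρ`. Because the tangent plane
has dimension two, the divergence is `2s²/ρ² + 2|w^⊥|²/ρ²`, where `w^⊥` is the part of `w` normal to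
the surface. As `H` is normal, Young's inequality bounds `⟨w, H⟩/ρ` by `2|w^⊥|²/ρ² + |H|²/8`; the
normal terms cancel, and `∫ 2s²/ρ² dA` is at most the boundary term plus `(1/8)∫|H|²`
(`integral_kernel_le`).

The boundary term is at most a regularized length of the radial projection of `Γ` from `x₀`. For an
inscribed polygon the visual angles sum to at most the exterior angles, so this length is at most
the total curvature `T`, and at most `T - π` when `x₀` lies on `Γ` (`integral_angularSpeed_le`).

As `s → 0`, each preimage of `x₀` of order `m` (order 1 at immersed points) contributes at least
`2πm` to the kernel integral if it is interior and `πm` if it lies on `∂M`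
(`IsLocalModel.eventually_le_setLIntegral`). Taking instead `s = r₀` bounds the area by a multiple
of `r₀²`. With Hölder's inequality and the smallness hypothesis this gives `(1/8)∫|H|² < επ`
(`willmore_energy_le`).

Hence the total density is below `4π` everywhere and below `3π` at points of `Γ`. Two interior
preimages, or an interior branch point, would need `4π`; an interior and a boundary preimage, or a
boundary branch point of order at least three, would need `3π`. Boundary order two is excluded
separately: `Γ` would turn back on itself (`not_hasOrder_two_of_boundary`). So `u` is an injective
immersion of a compact surface. -/

namespace BranchedSurface

/-! ### Total curvature and the length of the radial projection -/

open InnerProductGeometry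

/-- Seen from the origin, a closed polygon subtends at most the sum of its exterior angles. -/
theorem sum_angle_le_polygonCurvature {n k : ℕ} (v : Fin (k + 3) → E n)
    (hv : ∀ i, v (i + 1) ≠ v i) (x : E n) :
    ∑ i, angle (v i - x) (v (i + 1) - x) ≤ polygonCurvature v := by
  -- In the triangle with vertices `x`, `v i`, `v (i + 1)`, the angle at `x` is the difference of
  -- the angles that the two lines of sight make with the edge.
  have h1 : ∀ i, angle (v i - x) (v (i + 1) - x) =
      angle (v i - x) (v (i + 1) - v i) - angle (v (i + 1) - v i) (v (i + 1) - x) := by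
    intro i
    have := angle_eq_angle_add_add_angle_add (v i - x) (sub_ne_zero.2 (hv i))
    rw [show v i - x + (v (i + 1) - v i) = v (i + 1) - x by abel] at this
    linarith
  -- A cyclic shift brings together the two angles measured at the same vertex `v (i + 1)`. Their
  -- difference is at most the exterior angle there, by the triangle inequality for angles.
  have h2 : ∑ i, angle (v i - x) (v (i + 1) - v i) =
      ∑ i, angle (v (i + 1) - x) (v (i + 2) - v (i + 1)) := by
    rw [← Equiv.sum_comp (Equiv.addRight (1 : Fin (k + 3)))]
    refine Finset.sum_congr rfl fun i _ => ?_
    simp only [Equiv.coe_addRight, add_assoc]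
    rfl
  simp only [h1, Finset.sum_sub_distrib, polygonCurvature]
  rw [h2, ← Finset.sum_sub_distrib]
  refine Finset.sum_le_sum fun i _ => ?_
  have := angle_le_angle_add_angle (v (i + 1) - x) (v (i + 1) - v i) (v (i + 2) - v (i + 1))
  rw [angle_comm (v (i + 1) - x) (v (i + 1) - v i)] at this
  linarith

/-- The area of the parallelogram spanned by two vectors. -/
noncomputable def wedgeNorm {n : ℕ} (a b : E n) : ℝ :=
  Real.sqrt (‖a‖ ^ 2 * ‖b‖ ^ 2 - inner ℝ a b ^ 2)

theorem wedgeNorm_nonneg {n : ℕ} (a b : E n) : 0 ≤ wedgeNorm a b := Real.sqrt_nonneg _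

theorem continuous_wedgeNorm {n : ℕ} {α : Type*} [TopologicalSpace α] {f g : α → E n}
    (hf : Continuous f) (hg : Continuous g) : Continuous fun a => wedgeNorm (f a) (g a) :=
  Real.continuous_sqrt.comp
    (((hf.norm.pow 2).mul (hg.norm.pow 2)).sub ((hf.inner hg).pow 2))

theorem wedgeNorm_smul_right {n : ℕ} (a b : E n) {c : ℝ} (hc : 0 ≤ c) :
    wedgeNorm a (c • b) = c * wedgeNorm a b := by
  unfold wedgeNorm
  rw [norm_smul, inner_smul_right, Real.norm_of_nonneg hc,
    show ‖a‖ ^ 2 * (c * ‖b‖) ^ 2 - (c * inner ℝ a b) ^ 2 =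
      c ^ 2 * (‖a‖ ^ 2 * ‖b‖ ^ 2 - inner ℝ a b ^ 2) by ring,
    Real.sqrt_mul (sq_nonneg _), Real.sqrt_sq hc]

theorem wedgeNorm_sub_right {n : ℕ} (a b : E n) : wedgeNorm a (b - a) = wedgeNorm a b := by
  unfold wedgeNorm
  congr 1
  rw [inner_sub_right, norm_sub_sq_real, real_inner_self_eq_norm_sq, real_inner_comm]
  ring

@[simp] theorem wedgeNorm_zero_left {n : ℕ} (b : E n) : wedgeNorm 0 b = 0 := by
  simp [wedgeNorm]

@[simp] theorem wedgeNorm_zero_right {n : ℕ} (b : E n) : wedgeNorm b 0 = 0 := by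
  simp [wedgeNorm]

theorem wedgeNorm_le_angle_mul {n : ℕ} (a b : E n) : wedgeNorm a b ≤ angle a b * (‖a‖ * ‖b‖) := by
  have h := sin_angle_mul_norm_mul_norm a b
  have h1 : wedgeNorm a b = Real.sin (angle a b) * (‖a‖ * ‖b‖) := by
    rw [h]
    unfold wedgeNorm
    congr 1
    simp only [real_inner_self_eq_norm_sq]
    ring
  rw [h1]
  gcongr
  exact Real.sin_le (angle_nonneg a b)

/-- Since `sin θ ≤ θ`, the quotient without `s ^ 2` is already bounded by the angle. The extra term
only lowers it, and keeps it regular where a vector vanishes. -/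
theorem wedgeNorm_div_le_angle {n : ℕ} (a b : E n) {s : ℝ} (hs : 0 < s) :
    wedgeNorm a b / (s ^ 2 + ‖a‖ * ‖b‖) ≤ angle a b := by
  rw [div_le_iff₀ (by positivity)]
  refine (wedgeNorm_le_angle_mul a b).trans ?_
  gcongr
  · exact angle_nonneg a b
  · nlinarith

theorem one_periodic_ne {n : ℕ} {γ : ℝ → E n} (hγ : IsC1ClosedCurve γ) {a b : ℝ}
    (ha : 0 ≤ a) (hab : a < b) (hb : b ≤ 1) (h : 0 < a ∨ b < 1) : γ b ≠ γ a := by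
  intro he
  rcases hb.lt_or_eq with hb | rfl
  · exact hab.ne' (hγ.simple ⟨ha.trans hab.le, hb⟩ ⟨ha, hab.trans hb⟩ he)
  · have h0 : γ 1 = γ 0 := by simpa using hγ.periodic 0
    have := hγ.simple (x₁ := 0) (x₂ := a) ⟨le_rfl, one_pos⟩ ⟨ha, hab⟩ (h0.symm.trans he)
    rcases h with h | h <;> linarith

theorem sum_angle_le_totalCurvature {n : ℕ} {γ : ℝ → E n} (hγ : IsC1ClosedCurve γ)
    {T : ℝ} (hT0 : 0 ≤ T) (hT : totalCurvature γ ≤ ENNReal.ofReal T) (x : E n) {K : ℕ} (hK : 3 ≤ K)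
    {t : ℕ → ℝ} (ht : StrictMonoOn t (Set.Iic K)) (h0 : t 0 = 0) (h1 : t K = 1) :
    ∑ i ∈ Finset.range K, angle (γ (t i) - x) (γ (t (i + 1)) - x) ≤ T := by
  obtain ⟨k, rfl⟩ : ∃ k, K = k + 3 := ⟨K - 3, by omega⟩
  have hmono : StrictMono fun i : Fin (k + 3) => t i := fun i j hij =>
    ht (Set.mem_Iic.2 (by omega)) (Set.mem_Iic.2 (by omega)) hij
  have hIco : ∀ i : Fin (k + 3), t i ∈ Set.Ico (0 : ℝ) 1 := fun i => by
    refine ⟨?_, ?_⟩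
    · rw [← h0]
      exact ht.monotoneOn (Set.mem_Iic.2 (by omega)) (Set.mem_Iic.2 (by omega)) (Nat.zero_le _)
    · rw [← h1]
      exact ht (Set.mem_Iic.2 (by omega)) (Set.mem_Iic.2 (by omega)) i.2
  have hpc : polygonCurvature (fun i : Fin (k + 3) => γ (t i)) ≤ T := by
    rw [← ENNReal.ofReal_le_ofReal_iff hT0]
    refine le_trans ?_ hT
    unfold totalCurvature
    exact le_iSup_of_le k (le_iSup_of_le (fun i => t i) (le_iSup_of_le hmono
      (le_iSup_of_le hIco le_rfl)))
  -- At the last index the cyclic successor has parameter `t 0 = 0`, while the next node is `t K =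
  -- 1`; periodicity identifies the two vertices.
  have hnext : ∀ i : Fin (k + 3), γ (t ((i + 1 : Fin (k + 3)) : ℕ)) = γ (t ((i : ℕ) + 1)) := by
    intro i
    rcases Nat.lt_or_ge ((i : ℕ) + 1) (k + 3) with hi | hi
    · congr 2
      rw [Fin.val_add_one_of_lt']
      omega
    · have hi' : (i : ℕ) + 1 = k + 3 := by omega
      have : i = Fin.last (k + 2) := Fin.ext (by simp; omega)
      rw [hi', h1, this, Fin.last_add_one]
      have h0' : γ 1 = γ 0 := by simpa using hγ.periodic 0
      simp [h0, h0']
  refine le_trans (le_of_eq ?_) ((sum_angle_le_polygonCurvature (fun i : Fin (k + 3) => γ (t i))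
    (fun i => ?_) x).trans hpc)
  · rw [Finset.sum_range]
    exact Finset.sum_congr rfl fun i _ => by rw [hnext]
  · simp only [hnext]
    have hm : t i < t (i + 1) :=
      ht (Set.mem_Iic.2 (by omega)) (Set.mem_Iic.2 (by omega)) (Nat.lt_succ_self _)
    refine one_periodic_ne hγ (hIco i).1 hm ?_ ?_
    · rw [← h1]
      exact ht.monotoneOn (Set.mem_Iic.2 (by omega)) (Set.mem_Iic.2 (by omega)) (by omega)
    · rcases Nat.eq_zero_or_pos (i : ℕ) with hi | hi
      · right
        rw [← h1]
        exact ht (Set.mem_Iic.2 (by omega)) (Set.mem_Iic.2 (by omega)) (by omega)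
      · left
        rw [← h0]
        exact ht (Set.mem_Iic.2 (by omega)) (Set.mem_Iic.2 (by omega)) hi

/-- The average of `γ'` over the segment from `a` to `b` extends the difference quotient
continuously across the diagonal. Uniform continuity on a compact square then replaces a mean value
theorem for vector-valued maps. -/
theorem exists_continuous_diffQuotient {n : ℕ} {γ : ℝ → E n} (hγ : ContDiff ℝ 1 γ) :
    ∃ Δ : ℝ × ℝ → E n, Continuous Δ ∧ (∀ a, Δ (a, a) = deriv γ a) ∧
      ∀ a b, (b - a) • Δ (a, b) = γ b - γ a := by
  have hd : Continuous (deriv γ) := hγ.continuous_deriv le_rfl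
  refine ⟨fun p => ∫ θ in (0 : ℝ)..1, deriv γ (p.1 + θ * (p.2 - p.1)), ?_, ?_, ?_⟩
  · apply intervalIntegral.continuous_parametric_intervalIntegral_of_continuous'
    fun_prop
  · intro a
    simp
  · intro a b
    have h := intervalIntegral.smul_integral_comp_add_mul (a := 0) (b := 1) (deriv γ) (b - a) a
    simp only [mul_comm _ (b - a)]
    rw [h]
    simp only [mul_zero, add_zero, mul_one, add_sub_cancel]
    exact intervalIntegral.integral_deriv_eq_sub
      (fun t _ => hγ.differentiable one_ne_zero t) (hd.intervalIntegrable _ _)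

/-- The regularized angular speed of `γ` seen from `x`. -/
noncomputable def angularSpeed {n : ℕ} (γ : ℝ → E n) (x : E n) (s t : ℝ) : ℝ :=
  wedgeNorm (γ t - x) (deriv γ t) / (s ^ 2 + ‖γ t - x‖ ^ 2)

theorem continuous_angularSpeed {n : ℕ} {γ : ℝ → E n} (hγ : ContDiff ℝ 1 γ) (x : E n) {s : ℝ}
    (hs : 0 < s) : Continuous (angularSpeed γ x s) := by
  have hd : Continuous (deriv γ) := hγ.continuous_deriv le_rfl
  have hc := hγ.continuous
  unfold angularSpeed
  exact (continuous_wedgeNorm (hc.sub continuous_const) hd).div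
    (continuous_const.add ((hc.sub continuous_const).norm.pow 2)) fun t => by positivity

/-- The angular speed is the diagonal value of a continuous function `G` of two parameters, and `(b
- a) * G (a, b)` is exactly the chord quotient, because adding a multiple of `γ a - x` to the second
vector leaves the parallelogram area unchanged. The error is proportional to `b - a`, so the errors
of a partition of `[0, 1]` add up to `τ`. -/
theorem exists_integral_angularSpeed_le {n : ℕ} {γ : ℝ → E n} (hγ : ContDiff ℝ 1 γ) (x : E n)
    {s : ℝ} (hs : 0 < s) {τ : ℝ} (hτ : 0 < τ) :
    ∃ η > 0, ∀ a b : ℝ, 0 ≤ a → a < b → b ≤ 1 → b - a < η →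
      ∫ t in a..b, angularSpeed γ x s t ≤
        wedgeNorm (γ a - x) (γ b - x) / (s ^ 2 + ‖γ a - x‖ * ‖γ b - x‖) + τ * (b - a) := by
  obtain ⟨Δ, hΔ, hΔ0, hΔ1⟩ := exists_continuous_diffQuotient hγ
  have hc := hγ.continuous
  set G : ℝ × ℝ → ℝ := fun p =>
    wedgeNorm (γ p.1 - x) (Δ p) / (s ^ 2 + ‖γ p.1 - x‖ * ‖γ p.2 - x‖) with hG
  have hGc : Continuous G := by
    have hc1 : Continuous fun p : ℝ × ℝ => γ p.1 - x :=
      (hc.comp continuous_fst).sub continuous_const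
    have hc2 : Continuous fun p : ℝ × ℝ => γ p.2 - x :=
      (hc.comp continuous_snd).sub continuous_const
    exact (continuous_wedgeNorm hc1 hΔ).div
      (continuous_const.add (hc1.norm.mul hc2.norm)) fun p => by positivity
  have hunif := (isCompact_Icc (a := ((0 : ℝ), (0 : ℝ))) (b := (1, 1))).uniformContinuousOn_of_continuous
    hGc.continuousOn
  obtain ⟨η, hη, hu⟩ := Metric.uniformContinuousOn_iff.1 hunif τ hτ
  refine ⟨η, hη, fun a b ha hab hb hba => ?_⟩
  have hGab : (b - a) * G (a, b) =
      wedgeNorm (γ a - x) (γ b - x) / (s ^ 2 + ‖γ a - x‖ * ‖γ b - x‖) := by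
    simp only [hG]
    rw [← mul_div_assoc, ← wedgeNorm_smul_right _ _ (by linarith), hΔ1,
      ← wedgeNorm_sub_right _ (γ b - x)]
    congr 2
    abel
  have hGt : ∀ t, G (t, t) = angularSpeed γ x s t := fun t => by
    simp only [hG, angularSpeed, hΔ0, sq]
  have hle : ∀ t ∈ Set.Icc a b, angularSpeed γ x s t ≤ G (a, b) + τ := by
    intro t ht
    have := hu (t, t) ⟨⟨by linarith [ht.1], by linarith [ht.1]⟩, by linarith [ht.2], by linarith [ht.2]⟩
      (a, b) ⟨⟨by linarith, by linarith⟩, by linarith, by linarith⟩ (by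
        rw [Prod.dist_eq, Real.dist_eq, Real.dist_eq]
        refine max_lt ?_ ?_ <;> rw [abs_lt] <;> constructor <;> linarith [ht.1, ht.2])
    rw [Real.dist_eq, hGt] at this
    linarith [le_abs_self (angularSpeed γ x s t - G (a, b))]
  calc ∫ t in a..b, angularSpeed γ x s t ≤ ∫ _ in a..b, (G (a, b) + τ) :=
        intervalIntegral.integral_mono_on hab.le
          ((continuous_angularSpeed hγ x hs).intervalIntegrable _ _)
          (by simp) hle
    _ = _ := by
        rw [intervalIntegral.integral_const, smul_eq_mul, mul_add, hGab]
        ring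

/-- The prescribed `t₀` has to be a node: if `γ t₀` is the centre of projection, the gain of `π`
comes from the two polygon edges meeting there. -/
theorem exists_fine_partition {t₀ : ℝ} (ht₀ : t₀ ∈ Set.Ico (0 : ℝ) 1) {η : ℝ} (hη : 0 < η) :
    ∃ (K : ℕ) (t : ℕ → ℝ), 3 ≤ K ∧ StrictMonoOn t (Set.Iic K) ∧ t 0 = 0 ∧ t K = 1 ∧
      (∀ i < K, t (i + 1) - t i < η) ∧ ∃ j < K, t j = t₀ := by
  obtain ⟨N, hN⟩ := exists_nat_gt (1 / η + 3)
  have hN0 : (0 : ℝ) < N := by linarith [one_div_pos.2 hη]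
  have hN3 : 3 ≤ N := by
    have : (3 : ℝ) < N := by linarith [one_div_pos.2 hη]
    exact_mod_cast this.le
  have hNη : 1 / (N : ℝ) < η := by
    rw [div_lt_iff₀ hN0, ← div_lt_iff₀' hη]
    linarith
  have hNi : (0 : ℝ) < 1 / (N : ℝ) := by positivity
  have hmono : ∀ {t : ℕ → ℝ}, (∀ i, t i < t (i + 1)) → StrictMono t := strictMono_nat_of_lt_succ
  rcases ht₀.1.eq_or_lt with h0 | h0
  · have hstep : ∀ i : ℕ, ((i + 1 : ℕ) : ℝ) / N - (i : ℝ) / N = 1 / N := fun i => by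
      push_cast
      ring
    refine ⟨N, fun i => i / N, hN3, (hmono fun i => ?_).strictMonoOn _, by simp,
      div_self hN0.ne', fun i _ => ?_, 0, by omega, by simp [← h0]⟩
    · linarith [hstep i]
    · linarith [hstep i]
  · have h1 := ht₀.2
    -- `N` equal steps on `[0, t₀]`, followed by `N` equal steps on `[t₀, 1]`.
    set t : ℕ → ℝ := fun i => if i ≤ N then t₀ * (i / N) else t₀ + (1 - t₀) * (i / N - 1) with ht
    have hle : ∀ i, i ≤ N → t i = t₀ * (i / N) := fun i hi => if_pos hi
    have hge : ∀ i, N ≤ i → t i = t₀ + (1 - t₀) * (i / N - 1) := by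
      intro i hi
      rcases hi.eq_or_lt with rfl | hi
      · rw [hle _ le_rfl, div_self hN0.ne']
        ring
      · exact if_neg (by omega)
    have hstep : ∀ i, t (i + 1) - t i = t₀ * (1 / N) ∨ t (i + 1) - t i = (1 - t₀) * (1 / N) := by
      intro i
      rcases Nat.lt_or_ge i N with hi | hi
      · left
        rw [hle i hi.le, hle (i + 1) hi]
        push_cast
        ring
      · right
        rw [hge i hi, hge (i + 1) (by omega)]
        push_cast
        ring
    have h2 : 0 < t₀ * (1 / N) := mul_pos h0 hNi
    have h3 : 0 < (1 - t₀) * (1 / N) := mul_pos (by linarith) hNi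
    refine ⟨2 * N, t, by omega, (hmono fun i => ?_).strictMonoOn _, ?_, ?_, fun i _ => ?_,
      N, by omega, ?_⟩
    · rcases hstep i with h | h <;> linarith
    · rw [hle 0 (by omega)]
      simp
    · rw [hge _ (by omega)]
      push_cast
      field_simp
      ring
    · rcases hstep i with h | h <;> rw [h] <;> nlinarith
    · rw [hle N le_rfl, div_self hN0.ne', mul_one]

/-- The length of the radial projection of a closed curve is at most its total curvature; if the
centre lies on the curve, it is smaller by at least `π`. -/
theorem integral_angularSpeed_le {n : ℕ} {γ : ℝ → E n} (hγ : IsC1ClosedCurve γ)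
    {T : ℝ} (hT0 : 0 ≤ T) (hT : totalCurvature γ ≤ ENNReal.ofReal T) (x : E n) {s : ℝ}
    (hs : 0 < s) {t₀ : ℝ} (ht₀ : t₀ ∈ Set.Ico (0 : ℝ) 1) :
    (∫ t in (0 : ℝ)..1, angularSpeed γ x s t) + (if γ t₀ = x then Real.pi else 0) ≤ T := by
  refine le_of_forall_pos_le_add fun τ hτ => ?_
  obtain ⟨η, hη, hint⟩ := exists_integral_angularSpeed_le hγ.contDiff x hs hτ
  obtain ⟨K, t, hK, hmono, h0, h1, hmesh, j, hj, hjt⟩ := exists_fine_partition ht₀ hη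
  have hsum := sum_angle_le_totalCurvature hγ hT0 hT x hK hmono h0 h1
  set W : ℕ → ℝ := fun i => wedgeNorm (γ (t i) - x) (γ (t (i + 1)) - x) /
    (s ^ 2 + ‖γ (t i) - x‖ * ‖γ (t (i + 1)) - x‖) with hW
  have hWangle : ∀ i, W i ≤ angle (γ (t i) - x) (γ (t (i + 1)) - x) := fun i =>
    wedgeNorm_div_le_angle _ _ hs
  have hpi : ∑ i ∈ Finset.range K, W i + (if γ t₀ = x then Real.pi else 0) ≤
      ∑ i ∈ Finset.range K, angle (γ (t i) - x) (γ (t (i + 1)) - x) := by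
    split_ifs with hx
    swap
    · rw [add_zero]
      exact Finset.sum_le_sum fun i _ => hWangle i
    set d : ℕ → ℝ := fun i => angle (γ (t i) - x) (γ (t (i + 1)) - x) - W i with hd
    -- An angle with the zero vector is `π / 2` by convention, while the quotient `W` vanishes. Each
    -- of the two edges at the vertex `x` therefore leaves a surplus of `π / 2`, together `π`.
    have hdj : d j = Real.pi / 2 := by
      simp only [hd, hW]
      simp [hjt, hx]
    obtain ⟨j', hj', hne, hdj'⟩ : ∃ j' < K, j ≠ j' ∧ d j' = Real.pi / 2 := by
      have hgen : ∀ j', γ (t (j' + 1)) = x → d j' = Real.pi / 2 := by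
        intro j' h
        simp only [hd, hW, h, sub_self]
        simp
      -- The edge ending at `x` precedes the node `j`; for `j = 0` it is the last edge of the closed
      -- polygon.
      rcases Nat.eq_zero_or_pos j with hj0 | hj0
      · refine ⟨K - 1, by omega, by omega, hgen _ ?_⟩
        rw [show K - 1 + 1 = K by omega, h1, ← hx, ← hjt, hj0, h0]
        simpa using hγ.periodic 0
      · refine ⟨j - 1, by omega, by omega, hgen _ ?_⟩
        rw [show j - 1 + 1 = j by omega, hjt, hx]
    have hpair : ∑ i ∈ {j, j'}, d i ≤ ∑ i ∈ Finset.range K, d i :=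
      Finset.sum_le_sum_of_subset_of_nonneg
        (by
          intro i hi
          simp only [Finset.mem_insert, Finset.mem_singleton] at hi
          rcases hi with rfl | rfl <;> simpa)
        fun i _ _ => sub_nonneg.2 (hWangle i)
    rw [Finset.sum_pair hne, hdj, hdj'] at hpair
    simp only [hd, Finset.sum_sub_distrib] at hpair
    linarith
  have hsplit : ∫ t in (0 : ℝ)..1, angularSpeed γ x s t =
      ∑ i ∈ Finset.range K, ∫ t in t i..t (i + 1), angularSpeed γ x s t := by
    rw [intervalIntegral.sum_integral_adjacent_intervals, h0, h1]
    exact fun i _ => (continuous_angularSpeed hγ.contDiff x hs).intervalIntegrable _ _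
  have hbound : ∫ t in (0 : ℝ)..1, angularSpeed γ x s t ≤ ∑ i ∈ Finset.range K, W i + τ := by
    have htel : ∑ i ∈ Finset.range K, τ * (t (i + 1) - t i) = τ := by
      rw [← Finset.mul_sum, Finset.sum_range_sub, h0, h1]
      ring
    rw [hsplit]
    calc _ ≤ ∑ i ∈ Finset.range K, (W i + τ * (t (i + 1) - t i)) := by
          refine Finset.sum_le_sum fun i hi => ?_
          rw [Finset.mem_range] at hi
          refine hint _ _ ?_ ?_ ?_ (hmesh i hi)
          · rw [← h0]
            exact hmono.monotoneOn (Set.mem_Iic.2 (by omega)) (Set.mem_Iic.2 (by omega)) (by omega)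
          · exact hmono (Set.mem_Iic.2 (by omega)) (Set.mem_Iic.2 (by omega)) (by omega)
          · rw [← h1]
            exact hmono.monotoneOn (Set.mem_Iic.2 (by omega)) (Set.mem_Iic.2 (by omega)) (by omega)
      _ = _ := by rw [Finset.sum_add_distrib, htel]
  linarith

/-! ### Hausdorff measure on the boundary curve -/

open Filter Topology

/-- On a piece of `B` of small diameter, `γ` is Lipschitz with constant close to the speed at any of
its points, which controls the Hausdorff measure of the image. One inequality suffices, since the
boundary term is only estimated from above. -/
theorem hausdorffMeasure_image_le_lintegral {n : ℕ} {γ : ℝ → E n} (hγ : ContDiff ℝ 1 γ)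
    {B : Set ℝ} (hB : MeasurableSet B) (hB1 : B ⊆ Set.Ico 0 1) :
    μH[1] (γ '' B) ≤ ∫⁻ t in B, ENNReal.ofReal ‖deriv γ t‖ := by
  obtain ⟨Δ, hΔ, hΔ0, hΔ1⟩ := exists_continuous_diffQuotient hγ
  have hunif := (isCompact_Icc (a := ((0 : ℝ), (0 : ℝ))) (b := (1, 1))).uniformContinuousOn_of_continuous
    hΔ.continuousOn
  have hvol : volume B ≤ 1 := (measure_mono hB1).trans (by simp)
  refine ENNReal.le_of_forall_pos_le_add fun τ hτ _ => ?_
  have hτ' : (0 : ℝ) < τ / 2 := by positivity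
  obtain ⟨η, hη, hu⟩ := Metric.uniformContinuousOn_iff.1 hunif (τ / 2) hτ'
  have hmem : ∀ a ∈ B, ∀ b ∈ B, ((a, b) : ℝ × ℝ) ∈ Set.Icc ((0 : ℝ), (0 : ℝ)) (1, 1) :=
    fun a ha b hb => ⟨⟨(hB1 ha).1, (hB1 hb).1⟩, (hB1 ha).2.le, (hB1 hb).2.le⟩
  obtain ⟨N, hN⟩ := exists_nat_gt (1 / η)
  have hN0 : (0 : ℝ) < N := (one_div_pos.2 hη).trans hN
  set F : ℕ → Set ℝ := fun i => B ∩ {t | ⌊t * N⌋₊ = i} with hF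
  have hFm : ∀ i, MeasurableSet (F i) := fun i =>
    hB.inter ((Nat.measurable_floor.comp (measurable_id.mul_const _)) (measurableSet_singleton i))
  have hFU : ⋃ i, F i = B := by
    ext t
    simp [hF]
  have hFd : Pairwise (Function.onFun Disjoint F) := by
    intro i j hij
    refine Set.disjoint_left.2 fun t ht ht' => hij (ht.2.symm.trans ht'.2)
  have hclose : ∀ i, ∀ a ∈ F i, ∀ b ∈ F i, |a - b| < η := by
    intro i a ha b hb
    have h1 := Nat.floor_le (mul_nonneg (hB1 ha.1).1 hN0.le)
    have h2 := Nat.lt_floor_add_one (a * N)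
    have h3 := Nat.floor_le (mul_nonneg (hB1 hb.1).1 hN0.le)
    have h4 := Nat.lt_floor_add_one (b * N)
    rw [ha.2] at h1 h2
    rw [hb.2] at h3 h4
    rw [div_lt_iff₀ hη] at hN
    rw [abs_lt]
    constructor <;> nlinarith
  have hpiece : ∀ i, μH[1] (γ '' F i) ≤ ∫⁻ t in F i, (ENNReal.ofReal ‖deriv γ t‖ + τ) := by
    intro i
    rcases (F i).eq_empty_or_nonempty with he | ⟨c, hc⟩
    · simp [he]
    have hest : ∀ a ∈ F i, ∀ b ∈ F i, ‖Δ (a, b) - deriv γ c‖ < τ / 2 := by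
      intro a ha b hb
      have := hu (a, b) (hmem a ha.1 b hb.1) (c, c) (hmem c hc.1 c hc.1)
        (by rw [Prod.dist_eq]; exact max_lt (hclose i a ha c hc) (hclose i b hb c hc))
      rwa [dist_eq_norm, hΔ0] at this
    have hlip : LipschitzOnWith (‖deriv γ c‖₊ + τ / 2) γ (F i) := by
      refine LipschitzOnWith.of_dist_le_mul fun a ha b hb => ?_
      rw [dist_eq_norm, ← hΔ1, norm_smul, dist_eq_norm, mul_comm]
      gcongr
      have := norm_add_le (Δ (b, a) - deriv γ c) (deriv γ c)
      rw [sub_add_cancel] at this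
      have h2 := hest b hb a ha
      push_cast
      linarith
    have h1 := hlip.hausdorffMeasure_image_le (d := 1) zero_le_one
    rw [ENNReal.rpow_one, hausdorffMeasure_real] at h1
    refine h1.trans ?_
    rw [← setLIntegral_const]
    refine setLIntegral_mono_ae' (hFm i) (Eventually.of_forall fun t ht => ?_)
    have h2 := hest t ht t ht
    rw [hΔ0] at h2
    have h3 := norm_sub_norm_le (deriv γ c) (deriv γ t)
    rw [norm_sub_rev] at h3
    have h4 : ((‖deriv γ c‖₊ + τ / 2 : NNReal) : ℝ≥0∞) = ENNReal.ofReal (‖deriv γ c‖ + τ / 2) := by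
      rw [← ENNReal.ofReal_coe_nnreal]
      push_cast
      rfl
    rw [h4, ← ENNReal.ofReal_coe_nnreal (p := τ),
      ← ENNReal.ofReal_add (norm_nonneg _) (NNReal.coe_nonneg τ)]
    exact ENNReal.ofReal_le_ofReal (by linarith)
  calc μH[1] (γ '' B) = μH[1] (⋃ i, γ '' F i) := by rw [← Set.image_iUnion, hFU]
    _ ≤ ∑' i, μH[1] (γ '' F i) := measure_iUnion_le _
    _ ≤ ∑' i, ∫⁻ t in F i, (ENNReal.ofReal ‖deriv γ t‖ + τ) := ENNReal.tsum_le_tsum hpiece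
    _ = ∫⁻ t in B, (ENNReal.ofReal ‖deriv γ t‖ + τ) := by
        rw [← lintegral_iUnion hFm hFd, hFU]
    _ = (∫⁻ t in B, ENNReal.ofReal ‖deriv γ t‖) + τ * volume B := by
        rw [lintegral_add_right _ measurable_const, setLIntegral_const]
    _ ≤ _ := by
        gcongr
        exact mul_le_of_le_one_right' hvol

/-- The bound is a domination of measures, so `f` may be arbitrary. This spares any proof that the
conormal is measurable along the curve. -/
theorem lintegral_hausdorffMeasure_range_le {n : ℕ} {γ : ℝ → E n} (hγ : IsC1ClosedCurve γ)
    (f : E n → ℝ≥0∞) :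
    ∫⁻ x in Set.range γ, f x ∂μH[1] ≤
      ∫⁻ t in Set.Ico (0 : ℝ) 1, ENNReal.ofReal ‖deriv γ t‖ * f (γ t) := by
  have hc := hγ.contDiff.continuous
  have hd : Continuous (deriv γ) := hγ.contDiff.continuous_deriv le_rfl
  set m : Measure ℝ := (volume.restrict (Set.Ico (0 : ℝ) 1)).withDensity
    fun t => ENNReal.ofReal ‖deriv γ t‖ with hm
  have hmeas : Measurable fun t => ENNReal.ofReal ‖deriv γ t‖ := hd.norm.measurable.ennreal_ofReal
  have hle : (μH[1] : Measure (E n)).restrict (Set.range γ) ≤ m.map γ := by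
    refine Measure.le_iff.2 fun A hA => ?_
    rw [Measure.restrict_apply hA, Measure.map_apply hc.measurable hA, hm,
      withDensity_apply _ (hc.measurable hA), Measure.restrict_restrict (hc.measurable hA)]
    refine le_trans (measure_mono ?_) (hausdorffMeasure_image_le_lintegral hγ.contDiff
      ((hc.measurable hA).inter measurableSet_Ico) Set.inter_subset_right)
    rintro _ ⟨hx, t, rfl⟩
    obtain ⟨t', ht', he⟩ := hγ.periodic.exists_mem_Ico₀ one_pos t
    refine ⟨t', ⟨?_, ht'⟩, he.symm⟩
    rw [Set.mem_preimage, ← he]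
    exact hx
  refine (lintegral_mono' hle le_rfl).trans ((lintegral_map_le _ _).trans ?_)
  rw [hm, lintegral_withDensity_eq_lintegral_mul_non_measurable _ hmeas
    (Eventually.of_forall fun t => ENNReal.ofReal_lt_top)]
  rfl

/-! ### Local geometry of a simple closed curve -/

theorem exists_int_of_eq {n : ℕ} {γ : ℝ → E n} (hγ : IsC1ClosedCurve γ) {a b : ℝ}
    (h : γ a = γ b) : ∃ m : ℤ, a = b + m := by
  have hf : ∀ a, γ (Int.fract a) = γ a := fun a => by
    have := hγ.periodic.sub_int_mul_eq ⌊a⌋ (x := a)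
    rwa [mul_one] at this
  have := hγ.simple ⟨Int.fract_nonneg a, Int.fract_lt_one a⟩ ⟨Int.fract_nonneg b, Int.fract_lt_one b⟩
    ((hf a).trans (h.trans (hf b).symm))
  obtain ⟨m, hm⟩ := Int.fract_eq_fract.1 this
  exact ⟨m, by linarith⟩

/-- Points of a simple closed curve close to `γ t₀` have parameters close to `t₀`. -/
theorem exists_param_near {n : ℕ} {γ : ℝ → E n} (hγ : IsC1ClosedCurve γ) (t₀ : ℝ) {η : ℝ}
    (hη : 0 < η) : ∃ r > 0, ∀ x ∈ Set.range γ, ‖x - γ t₀‖ < r → ∃ t, |t - t₀| < η ∧ γ t = x := by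
  have hK : IsCompact (γ '' Set.Icc (t₀ + η) (t₀ + 1 - η)) :=
    isCompact_Icc.image hγ.contDiff.continuous
  have hnot : γ t₀ ∉ γ '' Set.Icc (t₀ + η) (t₀ + 1 - η) := by
    rintro ⟨t, ht, he⟩
    obtain ⟨m, hm⟩ := exists_int_of_eq hγ he
    have h1 : (0 : ℝ) < m := by linarith [ht.1]
    have h2 : (m : ℝ) < 1 := by linarith [ht.2]
    have h1' : 0 < m := by exact_mod_cast h1
    have h2' : m < 1 := by exact_mod_cast h2
    omega
  obtain ⟨r, hr, hball⟩ := Metric.isOpen_iff.1 hK.isClosed.isOpen_compl _ hnot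
  refine ⟨r, hr, ?_⟩
  rintro x hx hxr
  obtain ⟨t', rfl⟩ := hx
  obtain ⟨t, ht, he⟩ := hγ.periodic.exists_mem_Ico one_pos t' t₀
  rcases lt_or_ge t (t₀ + η) with h | h
  · exact ⟨t, by rw [abs_lt]; constructor <;> linarith [ht.1], he.symm⟩
  rcases lt_or_ge (t₀ + 1 - η) t with h' | h'
  · refine ⟨t - 1, by rw [abs_lt]; constructor <;> linarith [ht.2], ?_⟩
    rw [he]
    exact hγ.periodic.sub_eq t
  · exact absurd ⟨t, ⟨h, h'⟩, he.symm⟩ (hball (by rwa [Metric.mem_ball, dist_eq_norm]))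

/-- A `C¹` curve is tangent to its derivative. -/
theorem eventually_norm_normalProjection_le {n : ℕ} {γ : ℝ → E n} (hγ : IsC1ClosedCurve γ) (t₀ : ℝ)
    {τ : ℝ} (hτ : 0 < τ) :
    ∀ᶠ x in 𝓝 (γ t₀), x ∈ Set.range γ →
      ‖(ℝ ∙ deriv γ t₀)ᗮ.starProjection (x - γ t₀)‖ ≤ τ * ‖x - γ t₀‖ := by
  obtain ⟨Δ, hΔ, hΔ0, hΔ1⟩ := exists_continuous_diffQuotient hγ.contDiff
  set v := deriv γ t₀ with hv
  have hv0 : 0 < ‖v‖ := norm_pos_iff.2 (hγ.regular t₀)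
  have hc : Tendsto (fun t => Δ (t₀, t)) (𝓝 t₀) (𝓝 v) := by
    rw [hv, ← hΔ0]
    exact (hΔ.comp (by fun_prop : Continuous fun t : ℝ => (t₀, t))).tendsto t₀
  -- The first bound keeps the difference quotient at least `‖v‖ / 2` long; the second makes its
  -- normal part at most `τ` times that length.
  set κ := min (‖v‖ / 2) (τ * ‖v‖ / 2) with hκ
  have hκ0 : 0 < κ := by positivity
  obtain ⟨η, hη, hclose⟩ := Metric.tendsto_nhds_nhds.1 hc κ hκ0
  obtain ⟨r, hr, hpar⟩ := exists_param_near hγ t₀ hη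
  filter_upwards [Metric.ball_mem_nhds _ hr] with x hx hxr
  obtain ⟨t, ht, rfl⟩ := hpar x hxr (by rwa [Metric.mem_ball, dist_eq_norm] at hx)
  have h1 := hclose (show dist t t₀ < η from ht)
  rw [dist_eq_norm] at h1
  have hQv : (ℝ ∙ v)ᗮ.starProjection v = 0 := by
    rw [Submodule.starProjection_orthogonal_val]
    simp [Submodule.starProjection_eq_self_iff.2 (Submodule.mem_span_singleton_self v)]
  have h2 : ‖(ℝ ∙ v)ᗮ.starProjection (Δ (t₀, t))‖ ≤ κ := by
    have : (ℝ ∙ v)ᗮ.starProjection (Δ (t₀, t)) = (ℝ ∙ v)ᗮ.starProjection (Δ (t₀, t) - v) := by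
      rw [map_sub, hQv, sub_zero]
    rw [this]
    exact (Submodule.norm_starProjection_apply_le _ _).trans h1.le
  have h3 : ‖v‖ / 2 ≤ ‖Δ (t₀, t)‖ := by
    have := norm_sub_norm_le v (Δ (t₀, t))
    rw [norm_sub_rev] at this
    linarith [min_le_left (‖v‖ / 2) (τ * ‖v‖ / 2)]
  have h4 : κ ≤ τ * ‖Δ (t₀, t)‖ := by
    refine (min_le_right _ _).trans ?_
    rw [mul_div_assoc]
    gcongr
  rw [← hΔ1, map_smul, norm_smul, norm_smul]
  calc ‖t - t₀‖ * ‖(ℝ ∙ v)ᗮ.starProjection (Δ (t₀, t))‖ ≤ ‖t - t₀‖ * (τ * ‖Δ (t₀, t)‖) := by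
        gcongr
        exact h2.trans h4
    _ = _ := by ring

/-- Near `(t₀, t₀)` the difference quotient has positive inner product with `γ' t₀`, so the height
along the tangent is strictly monotone in the parameter. -/
theorem exists_injOn_inner_deriv {n : ℕ} {γ : ℝ → E n} (hγ : IsC1ClosedCurve γ) (t₀ : ℝ) :
    ∃ r > 0, Set.InjOn (fun x => inner ℝ (x - γ t₀) (deriv γ t₀))
      (Set.range γ ∩ Metric.ball (γ t₀) r) := by
  obtain ⟨Δ, hΔ, hΔ0, hΔ1⟩ := exists_continuous_diffQuotient hγ.contDiff
  set v := deriv γ t₀ with hv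
  have hpos : ∀ᶠ p in 𝓝 (t₀, t₀), 0 < inner ℝ (Δ p) v := by
    have hc : Continuous fun p => inner ℝ (Δ p) v := hΔ.inner continuous_const
    refine hc.continuousAt.eventually (lt_mem_nhds ?_)
    simp only [hΔ0, ← hv, real_inner_self_eq_norm_sq]
    exact pow_pos (norm_pos_iff.2 (hγ.regular t₀)) 2
  obtain ⟨η, hη, hball⟩ := Metric.eventually_nhds_iff.1 hpos
  obtain ⟨r, hr, hpar⟩ := exists_param_near hγ t₀ hη
  refine ⟨r, hr, ?_⟩
  rintro x ⟨hx, hxr⟩ y ⟨hy, hyr⟩ hxy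
  rw [Metric.mem_ball, dist_eq_norm] at hxr hyr
  obtain ⟨a, ha, rfl⟩ := hpar x hx hxr
  obtain ⟨b, hb, rfl⟩ := hpar y hy hyr
  have h1 : inner ℝ (γ b - γ a) v = 0 := by
    have : γ b - γ a = (γ b - γ t₀) - (γ a - γ t₀) := by abel
    rw [this, inner_sub_left]
    simp only at hxy
    linarith
  rw [← hΔ1, inner_smul_left] at h1
  have h2 := hball (y := (a, b)) (by rw [Prod.dist_eq]; exact max_lt ha hb)
  rcases mul_eq_zero.1 h1 with h | h
  · have : b - a = 0 := by simpa using h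
    rw [show a = b by linarith]
  · exact absurd h h2.ne'

/-- The leading coefficient of a map into the curve is tangent to the curve. -/
theorem normalProjection_eq_zero_of_tendsto {n : ℕ} {γ : ℝ → E n} (hγ : IsC1ClosedCurve γ) (t₀ : ℝ)
    {σ : ℝ → E n} {k : ℕ} (hk : k ≠ 0) {v : E n} (hσ : ∀ᶠ s in 𝓝 0, σ s ∈ Set.range γ)
    (hlim : Tendsto (fun s => (s ^ k)⁻¹ • (σ s - γ t₀)) (𝓝[≠] 0) (𝓝 v)) :
    (ℝ ∙ deriv γ t₀)ᗮ.starProjection v = 0 := by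
  have hpow : Tendsto (fun s : ℝ => s ^ k) (𝓝[≠] 0) (𝓝 0) := by
    have : Tendsto (fun s : ℝ => s ^ k) (𝓝 0) (𝓝 (0 ^ k)) := (continuous_pow k).tendsto 0
    rw [zero_pow hk] at this
    exact this.mono_left nhdsWithin_le_nhds
  have hσ0 : Tendsto σ (𝓝[≠] 0) (𝓝 (γ t₀)) := by
    have h1 := hpow.smul hlim
    rw [zero_smul] at h1
    have h2 := h1.add_const (γ t₀)
    rw [zero_add] at h2
    refine h2.congr' ?_
    filter_upwards [self_mem_nhdsWithin] with s hs
    rw [smul_smul, mul_inv_cancel₀ (pow_ne_zero k hs), one_smul, sub_add_cancel]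
  have hle : ∀ τ > 0, ‖(ℝ ∙ deriv γ t₀)ᗮ.starProjection v‖ ≤ τ * ‖v‖ := by
    intro τ hτ
    have hl := (((ℝ ∙ deriv γ t₀)ᗮ.starProjection.continuous.tendsto v).comp hlim).norm
    refine le_of_tendsto_of_tendsto hl (hlim.norm.const_mul τ) ?_
    filter_upwards [hσ0.eventually (eventually_norm_normalProjection_le hγ t₀ hτ),
      nhdsWithin_le_nhds hσ] with s h1 h2
    simp only [Function.comp, map_smul, norm_smul]
    have := mul_le_mul_of_nonneg_left (h1 h2) (norm_nonneg (s ^ k)⁻¹)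
    linarith
  rw [← norm_le_zero_iff]
  refine le_of_forall_pos_le_add fun τ hτ => ?_
  have := hle (τ / (‖v‖ + 1)) (by positivity)
  refine this.trans ?_
  rw [zero_add, div_mul_eq_mul_div, div_le_iff₀ (by positivity)]
  nlinarith [norm_nonneg v]

/-! ### The Jacobian -/

section Jacobian

variable {n : ℕ}

theorem det_eq_coord (T : E 2 →L[ℝ] E 2) :
    T.det = T (EuclideanSpace.single 0 1) 0 * T (EuclideanSpace.single 1 1) 1 -
      T (EuclideanSpace.single 1 1) 0 * T (EuclideanSpace.single 0 1) 1 := by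
  rw [ContinuousLinearMap.det,
    ← LinearMap.det_toMatrix (EuclideanSpace.basisFun (Fin 2) ℝ).toBasis, Matrix.det_fin_two]
  simp [LinearMap.toMatrix_apply]

theorem jacobian_eq_wedgeNorm (D : E 2 →L[ℝ] E n) :
    jacobian D = wedgeNorm (D (EuclideanSpace.single 0 1)) (D (EuclideanSpace.single 1 1)) := by
  have h : ∀ (x : E 2) (i : Fin 2), x i = inner ℝ (EuclideanSpace.single i (1 : ℝ)) x := by
    intro x i
    simp [EuclideanSpace.inner_single_left]
  rw [jacobian, wedgeNorm, det_eq_coord]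
  congr 1
  simp only [ContinuousLinearMap.comp_apply]
  rw [h, h, h, h]
  simp only [ContinuousLinearMap.adjoint_inner_right, real_inner_self_eq_norm_sq]
  rw [real_inner_comm (D (EuclideanSpace.single 0 1)) (D (EuclideanSpace.single 1 1))]
  ring

theorem eq_smul_add_smul_single (x : E 2) :
    x = x 0 • EuclideanSpace.single 0 (1 : ℝ) + x 1 • EuclideanSpace.single 1 (1 : ℝ) := by
  ext i
  fin_cases i <;> simp

theorem wedgeNorm_comb (x y : E n) (a b c d : ℝ) :
    wedgeNorm (a • x + c • y) (b • x + d • y) = |a * d - b * c| * wedgeNorm x y := by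
  rw [wedgeNorm, wedgeNorm, ← Real.sqrt_sq_eq_abs, ← Real.sqrt_mul (sq_nonneg _)]
  congr 1
  simp only [← real_inner_self_eq_norm_sq, inner_add_left, inner_add_right, inner_smul_left,
    inner_smul_right, real_inner_comm x y, RCLike.conj_to_real]
  ring

theorem jacobian_comp (D : E 2 →L[ℝ] E n) (T : E 2 →L[ℝ] E 2) :
    jacobian (D ∘L T) = |T.det| * jacobian D := by
  rw [jacobian_eq_wedgeNorm, jacobian_eq_wedgeNorm, det_eq_coord, ContinuousLinearMap.comp_apply,
    ContinuousLinearMap.comp_apply]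
  conv_lhs =>
    rw [eq_smul_add_smul_single (T (EuclideanSpace.single 0 1)),
      eq_smul_add_smul_single (T (EuclideanSpace.single 1 1))]
  simp only [map_add, map_smul]
  exact wedgeNorm_comb _ _ _ _ _ _

theorem continuous_jacobian : Continuous (jacobian : (E 2 →L[ℝ] E n) → ℝ) := by
  have : (jacobian : (E 2 →L[ℝ] E n) → ℝ) = fun D =>
      wedgeNorm (D (EuclideanSpace.single 0 1)) (D (EuclideanSpace.single 1 1)) :=
    funext jacobian_eq_wedgeNorm
  rw [this]
  exact continuous_wedgeNorm (by fun_prop) (by fun_prop)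

theorem jacobian_nonneg (D : E 2 →L[ℝ] E n) : 0 ≤ jacobian D := Real.sqrt_nonneg _

theorem jacobian_eq_zero_of_not_injective {D : E 2 →L[ℝ] E n} (h : ¬ Function.Injective D) :
    jacobian D = 0 := by
  have : ¬ Function.Injective (ContinuousLinearMap.adjoint D ∘L D) := fun h' =>
    h (Function.Injective.of_comp (f := ContinuousLinearMap.adjoint D) h')
  rw [jacobian]
  have h0 : (ContinuousLinearMap.adjoint D ∘L D).det = 0 := by
    by_contra hne
    apply this
    have hu : IsUnit (ContinuousLinearMap.adjoint D ∘L D).toLinearMap :=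
      (LinearMap.isUnit_iff_isUnit_det _).2 (isUnit_iff_ne_zero.2 hne)
    exact ((Module.End.isUnit_iff _).1 hu).1
  rw [h0, Real.sqrt_zero]

/-- Orthogonal projection onto a plane does not increase area. -/
theorem wedgeNorm_le_of_isometry (P : ℂ →ₗᵢ[ℝ] E n) (a b : ℂ) (a' b' : E n)
    (ha : ∀ w, inner ℝ (P w) a' = 0) (hb : ∀ w, inner ℝ (P w) b' = 0) :
    wedgeNorm (P a) (P b) ≤ wedgeNorm (P a + a') (P b + b') := by
  unfold wedgeNorm
  apply Real.sqrt_le_sqrt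
  have e1 : ‖P a + a'‖ ^ 2 = ‖P a‖ ^ 2 + ‖a'‖ ^ 2 := by
    rw [norm_add_sq_real, ha]
    ring
  have e2 : ‖P b + b'‖ ^ 2 = ‖P b‖ ^ 2 + ‖b'‖ ^ 2 := by
    rw [norm_add_sq_real, hb]
    ring
  have e3 : inner ℝ (P a + a') (P b + b') = inner ℝ (P a) (P b) + inner ℝ a' b' := by
    rw [inner_add_left, inner_add_right, inner_add_right, hb, real_inner_comm (P b) a', ha]
    ring
  rw [e1, e2, e3]
  have c1 := abs_real_inner_le_norm (P a) (P b)
  have c2 := abs_real_inner_le_norm a' b'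
  have c3 : inner ℝ (P a) (P b) * inner ℝ a' b' ≤ (‖P a‖ * ‖P b‖) * (‖a'‖ * ‖b'‖) := by
    refine (le_abs_self _).trans ?_
    rw [abs_mul]
    gcongr
  have c4 : inner ℝ a' b' ^ 2 ≤ (‖a'‖ * ‖b'‖) ^ 2 := by
    rw [← sq_abs]
    gcongr
  -- The mixed squares `‖P a‖²‖b'‖² + ‖P b‖²‖a'‖²` absorb twice the product of the two inner
  -- products.
  nlinarith [sq_nonneg (‖P a‖ * ‖b'‖ - ‖P b‖ * ‖a'‖)]

end Jacobian

/-! ### Local representatives and the area measure -/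

section Area

variable {n : ℕ} {M : Type*} [TopologicalSpace M] [ChartedSpace (EuclideanHalfSpace 2) M]

/-- The differential of `u` in the chart at `p`. -/
noncomputable def chartDeriv (u : M → E n) (p : M) (x : E 2) : E 2 →L[ℝ] E n :=
  fderivWithin ℝ (u ∘ (extChartAt (𝓡∂ 2) p).symm) (Set.range (𝓡∂ 2)) x

theorem measurableSet_extChartAt_target (p : M) : MeasurableSet (extChartAt (𝓡∂ 2) p).target := by
  rw [extChartAt_target]
  exact ((chartAt _ p).open_target.preimage (𝓡∂ 2).continuous_symm).measurableSet.inter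
    (𝓡∂ 2).isClosed_range.measurableSet

theorem uniqueDiffWithinAt_range {p : M} {x : E 2} (hx : x ∈ (extChartAt (𝓡∂ 2) p).target) :
    UniqueDiffWithinAt ℝ (Set.range (𝓡∂ 2)) x :=
  (𝓡∂ 2).uniqueDiffOn x (extChartAt_target_subset_range p hx)

theorem eventually_mem_target {p : M} {x : E 2} (hx : x ∈ (extChartAt (𝓡∂ 2) p).target) :
    ∀ᶠ y in 𝓝[Set.range (𝓡∂ 2)] x, y ∈ (extChartAt (𝓡∂ 2) p).target :=
  extChartAt_target_mem_nhdsWithin_of_mem hx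

theorem aemeasurable_extChartAt_symm [MeasurableSpace M] [BorelSpace M] (p : M)
    (f : E 2 → ℝ≥0∞) :
    AEMeasurable (extChartAt (𝓡∂ 2) p).symm
      ((volume.restrict (extChartAt (𝓡∂ 2) p).target).withDensity f) :=
  ((continuousOn_extChartAt_symm p).aemeasurable (measurableSet_extChartAt_target p)).mono_ac
    (withDensity_absolutelyContinuous _ _)

theorem measurableSet_symm_preimage_inter_target [MeasurableSpace M] [BorelSpace M] (p : M)
    {A : Set M} (hA : MeasurableSet A) :
    MeasurableSet ((extChartAt (𝓡∂ 2) p).symm ⁻¹' A ∩ (extChartAt (𝓡∂ 2) p).target) := by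
  have h := (continuousOn_extChartAt_symm (I := 𝓡∂ 2) p).domRestrict.measurable hA
  convert (measurableSet_extChartAt_target p).subtype_image h using 1
  ext x
  simp

theorem chartArea_apply [MeasurableSpace M] [BorelSpace M] (u : M → E n) (p : M) {A : Set M}
    (hA : MeasurableSet A) :
    chartArea u p A = ∫⁻ x in (extChartAt (𝓡∂ 2) p).symm ⁻¹' A ∩ (extChartAt (𝓡∂ 2) p).target,
      ENNReal.ofReal (jacobian (chartDeriv u p x)) := by
  rw [chartArea, Measure.map_apply_of_aemeasurable (aemeasurable_extChartAt_symm p _) hA,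
    withDensity_apply', Measure.restrict_restrict' (measurableSet_extChartAt_target p)]
  rfl

theorem du_eq_chartDeriv {u : M → E n} (hu : ContMDiff (𝓡∂ 2) 𝓘(ℝ, E n) 1 u) (q : M) :
    du u q = chartDeriv u q (extChartAt (𝓡∂ 2) q q) := by
  exact (hu.mdifferentiableAt one_ne_zero).mfderiv

variable [IsManifold (𝓡∂ 2) ∞ M]

theorem isManifold_one : IsManifold (𝓡∂ 2) 1 M :=
  IsManifold.of_le (n := ∞) (by exact_mod_cast le_top)

theorem contDiffOn_comp_extChartAt_symm {F : Type*} [NormedAddCommGroup F] [NormedSpace ℝ F]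
    {u : M → F} (hu : ContMDiff (𝓡∂ 2) 𝓘(ℝ, F) 1 u) (p : M) :
    ContDiffOn ℝ 1 (u ∘ (extChartAt (𝓡∂ 2) p).symm) (extChartAt (𝓡∂ 2) p).target := by
  have := isManifold_one (M := M)
  rw [← contMDiffOn_iff_contDiffOn]
  exact hu.comp_contMDiffOn (contMDiffOn_extChartAt_symm p)

theorem hasFDerivWithinAt_chartDeriv {u : M → E n} (hu : ContMDiff (𝓡∂ 2) 𝓘(ℝ, E n) 1 u) {p : M}
    {x : E 2} (hx : x ∈ (extChartAt (𝓡∂ 2) p).target) :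
    HasFDerivWithinAt (u ∘ (extChartAt (𝓡∂ 2) p).symm) (chartDeriv u p x) (Set.range (𝓡∂ 2)) x :=
  (((contDiffOn_comp_extChartAt_symm hu p x hx).differentiableWithinAt
    one_ne_zero).mono_of_mem_nhdsWithin (eventually_mem_target hx)).hasFDerivWithinAt

theorem continuousOn_chartDeriv {u : M → E n} (hu : ContMDiff (𝓡∂ 2) 𝓘(ℝ, E n) 1 u) (p : M) :
    ContinuousOn (chartDeriv u p) (extChartAt (𝓡∂ 2) p).target := by
  have h := (contDiffOn_comp_extChartAt_symm hu p).continuousOn_fderivWithin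
    (uniqueDiffOn_extChartAt_target p) le_rfl
  refine h.congr fun x hx => ?_
  exact ((hasFDerivWithinAt_chartDeriv hu hx).mono
    (extChartAt_target_subset_range p)).fderivWithin (uniqueDiffOn_extChartAt_target p x hx) |>.symm

/-- The transition map between two charts. -/
noncomputable def transition (p q : M) : E 2 → E 2 :=
  extChartAt (𝓡∂ 2) p ∘ (extChartAt (𝓡∂ 2) q).symm

/-- Derivatives are taken within the closed half plane, where chart targets are relative
neighbourhoods of their points; boundary points then need no separate chain rule. -/
theorem exists_transition_deriv {u : M → E n} (hu : ContMDiff (𝓡∂ 2) 𝓘(ℝ, E n) 1 u) (p q : M)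
    {x : E 2} (hx : x ∈ (extChartAt (𝓡∂ 2) q).target)
    (hxp : (extChartAt (𝓡∂ 2) q).symm x ∈ (extChartAt (𝓡∂ 2) p).source) :
    HasFDerivWithinAt (transition p q)
        (fderivWithin ℝ (transition p q) (Set.range (𝓡∂ 2)) x) (Set.range (𝓡∂ 2)) x ∧
      (fderivWithin ℝ (transition p q) (Set.range (𝓡∂ 2)) x).IsInvertible ∧
      chartDeriv u q x = chartDeriv u p (transition p q x) ∘L
        fderivWithin ℝ (transition p q) (Set.range (𝓡∂ 2)) x := by
  have hsrc : x ∈ ((extChartAt (𝓡∂ 2) q).symm ≫ extChartAt (𝓡∂ 2) p).source := ⟨hx, hxp⟩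
  have h1 : HasFDerivWithinAt (transition p q)
      (fderivWithin ℝ (transition p q) (Set.range (𝓡∂ 2)) x) (Set.range (𝓡∂ 2)) x :=
    ((contDiffWithinAt_ext_coord_change (n := ∞) p q hsrc).differentiableWithinAt
      (by simp)).hasFDerivWithinAt
  refine ⟨h1, ?_, ?_⟩
  · have h := ModelWithCorners.isInvertible_fderivWithin_extendCoordChange (n := ∞) (by simp)
      (IsManifold.chart_mem_maximalAtlas (I := 𝓡∂ 2) q) (IsManifold.chart_mem_maximalAtlas p) hsrc
    have h2 : fderivWithin ℝ (transition p q) (Set.range (𝓡∂ 2)) x = fderivWithin ℝ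
        (transition p q) ((extChartAt (𝓡∂ 2) q).symm ≫ extChartAt (𝓡∂ 2) p).source x :=
      fderivWithin_of_mem_nhdsWithin
        (ModelWithCorners.extendCoordChange_source_mem_nhdsWithin hsrc)
        (uniqueDiffWithinAt_range hx)
        (h1.differentiableWithinAt.mono fun y hy => extChartAt_target_subset_range q hy.1)
    rw [h2]
    exact h
  · have hmaps : Set.MapsTo (transition p q) (Set.range (𝓡∂ 2)) (Set.range (𝓡∂ 2)) := by
      intro y _
      simp [transition]
    have ht : transition p q x ∈ (extChartAt (𝓡∂ 2) p).target :=
      (extChartAt (𝓡∂ 2) p).map_source hxp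
    have h2 := (hasFDerivWithinAt_chartDeriv hu ht).comp x h1 hmaps
    refine HasFDerivWithinAt.fderivWithin ?_ (uniqueDiffWithinAt_range hx)
    refine h2.congr_of_eventuallyEq ?_ ?_
    · have hc : ∀ᶠ y in 𝓝[Set.range (𝓡∂ 2)] x,
          (extChartAt (𝓡∂ 2) q).symm y ∈ (extChartAt (𝓡∂ 2) p).source :=
        (continuousAt_extChartAt_symm'' hx).continuousWithinAt.eventually
          ((isOpen_extChartAt_source p).mem_nhds hxp)
      filter_upwards [hc] with y hy
      simp only [transition, Function.comp_apply, (extChartAt (𝓡∂ 2) p).left_inv hy]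
    · simp only [transition, Function.comp_apply, (extChartAt (𝓡∂ 2) p).left_inv hxp]

/-- `du u q` is computed in the chart at `q`, which varies with `q`. An invertible right factor
passes to a fixed chart without changing injectivity or range, so both can be studied there. -/
theorem exists_invertible_chartDeriv_eq {u : M → E n} (hu : ContMDiff (𝓡∂ 2) 𝓘(ℝ, E n) 1 u)
    (p : M) {q : M} (hq : q ∈ (extChartAt (𝓡∂ 2) p).source) :
    ∃ T : E 2 ≃L[ℝ] E 2, chartDeriv u p (extChartAt (𝓡∂ 2) p q) = du u q ∘L T := by
  have h := exists_transition_deriv hu q p ((extChartAt (𝓡∂ 2) p).map_source hq)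
    (by rw [(extChartAt (𝓡∂ 2) p).left_inv hq]; exact mem_extChartAt_source q)
  obtain ⟨T, hT⟩ := h.2.1
  refine ⟨T, ?_⟩
  have e : transition q p (extChartAt (𝓡∂ 2) p q) = extChartAt (𝓡∂ 2) q q := by
    simp only [transition, Function.comp_apply, (extChartAt (𝓡∂ 2) p).left_inv hq]
  rw [h.2.2, ← hT, e, du_eq_chartDeriv hu]

theorem injective_chartDeriv_iff {u : M → E n} (hu : ContMDiff (𝓡∂ 2) 𝓘(ℝ, E n) 1 u)
    (p : M) {q : M} (hq : q ∈ (extChartAt (𝓡∂ 2) p).source) :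
    Function.Injective (chartDeriv u p (extChartAt (𝓡∂ 2) p q)) ↔ Function.Injective (du u q) := by
  obtain ⟨T, hT⟩ := exists_invertible_chartDeriv_eq hu p hq
  rw [hT]
  exact T.toEquiv.injective_comp (du u q)

theorem range_chartDeriv {u : M → E n} (hu : ContMDiff (𝓡∂ 2) 𝓘(ℝ, E n) 1 u)
    (p : M) {q : M} (hq : q ∈ (extChartAt (𝓡∂ 2) p).source) :
    LinearMap.range (chartDeriv u p (extChartAt (𝓡∂ 2) p q)).toLinearMap = tangentPlane u q := by
  obtain ⟨T, hT⟩ := exists_invertible_chartDeriv_eq hu p hq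
  rw [hT, tangentPlane]
  ext y
  constructor
  · rintro ⟨x, rfl⟩
    exact ⟨T x, rfl⟩
  · rintro ⟨x, rfl⟩
    exact ⟨T.symm x, by simp⟩

theorem isOpen_setOf_injective_du {u : M → E n} (hu : ContMDiff (𝓡∂ 2) 𝓘(ℝ, E n) 1 u) :
    IsOpen {q | Function.Injective (du u q)} := by
  rw [isOpen_iff_mem_nhds]
  intro p hp
  have h1 : Function.Injective (chartDeriv u p (extChartAt (𝓡∂ 2) p p)) :=
    (injective_chartDeriv_iff hu p (mem_extChartAt_source p)).2 hp
  have h2 : ContinuousAt (fun q => chartDeriv u p (extChartAt (𝓡∂ 2) p q)) p := by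
    have h := (continuousOn_chartDeriv hu p).comp (continuousOn_extChartAt (I := 𝓡∂ 2) p)
      (extChartAt (𝓡∂ 2) p).mapsTo
    exact h.continuousAt (extChartAt_source_mem_nhds p)
  have h3 := h2.eventually (ContinuousLinearMap.isOpen_injective.mem_nhds h1)
  filter_upwards [h3, extChartAt_source_mem_nhds (I := 𝓡∂ 2) p] with q hq hqs
  exact (injective_chartDeriv_iff hu p hqs).1 hq

variable [MeasurableSpace M] [BorelSpace M]

/-- Change of variables along the transition map: the Jacobian of `u` picks up exactly the factor
`|det|`. -/
theorem chartArea_eq_of_subset {u : M → E n} (hu : ContMDiff (𝓡∂ 2) 𝓘(ℝ, E n) 1 u) (p q : M)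
    {A : Set M} (hA : MeasurableSet A) (hAp : A ⊆ (extChartAt (𝓡∂ 2) p).source)
    (hAq : A ⊆ (extChartAt (𝓡∂ 2) q).source) : chartArea u q A = chartArea u p A := by
  have hS : ∀ p : M, A ⊆ (extChartAt (𝓡∂ 2) p).source →
      (extChartAt (𝓡∂ 2) p).symm ⁻¹' A ∩ (extChartAt (𝓡∂ 2) p).target = extChartAt (𝓡∂ 2) p '' A := by
    intro p hp
    rw [(extChartAt (𝓡∂ 2) p).image_eq_target_inter_inv_preimage hp, Set.inter_comm]
  rw [chartArea_apply u q hA, chartArea_apply u p hA, hS p hAp]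
  set S := (extChartAt (𝓡∂ 2) q).symm ⁻¹' A ∩ (extChartAt (𝓡∂ 2) q).target with hSdef
  have himg : extChartAt (𝓡∂ 2) p '' A = transition p q '' S := by
    rw [hSdef, hS q hAq, ← Set.image_comp]
    refine Set.image_congr fun a ha => ?_
    simp only [transition, Function.comp_apply, (extChartAt (𝓡∂ 2) q).left_inv (hAq ha)]
  have hSm : MeasurableSet S := measurableSet_symm_preimage_inter_target q hA
  have hder : ∀ x ∈ S, _ := fun x (hx : x ∈ S) => exists_transition_deriv hu p q hx.2 (hAp hx.1)
  rw [himg, lintegral_image_eq_lintegral_abs_det_fderiv_mul volume hSm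
    (fun x hx => (hder x hx).1.mono fun y hy => extChartAt_target_subset_range q hy.2)]
  · refine setLIntegral_congr_fun hSm fun x hx => ?_
    rw [(hder x hx).2.2, jacobian_comp, ENNReal.ofReal_mul (abs_nonneg _)]
  · intro x hx y hy hxy
    refine (extChartAt (𝓡∂ 2) q).symm.injOn hx.2 hy.2 ?_
    exact (extChartAt (𝓡∂ 2) p).injOn (hAp hx.1) (hAp hy.1) hxy

theorem exists_open_chartArea_lt_top {u : M → E n} (hu : ContMDiff (𝓡∂ 2) 𝓘(ℝ, E n) 1 u) (p : M) :
    ∃ U, IsOpen U ∧ p ∈ U ∧ U ⊆ (extChartAt (𝓡∂ 2) p).source ∧ chartArea u p U < ⊤ := by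
  set x₀ := extChartAt (𝓡∂ 2) p p with hx₀
  have hx₀t : x₀ ∈ (extChartAt (𝓡∂ 2) p).target := mem_extChartAt_target p
  have hc : ContinuousWithinAt (fun x => jacobian (chartDeriv u p x))
      (extChartAt (𝓡∂ 2) p).target x₀ :=
    continuous_jacobian.continuousAt.comp_continuousWithinAt (continuousOn_chartDeriv hu p x₀ hx₀t)
  have hev : ∀ᶠ x in 𝓝[(extChartAt (𝓡∂ 2) p).target] x₀,
      jacobian (chartDeriv u p x) < jacobian (chartDeriv u p x₀) + 1 :=
    hc.eventually (gt_mem_nhds (by linarith))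
  obtain ⟨r, hr, hball⟩ := Metric.mem_nhdsWithin_iff.1 hev
  refine ⟨(extChartAt (𝓡∂ 2) p).source ∩ extChartAt (𝓡∂ 2) p ⁻¹' Metric.ball x₀ r,
    isOpen_extChartAt_preimage' p Metric.isOpen_ball, ⟨mem_extChartAt_source p, Metric.mem_ball_self hr⟩,
    Set.inter_subset_left, ?_⟩
  rw [chartArea_apply _ _ (isOpen_extChartAt_preimage' p Metric.isOpen_ball).measurableSet]
  set S := (extChartAt (𝓡∂ 2) p).symm ⁻¹' ((extChartAt (𝓡∂ 2) p).source ∩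
    extChartAt (𝓡∂ 2) p ⁻¹' Metric.ball x₀ r) ∩ (extChartAt (𝓡∂ 2) p).target with hS
  have hSsub : S ⊆ Metric.ball x₀ r ∩ (extChartAt (𝓡∂ 2) p).target := by
    rintro x ⟨⟨_, h⟩, hx⟩
    rw [Set.mem_preimage, (extChartAt (𝓡∂ 2) p).right_inv hx] at h
    exact ⟨h, hx⟩
  calc _ ≤ ∫⁻ x in Metric.ball x₀ r ∩ (extChartAt (𝓡∂ 2) p).target,
        ENNReal.ofReal (jacobian (chartDeriv u p x)) := lintegral_mono_set hSsub
    _ ≤ ∫⁻ _ in Metric.ball x₀ r ∩ (extChartAt (𝓡∂ 2) p).target,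
        ENNReal.ofReal (jacobian (chartDeriv u p x₀) + 1) :=
        setLIntegral_mono_ae' (measurableSet_ball.inter (measurableSet_extChartAt_target p))
          (Eventually.of_forall fun x hx => ENNReal.ofReal_le_ofReal (le_of_lt (hball hx)))
    _ < ⊤ := by
        rw [setLIntegral_const]
        exact ENNReal.mul_lt_top ENNReal.ofReal_lt_top
          ((measure_mono Set.inter_subset_left).trans_lt measure_ball_lt_top)

/-- The supremum defining `area` runs over all points of `M`. By compactness finitely many chart
measures dominate it, which is enough for finiteness and for null sets; lower bounds need only a
single chart. -/
theorem exists_finite_area_le [CompactSpace M] {u : M → E n}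
    (hu : ContMDiff (𝓡∂ 2) 𝓘(ℝ, E n) 1 u) :
    ∃ (F : Finset M) (U : M → Set M), (∀ p, IsOpen (U p)) ∧
      (∀ p, U p ⊆ (extChartAt (𝓡∂ 2) p).source) ∧ (∀ p, chartArea u p (U p) < ⊤) ∧
      area u ≤ ∑ p ∈ F, (chartArea u p).restrict (U p) := by
  choose U hUo hpU hUs hUf using exists_open_chartArea_lt_top hu
  obtain ⟨F, hF⟩ := isCompact_univ.elim_finite_subcover U hUo
    fun p _ => Set.mem_iUnion.2 ⟨p, hpU p⟩
  refine ⟨F, U, hUo, hUs, hUf, iSup_le fun q => Measure.le_iff.2 fun A hA => ?_⟩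
  -- the chart at `q` only sees its own source
  have hsrc : chartArea u q A = chartArea u q (A ∩ (extChartAt (𝓡∂ 2) q).source) := by
    rw [chartArea_apply u q hA,
      chartArea_apply u q (hA.inter (isOpen_extChartAt_source q).measurableSet)]
    congr 2
    ext x
    simp only [Set.mem_inter_iff, Set.mem_preimage]
    constructor
    · rintro ⟨h1, h2⟩
      exact ⟨⟨h1, (extChartAt (𝓡∂ 2) q).map_target h2⟩, h2⟩
    · rintro ⟨⟨h1, _⟩, h2⟩
      exact ⟨h1, h2⟩
  set A' := A ∩ (extChartAt (𝓡∂ 2) q).source with hA'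
  have hA'm : MeasurableSet A' := hA.inter (isOpen_extChartAt_source q).measurableSet
  rw [hsrc, Measure.coe_finsetSum, Finset.sum_apply]
  calc chartArea u q A' ≤ chartArea u q (⋃ p ∈ F, A' ∩ U p) := by
        refine measure_mono fun a ha => ?_
        obtain ⟨p, hp⟩ := Set.mem_iUnion.1 (hF (Set.mem_univ a))
        obtain ⟨hpF, hap⟩ := Set.mem_iUnion.1 hp
        exact Set.mem_iUnion₂.2 ⟨p, hpF, ha, hap⟩
    _ ≤ ∑ p ∈ F, chartArea u q (A' ∩ U p) := measure_biUnion_finset_le _ _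
    _ ≤ ∑ p ∈ F, (chartArea u p).restrict (U p) A := by
        refine Finset.sum_le_sum fun p _ => ?_
        rw [chartArea_eq_of_subset hu p q (hA'm.inter (hUo p).measurableSet)
          (Set.inter_subset_right.trans (hUs p))
          (Set.inter_subset_left.trans Set.inter_subset_right), Measure.restrict_apply hA]
        exact measure_mono (Set.inter_subset_inter_left _ Set.inter_subset_left)

theorem isFiniteMeasure_area [CompactSpace M] {u : M → E n}
    (hu : ContMDiff (𝓡∂ 2) 𝓘(ℝ, E n) 1 u) : IsFiniteMeasure (area u) := by
  obtain ⟨F, U, _, _, hUf, hle⟩ := exists_finite_area_le hu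
  refine ⟨(hle Set.univ).trans_lt ?_⟩
  rw [Measure.coe_finsetSum, Finset.sum_apply]
  exact ENNReal.sum_lt_top.2 fun p _ => by simpa using hUf p

/-- The Jacobian vanishes wherever `du` is not injective, so branch points are negligible without
any count of them. -/
theorem ae_injective_du [CompactSpace M] {u : M → E n}
    (hu : ContMDiff (𝓡∂ 2) 𝓘(ℝ, E n) 1 u) :
    ∀ᵐ q ∂area u, Function.Injective (du u q) := by
  obtain ⟨F, U, hUo, hUs, _, hle⟩ := exists_finite_area_le hu
  have hm : MeasurableSet {q | ¬ Function.Injective (du u q)} :=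
    (isOpen_setOf_injective_du hu).measurableSet.compl
  rw [ae_iff, ← nonpos_iff_eq_zero]
  refine (hle _).trans ?_
  rw [Measure.coe_finsetSum, Finset.sum_apply]
  refine le_of_eq (Finset.sum_eq_zero fun p _ => ?_)
  rw [Measure.restrict_apply hm, chartArea_apply u p (hm.inter (hUo p).measurableSet)]
  rw [setLIntegral_congr_fun (g := 0) (measurableSet_symm_preimage_inter_target p
    (hm.inter (hUo p).measurableSet)) fun x hx => ?_]
  · simp
  · have h1 := injective_chartDeriv_iff hu p (hUs p hx.1.2)
    rw [(extChartAt (𝓡∂ 2) p).right_inv hx.2] at h1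
    simp [jacobian_eq_zero_of_not_injective (mt h1.1 hx.1.1)]

end Area

/-! ### The test field `x / (s² + |x|²)` -/

section TestField

variable {n : ℕ}

/-- The radial vector field `(x - x₀) / (s² + |x - x₀|²)`. -/
noncomputable def radialField (x₀ : E n) (s : ℝ) (x : E n) : E n :=
  (s ^ 2 + ‖x - x₀‖ ^ 2)⁻¹ • (x - x₀)

theorem contDiff_radialField (x₀ : E n) {s : ℝ} (hs : 0 < s) :
    ContDiff ℝ 1 (radialField x₀ s) := by
  unfold radialField
  have h : ContDiff ℝ 1 fun x : E n => x - x₀ := contDiff_id.sub contDiff_const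
  exact ((contDiff_const.add (h.norm_sq ℝ)).inv fun x => by positivity).smul h

theorem hasFDerivAt_radialField (x₀ : E n) {s : ℝ} (hs : 0 < s) (x : E n) :
    HasFDerivAt (radialField x₀ s)
      ((s ^ 2 + ‖x - x₀‖ ^ 2)⁻¹ • ContinuousLinearMap.id ℝ (E n) -
        (2 / (s ^ 2 + ‖x - x₀‖ ^ 2) ^ 2) • (innerSL ℝ (x - x₀)).smulRight (x - x₀)) x := by
  have hρ : s ^ 2 + ‖x - x₀‖ ^ 2 ≠ 0 := by positivity
  have h : HasFDerivAt (fun x : E n => x - x₀) (ContinuousLinearMap.id ℝ (E n)) x :=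
    (hasFDerivAt_id x).sub_const x₀
  have h2 := ((hasDerivAt_inv hρ).comp_hasFDerivAt x (h.norm_sq.const_add (s ^ 2))).smul h
  refine h2.congr_fderiv ?_
  ext v : 1
  change (s ^ 2 + ‖x - x₀‖ ^ 2)⁻¹ • v +
      (-((s ^ 2 + ‖x - x₀‖ ^ 2) ^ 2)⁻¹ • 2 • inner ℝ (x - x₀) v) • (x - x₀) =
    (s ^ 2 + ‖x - x₀‖ ^ 2)⁻¹ • v -
      (2 / (s ^ 2 + ‖x - x₀‖ ^ 2) ^ 2) • inner ℝ (x - x₀) v • (x - x₀)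
  rw [smul_smul, sub_eq_add_neg (_ • v), ← neg_smul]
  congr 2
  simp only [smul_eq_mul, nsmul_eq_mul]
  push_cast
  ring

theorem trace_starProjection (K : Submodule ℝ (E n)) :
    LinearMap.trace ℝ (E n) K.starProjection.toLinearMap = Module.finrank ℝ K := by
  refine LinearMap.IsProj.trace ⟨fun x => K.starProjection_apply_mem x, fun x hx => ?_⟩
  exact Submodule.starProjection_eq_self_iff.2 hx

theorem norm_sq_eq_starProjection (K : Submodule ℝ (E n)) (w : E n) :
    ‖w‖ ^ 2 = ‖K.starProjection w‖ ^ 2 + ‖w - K.starProjection w‖ ^ 2 := by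
  have h := norm_add_sq_real (K.starProjection w) (w - K.starProjection w)
  rw [real_inner_comm, K.starProjection_inner_eq_zero w _ (K.starProjection_apply_mem w)] at h
  rw [add_sub_cancel] at h
  linarith

/-- With `ρ = s² + |w|²`, the identity part contributes `2/ρ` and the rank-one part `-2|w^T|²/ρ²`,
where `w^T` is the projection to `K`. Dimension two is what makes `|w|²` cancel, leaving only `s²`
and the normal part. -/
theorem trace_starProjection_comp_fderiv_radialField (K : Submodule ℝ (E n))
    (hK : Module.finrank ℝ K = 2) (x₀ : E n) {s : ℝ} (hs : 0 < s) (x : E n) :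
    LinearMap.trace ℝ (E n) (K.starProjection ∘L fderiv ℝ (radialField x₀ s) x).toLinearMap =
      2 * s ^ 2 / (s ^ 2 + ‖x - x₀‖ ^ 2) ^ 2 +
        2 * ‖(x - x₀) - K.starProjection (x - x₀)‖ ^ 2 / (s ^ 2 + ‖x - x₀‖ ^ 2) ^ 2 := by
  have hρ : s ^ 2 + ‖x - x₀‖ ^ 2 ≠ 0 := by positivity
  rw [(hasFDerivAt_radialField x₀ hs x).fderiv]
  set w := x - x₀ with hw
  set ρ := s ^ 2 + ‖w‖ ^ 2 with hρd
  have hlin : (K.starProjection ∘L (ρ⁻¹ • ContinuousLinearMap.id ℝ (E n) -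
      (2 / ρ ^ 2) • (innerSL ℝ w).smulRight w)).toLinearMap =
      ρ⁻¹ • K.starProjection.toLinearMap -
        (2 / ρ ^ 2) • (innerSL ℝ w).toLinearMap.smulRight (K.starProjection w) := by
    ext v : 1
    simp
  rw [hlin, map_sub, map_smul, map_smul, trace_starProjection, hK, LinearMap.trace_smulRight]
  have h1 : (innerSL ℝ w).toLinearMap (K.starProjection w) = ‖K.starProjection w‖ ^ 2 := by
    have := K.starProjection_inner_eq_zero w _ (K.starProjection_apply_mem w)
    rw [inner_sub_left, sub_eq_zero, real_inner_self_eq_norm_sq] at this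
    exact this
  have h2 := norm_sq_eq_starProjection K w
  rw [h1]
  simp only [smul_eq_mul]
  field_simp
  push_cast
  rw [hρd]
  linarith

end TestField

/-! ### Continuity of the tangent plane -/

section Tangent

variable {n : ℕ}

theorem isInvertible_adjoint_comp_self {D : E 2 →L[ℝ] E n} (hD : Function.Injective D) :
    (ContinuousLinearMap.adjoint D ∘L D).IsInvertible := by
  have hinj : Function.Injective (ContinuousLinearMap.adjoint D ∘L D).toLinearMap := by
    rw [← LinearMap.ker_eq_bot, LinearMap.ker_eq_bot']
    intro x hx
    have h1 : inner ℝ (D x) (D x) = 0 := by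
      rw [← ContinuousLinearMap.adjoint_inner_right]
      have : ContinuousLinearMap.adjoint D (D x) = 0 := hx
      rw [this, inner_zero_right]
    exact hD (by rw [inner_self_eq_zero.1 h1, map_zero])
  refine ⟨(LinearEquiv.ofInjectiveEndo _ hinj).toContinuousLinearEquiv, ?_⟩
  ext x : 1
  rfl

/-- The normal equations express the projection through `D` alone. This gives continuity of the
tangent plane off the singular set, hence measurability of the normal part of the position vector.
-/
theorem starProjection_range_eq {D : E 2 →L[ℝ] E n} (hD : Function.Injective D) :
    (LinearMap.range D.toLinearMap).starProjection =
      D ∘L (ContinuousLinearMap.adjoint D ∘L D).inverse ∘L ContinuousLinearMap.adjoint D := by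
  have hinv := isInvertible_adjoint_comp_self hD
  ext x : 1
  refine Submodule.eq_starProjection_of_mem_of_inner_eq_zero ⟨_, rfl⟩ ?_
  rintro _ ⟨y, rfl⟩
  rw [inner_sub_left, sub_eq_zero]
  simp only [ContinuousLinearMap.coe_coe, ContinuousLinearMap.comp_apply]
  rw [← ContinuousLinearMap.adjoint_inner_left, ← ContinuousLinearMap.adjoint_inner_left]
  congr 1
  exact (hinv.self_apply_inverse (ContinuousLinearMap.adjoint D x)).symm

theorem continuousAt_starProjection_range {D : E 2 →L[ℝ] E n} (hD : Function.Injective D) :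
    ContinuousAt (fun D : E 2 →L[ℝ] E n => (LinearMap.range D.toLinearMap).starProjection) D := by
  have hadj : Continuous fun D : E 2 →L[ℝ] E n => ContinuousLinearMap.adjoint D :=
    ContinuousLinearMap.adjoint.continuous
  have h1 : ContinuousAt (fun D : E 2 →L[ℝ] E n => ContinuousLinearMap.adjoint D ∘L D) D :=
    (hadj.clm_comp continuous_id).continuousAt
  have h2 : ContinuousAt (fun D : E 2 →L[ℝ] E n =>
      (ContinuousLinearMap.adjoint D ∘L D).inverse) D :=
    ContinuousAt.comp (f := fun D : E 2 →L[ℝ] E n => ContinuousLinearMap.adjoint D ∘L D)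
      ((isInvertible_adjoint_comp_self hD).contDiffAt_map_inverse (n := 0)).continuousAt h1
  have h3 := continuousAt_id.clm_comp (h2.clm_comp hadj.continuousAt)
  refine h3.congr ?_
  filter_upwards [ContinuousLinearMap.isOpen_injective.mem_nhds hD] with D' hD'
  exact (starProjection_range_eq hD').symm

variable {M : Type*} [TopologicalSpace M] [ChartedSpace (EuclideanHalfSpace 2) M]

theorem finrank_tangentPlane {u : M → E n} {q : M} (hq : Function.Injective (du u q)) :
    Module.finrank ℝ (tangentPlane u q) = 2 := by
  rw [tangentPlane, LinearMap.finrank_range_of_inj hq]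
  simp

variable [IsManifold (𝓡∂ 2) ∞ M]

theorem continuousOn_starProjection_tangentPlane {u : M → E n}
    (hu : ContMDiff (𝓡∂ 2) 𝓘(ℝ, E n) 1 u) :
    ContinuousOn (fun q => (tangentPlane u q).starProjection)
      {q | Function.Injective (du u q)} := by
  intro p hp
  apply ContinuousAt.continuousWithinAt
  have h1 : Function.Injective (chartDeriv u p (extChartAt (𝓡∂ 2) p p)) :=
    (injective_chartDeriv_iff hu p (mem_extChartAt_source p)).2 hp
  have h2 : ContinuousAt (fun q => chartDeriv u p (extChartAt (𝓡∂ 2) p q)) p := by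
    have h := (continuousOn_chartDeriv hu p).comp (continuousOn_extChartAt (I := 𝓡∂ 2) p)
      (extChartAt (𝓡∂ 2) p).mapsTo
    exact h.continuousAt (extChartAt_source_mem_nhds p)
  have h3 := ContinuousAt.comp (f := fun q => chartDeriv u p (extChartAt (𝓡∂ 2) p q))
    (continuousAt_starProjection_range h1) h2
  refine h3.congr ?_
  filter_upwards [extChartAt_source_mem_nhds (I := 𝓡∂ 2) p] with q hq
  simp only [Function.comp_apply]
  congr 1
  exact range_chartDeriv hu p hq

/-! ### The kernel inequality -/

/-- The weighted area inequality obtained by testing the divergence identity with a radial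
field. -/
theorem integral_kernel_le [CompactSpace M] [MeasurableSpace M] [BorelSpace M] {u H : M → E n}
    (hu : ContMDiff (𝓡∂ 2) 𝓘(ℝ, E n) 1 u) (hH : IsMeanCurvature u H)
    (hdiv : DivergenceIdentity u H) (hH2 : MemLp H 2 (area u)) (x₀ : E n) {s : ℝ} (hs : 0 < s) :
    ∫ q, 2 * s ^ 2 / (s ^ 2 + ‖u q - x₀‖ ^ 2) ^ 2 ∂area u ≤
      ∫ x in boundaryCurve u, inner ℝ (radialField x₀ s x) (boundaryConormal u x) ∂μH[1] +
        (1 / 8) * ∫ q, ‖H q‖ ^ 2 ∂area u := by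
  have hfin : IsFiniteMeasure (area u) := isFiniteMeasure_area hu
  have huc : Continuous u := hu.continuous
  set μ := area u with hμ
  set ρ : M → ℝ := fun q => s ^ 2 + ‖u q - x₀‖ ^ 2 with hρ
  have hρpos : ∀ q, 0 < ρ q := fun q => by positivity
  have hρc : Continuous ρ := by fun_prop
  set N : M → ℝ := fun q =>
    ‖(u q - x₀) - (tangentPlane u q).starProjection (u q - x₀)‖ with hN
  set R := {q | Function.Injective (du u q)} with hR
  have hRae : ∀ᵐ q ∂μ, q ∈ R := ae_injective_du hu
  have hRm : MeasurableSet R := (isOpen_setOf_injective_du hu).measurableSet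
  have hrestr : μ.restrict R = μ := Measure.restrict_eq_self_of_ae_mem hRae
  have hdiveq : ∀ q ∈ R, tangentialDiv u (radialField x₀ s) q =
      2 * s ^ 2 / ρ q ^ 2 + 2 * N q ^ 2 / ρ q ^ 2 := fun q hq =>
    trace_starProjection_comp_fderiv_radialField _ (finrank_tangentPlane hq) x₀ hs (u q)
  have hNle : ∀ q, N q ^ 2 ≤ ‖u q - x₀‖ ^ 2 := fun q => by
    have := norm_sq_eq_starProjection (tangentPlane u q) (u q - x₀)
    nlinarith [sq_nonneg ‖(tangentPlane u q).starProjection (u q - x₀)‖]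
  have hNc : ContinuousOn N R := by
    have h := continuousOn_starProjection_tangentPlane hu
    have hc : ContinuousOn (fun q => u q - x₀) R := by fun_prop
    exact (hc.sub (h.clm_apply hc)).norm
  have hker : Integrable (fun q => 2 * s ^ 2 / ρ q ^ 2) μ :=
    (by
      have : Continuous fun q => 2 * s ^ 2 / ρ q ^ 2 :=
        continuous_const.div (hρc.pow 2) fun q => (pow_pos (hρpos q) 2).ne'
      exact (BoundedContinuousFunction.mkOfCompact ⟨_, this⟩).integrable μ)
  have hNint : Integrable (fun q => 2 * N q ^ 2 / ρ q ^ 2) μ := by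
    refine Integrable.of_bound (C := 2 / s ^ 2) ?_ (Eventually.of_forall fun q => ?_)
    · rw [← hrestr]
      refine ContinuousOn.aestronglyMeasurable ?_ hRm
      exact ((hNc.pow 2).const_mul 2 |>.div (hρc.pow 2).continuousOn
        fun q _ => (pow_pos (hρpos q) 2).ne')
    · have h1 := hρpos q
      rw [Real.norm_of_nonneg (by positivity), div_le_div_iff₀ (by positivity) (by positivity)]
      have h2 : N q ^ 2 ≤ ρ q := (hNle q).trans (by simp only [hρ]; nlinarith)
      have h3 : s ^ 2 ≤ ρ q := by simp only [hρ]; nlinarith [sq_nonneg ‖u q - x₀‖]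
      nlinarith [mul_le_mul h2 h3 (sq_nonneg s) h1.le]
  have hXH : Integrable (fun q => inner ℝ (radialField x₀ s (u q)) (H q)) μ := by
    have hXc : Continuous fun q => radialField x₀ s (u q) :=
      (contDiff_radialField x₀ hs).continuous.comp huc
    obtain ⟨C, hC⟩ := (isCompact_range hXc).isBounded.exists_norm_le
    refine (hH.integrable.norm.const_mul C).mono'
      (hXc.aestronglyMeasurable.inner hH.integrable.1) (Eventually.of_forall fun q => ?_)
    exact (norm_inner_le_norm _ _).trans
      (mul_le_mul_of_nonneg_right (hC _ ⟨q, rfl⟩) (norm_nonneg _))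
  have hHsq : Integrable (fun q => ‖H q‖ ^ 2) μ := hH2.integrable_norm_pow two_ne_zero
  have hdiv' := hdiv (radialField x₀ s) (contDiff_radialField x₀ hs)
  rw [← hμ, integral_congr_ae (hRae.mono hdiveq), integral_add hker hNint] at hdiv'
  -- Since `H` is normal, only the normal part of the position pairs with it. Young's inequality `ab
  -- ≤ 2a² + b²/8` is weighted to reproduce exactly the normal term of the divergence.
  have hpt : ∀ᵐ q ∂μ, inner ℝ (radialField x₀ s (u q)) (H q) ≤
      2 * N q ^ 2 / ρ q ^ 2 + 1 / 8 * ‖H q‖ ^ 2 := by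
    filter_upwards [hH.normal] with q hq
    have h1 : inner ℝ (u q - x₀) (H q) =
        inner ℝ ((u q - x₀) - (tangentPlane u q).starProjection (u q - x₀)) (H q) := by
      rw [inner_sub_left (u q - x₀), (Submodule.mem_orthogonal _ _).1 hq _
        (Submodule.starProjection_apply_mem _ _), sub_zero]
    have h2 : inner ℝ (u q - x₀) (H q) ≤ N q * ‖H q‖ := by
      rw [h1]
      exact real_inner_le_norm _ _
    have h3 := hρpos q
    simp only [radialField, inner_smul_left, RCLike.conj_to_real]
    calc (ρ q)⁻¹ * inner ℝ (u q - x₀) (H q) ≤ (ρ q)⁻¹ * (N q * ‖H q‖) := by gcongr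
      _ = (N q / ρ q) * ‖H q‖ := by ring
      _ ≤ 2 * (N q / ρ q) ^ 2 + 1 / 8 * ‖H q‖ ^ 2 := by
          nlinarith [sq_nonneg (4 * (N q / ρ q) - ‖H q‖)]
      _ = _ := by rw [div_pow, mul_div_assoc]
  have hmono := integral_mono_ae hXH (hNint.add (hHsq.const_mul (1 / 8))) hpt
  simp only [Pi.add_apply] at hmono
  rw [integral_add hNint (hHsq.const_mul (1 / 8)), integral_const_mul] at hmono
  linarith

/-! ### The boundary term -/

/-- A vector `ν` orthogonal to `v` sees only the component of `w` orthogonal to `v`, and the length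
of that component times `‖v‖` is the area of the parallelogram. -/
theorem mul_abs_inner_le_wedgeNorm (w v ν : E n) (hν : ‖ν‖ ≤ 1) (h : inner ℝ ν v = 0) :
    ‖v‖ * |inner ℝ w ν| ≤ wedgeNorm w v := by
  rcases eq_or_ne v 0 with rfl | hv
  · simp
  have hv0 : 0 < ‖v‖ := norm_pos_iff.2 hv
  apply Real.le_sqrt_of_sq_le
  have h1 : inner ℝ (‖v‖ ^ 2 • w - inner ℝ w v • v) ν = ‖v‖ ^ 2 * inner ℝ w ν := by
    rw [inner_sub_left, inner_smul_left, inner_smul_left, real_inner_comm ν v, h]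
    simp
  have h2 : ‖‖v‖ ^ 2 • w - inner ℝ w v • v‖ ^ 2 =
      ‖v‖ ^ 2 * (‖w‖ ^ 2 * ‖v‖ ^ 2 - inner ℝ w v ^ 2) := by
    rw [norm_sub_sq_real, norm_smul, norm_smul, inner_smul_left, inner_smul_right]
    simp only [norm_pow, Real.norm_eq_abs, RCLike.conj_to_real, mul_pow, sq_abs]
    ring
  have h3 := abs_real_inner_le_norm (‖v‖ ^ 2 • w - inner ℝ w v • v) ν
  rw [h1] at h3
  have h4 : (‖v‖ ^ 2 * inner ℝ w ν) ^ 2 ≤ ‖‖v‖ ^ 2 • w - inner ℝ w v • v‖ ^ 2 := by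
    rw [← sq_abs]
    gcongr
    exact h3.trans (mul_le_of_le_one_right (norm_nonneg _) hν)
  rw [h2] at h4
  have h5 : 0 < ‖v‖ ^ 2 := by positivity
  rw [mul_pow, sq_abs]
  have h6 : ‖v‖ ^ 2 * (‖v‖ ^ 2 * inner ℝ w ν ^ 2) ≤
      ‖v‖ ^ 2 * (‖w‖ ^ 2 * ‖v‖ ^ 2 - inner ℝ w v ^ 2) := by linarith
  exact le_of_mul_le_mul_left h6 h5

/-- Passing to the lower integral of the norm makes the estimate valid with no measurability of `ν`.
-/
theorem boundary_integral_le {γ : ℝ → E n} (hγ : IsC1ClosedCurve γ) (ν : E n → E n)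
    (hν1 : ∀ x, ‖ν x‖ ≤ 1) (hν : ∀ t, inner ℝ (ν (γ t)) (deriv γ t) = 0) (x₀ : E n) {s : ℝ}
    (hs : 0 < s) :
    ∫ x in Set.range γ, inner ℝ (radialField x₀ s x) (ν x) ∂μH[1] ≤
      ∫ t in (0 : ℝ)..1, angularSpeed γ x₀ s t := by
  have hc := continuous_angularSpeed hγ.contDiff x₀ hs
  have hnn : ∀ t, 0 ≤ angularSpeed γ x₀ s t := fun t =>
    div_nonneg (wedgeNorm_nonneg _ _) (by positivity)
  have hpt : ∀ t, ‖deriv γ t‖ * ‖inner ℝ (radialField x₀ s (γ t)) (ν (γ t))‖ ≤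
      angularSpeed γ x₀ s t := by
    intro t
    have h := mul_abs_inner_le_wedgeNorm (γ t - x₀) (deriv γ t) (ν (γ t)) (hν1 _) (hν t)
    simp only [radialField, inner_smul_left, RCLike.conj_to_real, angularSpeed, norm_mul,
      Real.norm_eq_abs]
    rw [abs_of_pos (by positivity : 0 < (s ^ 2 + ‖γ t - x₀‖ ^ 2)⁻¹), div_eq_inv_mul]
    calc _ = (s ^ 2 + ‖γ t - x₀‖ ^ 2)⁻¹ * (‖deriv γ t‖ * |inner ℝ (γ t - x₀) (ν (γ t))|) := by ring
      _ ≤ _ := by gcongr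
  have hle : ∫⁻ x in Set.range γ, ‖inner ℝ (radialField x₀ s x) (ν x)‖ₑ ∂μH[1] ≤
      ENNReal.ofReal (∫ t in (0 : ℝ)..1, angularSpeed γ x₀ s t) := by
    refine (lintegral_hausdorffMeasure_range_le hγ _).trans ?_
    rw [intervalIntegral.integral_of_le zero_le_one, ← integral_Ico_eq_integral_Ioc,
      ofReal_integral_eq_lintegral_ofReal
        ((hc.integrableOn_Icc (a := 0) (b := 1)).mono_set Set.Ico_subset_Icc_self)
        (Eventually.of_forall hnn)]
    refine lintegral_mono fun t => ?_
    rw [← ofReal_norm, ← ENNReal.ofReal_mul (norm_nonneg _)]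
    exact ENNReal.ofReal_le_ofReal (hpt t)
  refine (le_abs_self _).trans ?_
  rw [← Real.norm_eq_abs]
  refine (norm_integral_le_lintegral_norm _).trans ?_
  simp only [ofReal_norm]
  exact ENNReal.toReal_le_of_le_ofReal
    (intervalIntegral.integral_nonneg zero_le_one fun t _ => hnn t) hle

end Tangent

/-! ### The model density integral in the plane -/

section Planar

/-- The pull back under `z ↦ z ^ (k + 1)` of the kernel `2 s² / (s² + b |x|²)²`, as a function of
`r = |z|`. -/
noncomputable def planarKernel (k : ℕ) (b s r : ℝ) : ℝ :=
  2 * s ^ 2 * (k + 1) ^ 2 * r ^ (2 * k) / (s ^ 2 + b * r ^ (2 * k + 2)) ^ 2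

variable {k : ℕ} {b s : ℝ}

theorem planarKernel_nonneg (r : ℝ) : 0 ≤ planarKernel k b s r :=
  div_nonneg (mul_nonneg (by positivity) (Even.pow_nonneg (even_two_mul k) r)) (sq_nonneg _)

theorem planarKernel_denom_pos (hb : 0 < b) (hs : 0 < s) (r : ℝ) :
    0 < s ^ 2 + b * r ^ (2 * k + 2) := by
  have : 0 ≤ r ^ (2 * k + 2) := Even.pow_nonneg (by simp [parity_simps]) r
  positivity

theorem continuous_planarKernel (hb : 0 < b) (hs : 0 < s) : Continuous (planarKernel k b s) := by
  unfold planarKernel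
  exact Continuous.div (by fun_prop) (by fun_prop)
    fun r => (pow_pos (planarKernel_denom_pos hb hs r) 2).ne'

/-- Up to a constant the integrand is the derivative of `1 / (s² + b r^(2k+2))`. As `s → 0` the
value tends to `(k + 1) / b`: the source of the multiplicity `k + 1` in the density. -/
theorem integral_planarKernel (hb : 0 < b) (hs : 0 < s) (ρ : ℝ) :
    ∫ r in (0 : ℝ)..ρ, r * planarKernel k b s r =
      (k + 1) / b * (1 - s ^ 2 / (s ^ 2 + b * ρ ^ (2 * k + 2))) := by
  have hder : ∀ r : ℝ, HasDerivAt
      (fun r => -((k + 1) * s ^ 2 / b) * (s ^ 2 + b * r ^ (2 * k + 2))⁻¹)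
      (r * planarKernel k b s r) r := by
    intro r
    have hpos := planarKernel_denom_pos (k := k) hb hs r
    have h1 : HasDerivAt (fun r : ℝ => s ^ 2 + b * r ^ (2 * k + 2))
        (b * ((2 * k + 2 : ℕ) * r ^ (2 * k + 1))) r := by
      simpa using ((hasDerivAt_pow (2 * k + 2) r).const_mul b).const_add (s ^ 2)
    have h2 := (h1.fun_inv hpos.ne').const_mul (-((k + 1) * s ^ 2 / b))
    refine h2.congr_deriv ?_
    unfold planarKernel
    have hb' := hb.ne'
    have hpos' := hpos.ne'
    field_simp
    push_cast
    ring
  rw [intervalIntegral.integral_eq_sub_of_hasDerivAt (fun r _ => hder r)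
    ((continuous_id.mul (continuous_planarKernel hb hs)).intervalIntegrable _ _)]
  have h0 : (0 : ℝ) ^ (2 * k + 2) = 0 := by simp
  rw [h0]
  have hpos := (planarKernel_denom_pos (k := k) hb hs ρ).ne'
  have hs' := hs.ne'
  field_simp
  ring

theorem setLIntegral_planarKernel (hb : 0 < b) (hs : 0 < s) {ρ : ℝ} (hρ : 0 < ρ) :
    ∫⁻ x in Metric.ball (0 : E 2) ρ, ENNReal.ofReal (planarKernel k b s ‖x‖) =
      ENNReal.ofReal (2 * Real.pi * ((k + 1) / b * (1 - s ^ 2 / (s ^ 2 + b * ρ ^ (2 * k + 2))))) := by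
  have hc : Continuous fun x : E 2 => planarKernel k b s ‖x‖ :=
    (continuous_planarKernel hb hs).comp continuous_norm
  rw [← ofReal_integral_eq_lintegral_ofReal
    ((hc.continuousOn.integrableOn_compact (isCompact_closedBall (0 : E 2) ρ)).mono_set
      Metric.ball_subset_closedBall) (Eventually.of_forall fun x => planarKernel_nonneg _)]
  congr 1
  have h1 : ∫ x in Metric.ball (0 : E 2) ρ, planarKernel k b s ‖x‖ =
      ∫ x : E 2, (Set.Iio ρ).indicator (planarKernel k b s) ‖x‖ := by
    rw [← integral_indicator measurableSet_ball]
    congr 1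
    ext x
    simp [Set.indicator]
  rw [h1, integral_fun_norm_addHaar]
  have hball : (volume : Measure (E 2)).real (Metric.ball 0 1) = Real.pi := by
    simp [Measure.real, Real.pi_pos.le]
  have h2 : ∫ y in Set.Ioi (0 : ℝ), y ^ (Module.finrank ℝ (E 2) - 1) •
      (Set.Iio ρ).indicator (planarKernel k b s) y = ∫ r in (0 : ℝ)..ρ, r * planarKernel k b s r := by
    rw [intervalIntegral.integral_of_le hρ.le, integral_Ioc_eq_integral_Ioo,
      ← Set.Ioi_inter_Iio, ← setIntegral_indicator measurableSet_Iio]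
    congr 1
    ext y
    by_cases hy : y < ρ <;> simp [Set.indicator, hy]
  rw [h2, hball, integral_planarKernel hb hs]
  simp
  ring

/-- `S` carries at least the fraction `c` of the integral of every even function. -/
def EvenFraction (S : Set (E 2)) (c : ℝ) : Prop :=
  MeasurableSet S ∧ ∀ G : E 2 → ℝ≥0∞, Measurable G → (∀ h, G (-h) = G h) →
    ENNReal.ofReal c * ∫⁻ h, G h ≤ ∫⁻ h in S, G h

theorem evenFraction_univ : EvenFraction Set.univ 1 :=
  ⟨MeasurableSet.univ, fun G _ _ => by simp⟩

/-- The reflection `h ↦ -h` carries the complement into the half plane. The fraction `1 / 2` is why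
a boundary point has half the density of an interior one. -/
theorem evenFraction_halfPlane : EvenFraction {h : E 2 | 0 ≤ h 0} (1 / 2) := by
  have hm : MeasurableSet {h : E 2 | 0 ≤ h 0} :=
    (isClosed_le continuous_const (by fun_prop)).measurableSet
  refine ⟨hm, fun G hG heven => ?_⟩
  set S := {h : E 2 | 0 ≤ h 0} with hS
  have hneg : ∫⁻ h in Sᶜ, G h ≤ ∫⁻ h in S, G h := by
    have h1 : ∫⁻ h in S, G h = ∫⁻ h in Neg.neg ⁻¹' S, G h := by
      rw [← (Measure.measurePreserving_neg (volume : Measure (E 2))).setLIntegral_comp_preimage hm hG]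
      simp only [heven]
    rw [h1]
    refine lintegral_mono_set fun h hh => ?_
    simp only [hS, Set.mem_compl_iff, Set.mem_ofPred_eq, not_le, Set.mem_preimage] at hh ⊢
    simpa using hh.le
  have hsplit : ∫⁻ h, G h ≤ 2 * ∫⁻ h in S, G h := by
    rw [← lintegral_add_compl G hm, two_mul]
    gcongr
  calc ENNReal.ofReal (1 / 2) * ∫⁻ h, G h
      ≤ ENNReal.ofReal (1 / 2) * (2 * ∫⁻ h in S, G h) := by gcongr
    _ = ∫⁻ h in S, G h := by
        have h2 : ENNReal.ofReal (1 / 2) * 2 = 1 := by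
          rw [← ENNReal.ofReal_ofNat 2, ← ENNReal.ofReal_mul (by norm_num)]
          norm_num
        rw [← mul_assoc, h2, one_mul]

/-- A radial function composed with a linear map is no longer radial, but it is still even. So the
fraction survives a coordinate whose differential does not preserve the half plane. -/
theorem EvenFraction.le_setLIntegral_comp {S : Set (E 2)} {c : ℝ} (hS : EvenFraction S c)
    {A : E 2 →L[ℝ] E 2} (hA : Function.Injective A) {f : ℝ → ℝ} (hf : Continuous f) (ρ : ℝ) :
    ENNReal.ofReal c * ∫⁻ x in Metric.ball (0 : E 2) ρ, ENNReal.ofReal (f ‖x‖) ≤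
      ∫⁻ h in S ∩ A ⁻¹' Metric.ball 0 ρ, ENNReal.ofReal |A.det| * ENNReal.ofReal (f ‖A h‖) := by
  have hsurj : Function.Surjective A := LinearMap.injective_iff_surjective.1 hA
  have hpre : MeasurableSet (A ⁻¹' Metric.ball (0 : E 2) ρ) :=
    (Metric.isOpen_ball.preimage A.continuous).measurableSet
  set g : E 2 → ℝ≥0∞ := (Metric.ball (0 : E 2) ρ).indicator fun x => ENNReal.ofReal (f ‖x‖) with hg
  have hfm : Measurable fun x : E 2 => ENNReal.ofReal (f ‖x‖) :=
    (hf.comp continuous_norm).measurable.ennreal_ofReal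
  have hgm : Measurable g := hfm.indicator measurableSet_ball
  have hcv := lintegral_image_eq_lintegral_abs_det_fderiv_mul volume MeasurableSet.univ
    (fun x _ => A.hasFDerivAt.hasFDerivWithinAt (s := Set.univ) (x := x)) hA.injOn g
  rw [Set.image_univ, hsurj.range_eq, setLIntegral_univ, setLIntegral_univ, hg,
    lintegral_indicator measurableSet_ball, ← hg] at hcv
  rw [hcv]
  refine (hS.2 (fun h => ENNReal.ofReal |A.det| * g (A h))
    ((hgm.comp A.continuous.measurable).const_mul _) fun h => ?_).trans ?_
  · simp [hg, Set.indicator]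
  · rw [Set.inter_comm, ← Measure.restrict_restrict hpre, ← lintegral_indicator hpre]
    refine lintegral_mono fun h => ?_
    by_cases hh : A h ∈ Metric.ball (0 : E 2) ρ
    · simp [hg, Set.indicator, mem_ball_zero_iff.1 hh]
    · have : g (A h) = 0 := by simp only [hg, Set.indicator_of_notMem hh]
      simp [this]

end Planar

/-! ### Local models -/

section LocalModel

variable {n : ℕ}

/-- In the coordinate `ζ`, the map `v` is `(ζ ^ m, o(|ζ| ^ m))` near `x₀`, up to a rigid motion. -/
structure IsLocalModel (v : E 2 → E n) (R : Set (E 2)) (x₀ : E 2) (m : ℕ) (ζ : E 2 → ℂ)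
    (P : ℂ →ₗᵢ[ℝ] E n) : Prop where
  contDiff : ContDiffWithinAt ℝ 1 ζ R x₀
  zero : ζ x₀ = 0
  injective : Function.Injective (fderivWithin ℝ ζ R x₀)
  normal : ∀ᶠ x in 𝓝[R] x₀, ∀ w, inner ℝ (P w) (v x - v x₀ - P (ζ x ^ m)) = 0
  isLittleO : (fun x => v x - v x₀ - P (ζ x ^ m)) =o[𝓝[R] x₀] fun x => ‖ζ x‖ ^ m

theorem exists_norm_le_mul_of_injective {F : Type*} [NormedAddCommGroup F] [NormedSpace ℝ F]
    {T : E 2 →L[ℝ] F} (hT : Function.Injective T) : ∃ C > 0, ∀ h, ‖h‖ ≤ C * ‖T h‖ := by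
  obtain ⟨K, hK, hanti⟩ := T.exists_antilipschitzWith (LinearMap.ker_eq_bot.2 hT)
  exact ⟨K, hK, fun h => T.bound_of_antilipschitz hanti h⟩

theorem eventually_norm_sub_le_of_injective {F : Type*} [NormedAddCommGroup F] [NormedSpace ℝ F]
    {ζ : E 2 → F} {R : Set (E 2)} {x₀ : E 2} {T : E 2 →L[ℝ] F} (hζ : HasFDerivWithinAt ζ T R x₀)
    (hT : Function.Injective T) {τ : ℝ} (hτ : 0 < τ) :
    ∀ᶠ x in 𝓝[R] x₀, ‖ζ x - ζ x₀ - T (x - x₀)‖ ≤ τ * ‖T (x - x₀)‖ := by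
  obtain ⟨C, hC, hle⟩ := exists_norm_le_mul_of_injective hT
  have h := hζ.isLittleO.def (c := τ / C) (by positivity)
  filter_upwards [h] with x hx
  refine hx.trans ?_
  rw [div_mul_eq_mul_div, div_le_iff₀ hC]
  nlinarith [hle (x - x₀)]

theorem wedgeNorm_isometry_mul (P : ℂ →ₗᵢ[ℝ] E n) (c a b : ℂ) :
    wedgeNorm (P (c * a)) (P (c * b)) = ‖c‖ ^ 2 * wedgeNorm (P a) (P b) := by
  have h : inner ℝ (P (c * a)) (P (c * b)) = ‖c‖ ^ 2 * inner ℝ (P a) (P b) := by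
    rw [P.inner_map_map, P.inner_map_map, Complex.inner, Complex.inner, ← Complex.normSq_eq_norm_sq]
    simp [Complex.normSq_apply]
    ring
  unfold wedgeNorm
  rw [h, P.norm_map, P.norm_map, P.norm_map, P.norm_map, norm_mul, norm_mul,
    show (‖c‖ * ‖a‖) ^ 2 * (‖c‖ * ‖b‖) ^ 2 - (‖c‖ ^ 2 * inner ℝ (P a) (P b)) ^ 2 =
      (‖c‖ ^ 2) ^ 2 * (‖a‖ ^ 2 * ‖b‖ ^ 2 - inner ℝ (P a) (P b) ^ 2) by ring,
    Real.sqrt_mul (sq_nonneg _), Real.sqrt_sq (sq_nonneg _)]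

theorem exists_planar_representative (P : ℂ →ₗᵢ[ℝ] E n) {T : E 2 →L[ℝ] ℂ}
    (hT : Function.Injective T) :
    ∃ A : E 2 →L[ℝ] E 2, Function.Injective A ∧ (∀ h, ‖A h‖ = ‖T h‖) ∧
      |A.det| = jacobian (P.toContinuousLinearMap ∘L T) := by
  set e := Complex.orthonormalBasisOneI.repr with he
  refine ⟨e.toContinuousLinearEquiv.toContinuousLinearMap ∘L T, ?_, ?_, ?_⟩
  · exact e.injective.comp hT
  · intro h
    simp
  · set A : E 2 →L[ℝ] E 2 := e.toContinuousLinearEquiv.toContinuousLinearMap ∘L T with hA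
    have h1 : jacobian A = |A.det| := by
      have := jacobian_comp (ContinuousLinearMap.id ℝ (E 2)) A
      rw [ContinuousLinearMap.id_comp] at this
      rw [this, jacobian_eq_wedgeNorm, wedgeNorm]
      simp [EuclideanSpace.inner_single_left]
    rw [← h1, jacobian_eq_wedgeNorm, jacobian_eq_wedgeNorm]
    have h2 : ∀ x, A x = e (T x) := fun x => rfl
    have h3 : ∀ x, (P.toContinuousLinearMap ∘L T) x = P (T x) := fun x => rfl
    unfold wedgeNorm
    rw [h2, h2, h3, h3, P.inner_map_map, e.inner_map_map, P.norm_map, P.norm_map, e.norm_map,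
      e.norm_map]

variable {v : E 2 → E n} {R : Set (E 2)} {x₀ : E 2} {m : ℕ} {ζ : E 2 → ℂ} {P : ℂ →ₗᵢ[ℝ] E n}

theorem IsLocalModel.hasFDerivWithinAt (h : IsLocalModel v R x₀ m ζ P) :
    HasFDerivWithinAt ζ (fderivWithin ℝ ζ R x₀) R x₀ :=
  (h.contDiff.differentiableWithinAt one_ne_zero).hasFDerivWithinAt

theorem IsLocalModel.eventually_norm_bounds (h : IsLocalModel v R x₀ m ζ P) {τ : ℝ} (hτ : 0 < τ) :
    ∀ᶠ x in 𝓝[R] x₀, (1 - τ) * ‖fderivWithin ℝ ζ R x₀ (x - x₀)‖ ≤ ‖ζ x‖ ∧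
      ‖ζ x‖ ≤ (1 + τ) * ‖fderivWithin ℝ ζ R x₀ (x - x₀)‖ ∧
      ‖v x - v x₀‖ ≤ (1 + τ) * ‖ζ x‖ ^ m := by
  filter_upwards [eventually_norm_sub_le_of_injective h.hasFDerivWithinAt h.injective hτ,
    h.isLittleO.def hτ] with x h1 h2
  rw [h.zero, sub_zero] at h1
  have a1 := norm_sub_norm_le (ζ x) (fderivWithin ℝ ζ R x₀ (x - x₀))
  have a2 := norm_sub_norm_le (fderivWithin ℝ ζ R x₀ (x - x₀)) (ζ x)
  rw [norm_sub_rev] at a2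
  have a3 := norm_add_le (v x - v x₀ - P (ζ x ^ m)) (P (ζ x ^ m))
  rw [sub_add_cancel, P.norm_map, norm_pow] at a3
  rw [norm_pow, norm_norm] at h2
  refine ⟨by linarith, by linarith, by linarith⟩

/-- The size of the remainder says nothing about its derivative. But the remainder takes values
orthogonal to the plane of `P`, hence so does its derivative, and projecting onto that plane can
only decrease area; what remains is the Jacobian of `ζ ^ m`. -/
theorem IsLocalModel.eventually_le_jacobian (h : IsLocalModel v R x₀ m ζ P)
    (hR : UniqueDiffOn ℝ R) (hx₀ : x₀ ∈ R)
    (hv : ∀ᶠ x in 𝓝[R] x₀, DifferentiableWithinAt ℝ v R x) :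
    ∀ᶠ x in 𝓝[R] x₀, ‖(m : ℂ) * ζ x ^ (m - 1)‖ ^ 2 *
        jacobian (P.toContinuousLinearMap ∘L fderivWithin ℝ ζ R x) ≤
      jacobian (fderivWithin ℝ v R x) := by
  have hζ : ∀ᶠ x in 𝓝[R] x₀, ContDiffWithinAt ℝ 1 ζ R x := by
    have := h.contDiff.eventually (by simp)
    rwa [Set.insert_eq_of_mem hx₀] at this
  filter_upwards [hζ, hv, eventually_eventually_nhdsWithin.2 h.normal, self_mem_nhdsWithin]
    with x h1 h2 h3 hxR
  have hζ' := (h1.differentiableWithinAt one_ne_zero).hasFDerivWithinAt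
  have hv' := h2.hasFDerivWithinAt
  set c : ℂ := (m : ℂ) * ζ x ^ (m - 1) with hc
  have hpow : HasFDerivWithinAt (fun y => P (ζ y ^ m))
      (P.toContinuousLinearMap ∘L (c • fderivWithin ℝ ζ R x)) R x := by
    have := P.toContinuousLinearMap.hasFDerivAt.comp_hasFDerivWithinAt x (hζ'.pow m)
    refine this.congr_fderiv ?_
    rw [hc, nsmul_eq_mul]
  have hr := (hv'.sub_const (v x₀)).sub hpow
  set r := fderivWithin ℝ v R x - P.toContinuousLinearMap ∘L (c • fderivWithin ℝ ζ R x) with hrd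
  have horth : ∀ w y, inner ℝ (P w) (r y) = 0 := by
    intro w y
    have e1 := (innerSL ℝ (P w)).hasFDerivAt.comp_hasFDerivWithinAt x hr
    have e2 : HasFDerivWithinAt (⇑(innerSL ℝ (P w)) ∘ fun y => v y - v x₀ - P (ζ y ^ m))
        (0 : E 2 →L[ℝ] ℝ) R x := by
      refine (hasFDerivWithinAt_const (0 : ℝ) x R).congr_of_eventuallyEq ?_ ?_
      · filter_upwards [h3] with y hy
        exact hy w
      · exact h3.self_of_nhdsWithin hxR w
    have e3 := (hR x hxR).eq e1 e2
    exact DFunLike.congr_fun e3 y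
  have hdec : ∀ y, fderivWithin ℝ v R x y = P (c * fderivWithin ℝ ζ R x y) + r y := by
    intro y
    have : r y = fderivWithin ℝ v R x y - P (c * fderivWithin ℝ ζ R x y) := rfl
    rw [this]
    abel
  rw [jacobian_eq_wedgeNorm, jacobian_eq_wedgeNorm, hdec, hdec]
  refine le_trans (le_of_eq ?_) (wedgeNorm_le_of_isometry P _ _ _ _ (fun w => horth w _)
    (fun w => horth w _))
  exact (wedgeNorm_isometry_mul P c _ _).symm

theorem IsLocalModel.eventually_jacobian_coord (h : IsLocalModel v R x₀ m ζ P)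
    (hR : UniqueDiffOn ℝ R) (hx₀ : x₀ ∈ R) {τ : ℝ} (hτ : 0 < τ) :
    ∀ᶠ x in 𝓝[R] x₀, (1 - τ) * jacobian (P.toContinuousLinearMap ∘L fderivWithin ℝ ζ R x₀) ≤
      jacobian (P.toContinuousLinearMap ∘L fderivWithin ℝ ζ R x) := by
  obtain ⟨A, hA, -, hdet⟩ := exists_planar_representative P h.injective
  have hpos : 0 < jacobian (P.toContinuousLinearMap ∘L fderivWithin ℝ ζ R x₀) := by
    rw [← hdet]
    have hu : IsUnit A.toLinearMap := (LinearMap.isUnit_iff_ker_eq_bot _).2 (LinearMap.ker_eq_bot.2 hA)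
    exact abs_pos.2 ((LinearMap.isUnit_iff_isUnit_det _).1 hu).ne_zero
  have hc : ContinuousWithinAt (fderivWithin ℝ ζ R) R x₀ :=
    (h.contDiff.fderivWithin_right hR (m := 0) (by simp) hx₀).continuousWithinAt
  have hJ : Continuous fun D : E 2 →L[ℝ] ℂ => jacobian (P.toContinuousLinearMap ∘L D) :=
    continuous_jacobian.comp (by fun_prop)
  exact (hJ.continuousAt.comp_continuousWithinAt hc).eventually
    (le_mem_nhds (by simp only [Function.comp_apply]; nlinarith))

/-- The coordinate is replaced by its differential at `x₀`. The factor `(1 - τ) ^ (2 * k + 1)`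
collects `2k` powers of `‖ζ‖` and one from the Jacobian; `(1 + τ) ^ (2 * k + 4)` comes from squaring
`‖v x - v x₀‖ ≤ (1 + τ) ((1 + τ) a) ^ (k + 1)`. -/
theorem IsLocalModel.eventually_planarKernel_le {k : ℕ} (h : IsLocalModel v R x₀ (k + 1) ζ P)
    (hR : UniqueDiffOn ℝ R) (hx₀ : x₀ ∈ R)
    (hv : ∀ᶠ x in 𝓝[R] x₀, DifferentiableWithinAt ℝ v R x) {τ : ℝ} (hτ : 0 < τ) (hτ1 : τ < 1) :
    ∀ᶠ x in 𝓝[R] x₀, ∀ s > 0,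
      (1 - τ) ^ (2 * k + 1) * (jacobian (P.toContinuousLinearMap ∘L fderivWithin ℝ ζ R x₀) *
          planarKernel k ((1 + τ) ^ (2 * k + 4)) s ‖fderivWithin ℝ ζ R x₀ (x - x₀)‖) ≤
        2 * s ^ 2 / (s ^ 2 + ‖v x - v x₀‖ ^ 2) ^ 2 * jacobian (fderivWithin ℝ v R x) := by
  filter_upwards [h.eventually_norm_bounds hτ, h.eventually_le_jacobian hR hx₀ hv,
    h.eventually_jacobian_coord hR hx₀ hτ] with x ⟨h1, h2, h3⟩ h4 h5 s hs
  set a := ‖fderivWithin ℝ ζ R x₀ (x - x₀)‖ with ha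
  set J := jacobian (P.toContinuousLinearMap ∘L fderivWithin ℝ ζ R x₀) with hJ
  have ha0 : 0 ≤ a := norm_nonneg _
  have hJ0 : 0 ≤ J := jacobian_nonneg _
  have hτ' : 0 < 1 - τ := by linarith
  have b1 : ‖v x - v x₀‖ ^ 2 ≤ (1 + τ) ^ (2 * k + 4) * a ^ (2 * k + 2) := by
    have : ‖v x - v x₀‖ ≤ (1 + τ) * ((1 + τ) * a) ^ (k + 1) := by
      refine h3.trans ?_
      gcongr
    calc ‖v x - v x₀‖ ^ 2 ≤ ((1 + τ) * ((1 + τ) * a) ^ (k + 1)) ^ 2 := by gcongr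
      _ = _ := by
        rw [mul_pow (1 + τ) a]
        ring
  have b2 : (k + 1 : ℝ) ^ 2 * ((1 - τ) * a) ^ (2 * k) ≤ ‖((k + 1 : ℕ) : ℂ) * ζ x ^ (k + 1 - 1)‖ ^ 2 := by
    rw [norm_mul, norm_pow, Complex.norm_natCast, Nat.add_sub_cancel, mul_pow _ (‖ζ x‖ ^ k),
      ← pow_mul, mul_comm k 2]
    push_cast
    gcongr
  have b3 : (k + 1 : ℝ) ^ 2 * ((1 - τ) * a) ^ (2 * k) * ((1 - τ) * J) ≤
      jacobian (fderivWithin ℝ v R x) := by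
    refine le_trans ?_ h4
    gcongr
  unfold planarKernel
  calc (1 - τ) ^ (2 * k + 1) * (J * (2 * s ^ 2 * (k + 1) ^ 2 * a ^ (2 * k) /
        (s ^ 2 + (1 + τ) ^ (2 * k + 4) * a ^ (2 * k + 2)) ^ 2))
      = 2 * s ^ 2 / (s ^ 2 + (1 + τ) ^ (2 * k + 4) * a ^ (2 * k + 2)) ^ 2 *
          ((k + 1 : ℝ) ^ 2 * ((1 - τ) * a) ^ (2 * k) * ((1 - τ) * J)) := by
        rw [mul_pow]
        ring
    _ ≤ 2 * s ^ 2 / (s ^ 2 + ‖v x - v x₀‖ ^ 2) ^ 2 * jacobian (fderivWithin ℝ v R x) := by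
        gcongr

/-- The lower density bound at a point with a local model of order `k + 1`. -/
theorem IsLocalModel.eventually_le_setLIntegral {k : ℕ} (h : IsLocalModel v R x₀ (k + 1) ζ P)
    (hR : UniqueDiffOn ℝ R) (hx₀ : x₀ ∈ R)
    (hv : ∀ᶠ x in 𝓝[R] x₀, DifferentiableWithinAt ℝ v R x) {S : Set (E 2)} {c : ℝ}
    (hS : EvenFraction S c) (hc : 0 ≤ c) (hSR : ∀ᶠ y in 𝓝 0, y ∈ S → x₀ + y ∈ R) {V : Set (E 2)}
    (hV : V ∈ 𝓝[R] x₀) {κ : ℝ} (hκ : κ < c * (2 * Real.pi * (k + 1))) :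
    ∀ᶠ s in 𝓝[>] (0 : ℝ), ENNReal.ofReal κ ≤
      ∫⁻ x in V, ENNReal.ofReal (2 * s ^ 2 / (s ^ 2 + ‖v x - v x₀‖ ^ 2) ^ 2 *
        jacobian (fderivWithin ℝ v R x)) := by
  -- The limiting mass obtained with error `τ` is continuous in `τ` and equals `c · 2π(k + 1) > κ`
  -- at `τ = 0`.
  obtain ⟨τ, hτ, hτ1, hκτ⟩ : ∃ τ : ℝ, 0 < τ ∧ τ < 1 ∧
      κ < c * ((1 - τ) ^ (2 * k + 1) * (2 * Real.pi * ((k + 1) / (1 + τ) ^ (2 * k + 4)))) := by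
    have hcont : ContinuousAt (fun τ : ℝ => c * ((1 - τ) ^ (2 * k + 1) *
        (2 * Real.pi * ((k + 1) / (1 + τ) ^ (2 * k + 4))))) 0 := by
      refine ContinuousAt.mul continuousAt_const (ContinuousAt.mul (by fun_prop)
        (ContinuousAt.mul continuousAt_const (ContinuousAt.div continuousAt_const (by fun_prop) ?_)))
      simp
    have hev := hcont.eventually (lt_mem_nhds (a := κ) (by simpa using hκ))
    have hev' := (hev.filter_mono (nhdsWithin_le_nhds (s := Set.Ioi 0))).and
      (Ioo_mem_nhdsGT (zero_lt_one (α := ℝ)))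
    obtain ⟨τ, h1, h2⟩ := hev'.exists
    exact ⟨τ, h2.1, h2.2, h1⟩
  set b : ℝ := (1 + τ) ^ (2 * k + 4) with hb
  have hb0 : 0 < b := by positivity
  obtain ⟨A, hA, hAn, hdet⟩ := exists_planar_representative P h.injective
  set J := jacobian (P.toContinuousLinearMap ∘L fderivWithin ℝ ζ R x₀) with hJ
  obtain ⟨C, hC, hCle⟩ := exists_norm_le_mul_of_injective hA
  have hev := (h.eventually_planarKernel_le hR hx₀ hv hτ hτ1).and hV
  obtain ⟨η, hη, hball⟩ := Metric.mem_nhdsWithin_iff.1 hev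
  obtain ⟨η', hη', hball'⟩ := Metric.eventually_nhds_iff.1 hSR
  -- Since `‖y‖ ≤ C * ‖A y‖`, the condition `‖A y‖ < ρ` keeps `y` within both radii `η` and `η'`.
  set ρ := min η η' / C with hρ
  have hρ0 : 0 < ρ := by positivity
  set W := S ∩ A ⁻¹' Metric.ball 0 ρ with hW
  have hgood : ∀ y ∈ W, x₀ + y ∈ V ∧ ∀ s > 0, (1 - τ) ^ (2 * k + 1) *
      (J * planarKernel k b s ‖A y‖) ≤ 2 * s ^ 2 / (s ^ 2 + ‖v (x₀ + y) - v x₀‖ ^ 2) ^ 2 *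
        jacobian (fderivWithin ℝ v R (x₀ + y)) := by
    rintro y ⟨hyS, hyA⟩
    have hy : ‖y‖ < min η η' := by
      rw [Set.mem_preimage, mem_ball_zero_iff, hρ, lt_div_iff₀ hC] at hyA
      linarith [hCle y]
    have h1 : x₀ + y ∈ R :=
      hball' (by rw [dist_zero_right]; exact hy.trans_le (min_le_right _ _)) hyS
    have h2 := hball ⟨(by
      rw [Metric.mem_ball, dist_eq_norm, add_sub_cancel_left]
      exact hy.trans_le (min_le_left _ _)), h1⟩
    refine ⟨h2.2, fun s hs => ?_⟩
    have h3 := h2.1 s hs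
    rwa [add_sub_cancel_left, ← hAn] at h3
  have hWm : MeasurableSet W :=
    hS.1.inter (Metric.isOpen_ball.preimage A.continuous).measurableSet
  have hlow : ∀ s > 0, ENNReal.ofReal (c * ((1 - τ) ^ (2 * k + 1) *
      (2 * Real.pi * ((k + 1) / b * (1 - s ^ 2 / (s ^ 2 + b * ρ ^ (2 * k + 2))))))) ≤
      ∫⁻ x in V, ENNReal.ofReal (2 * s ^ 2 / (s ^ 2 + ‖v x - v x₀‖ ^ 2) ^ 2 *
        jacobian (fderivWithin ℝ v R x)) := by
    intro s hs
    set F : E 2 → ℝ≥0∞ := fun x => ENNReal.ofReal (2 * s ^ 2 / (s ^ 2 + ‖v x - v x₀‖ ^ 2) ^ 2 *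
        jacobian (fderivWithin ℝ v R x)) with hF
    have hτp : 0 ≤ (1 - τ) ^ (2 * k + 1) := pow_nonneg (by linarith) _
    have e1 := hS.le_setLIntegral_comp hA (continuous_planarKernel (k := k) hb0 hs) ρ
    rw [setLIntegral_planarKernel hb0 hs hρ0, hdet] at e1
    have e2 : ∫⁻ y in W, F (x₀ + y) ≤ ∫⁻ x in V, F x := by
      have hpre : (fun y => x₀ + y) ⁻¹' ((fun y => x₀ + y) '' W) = W :=
        Set.preimage_image_eq _ (add_right_injective x₀)
      have := (measurePreserving_add_left (volume : Measure (E 2)) x₀).setLIntegral_comp_preimage_emb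
        (measurableEmbedding_addLeft x₀) F ((fun y => x₀ + y) '' W)
      rw [hpre] at this
      rw [this]
      refine lintegral_mono_set ?_
      rintro _ ⟨y, hy, rfl⟩
      exact (hgood y hy).1
    refine le_trans ?_ e2
    calc ENNReal.ofReal (c * ((1 - τ) ^ (2 * k + 1) *
          (2 * Real.pi * ((k + 1) / b * (1 - s ^ 2 / (s ^ 2 + b * ρ ^ (2 * k + 2)))))))
        = ENNReal.ofReal ((1 - τ) ^ (2 * k + 1)) * (ENNReal.ofReal c * ENNReal.ofReal
          (2 * Real.pi * ((k + 1) / b * (1 - s ^ 2 / (s ^ 2 + b * ρ ^ (2 * k + 2)))))) := by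
          rw [← ENNReal.ofReal_mul hc, ← ENNReal.ofReal_mul hτp]
          congr 1
          ring
      _ ≤ ENNReal.ofReal ((1 - τ) ^ (2 * k + 1)) *
          ∫⁻ y in W, ENNReal.ofReal J * ENNReal.ofReal (planarKernel k b s ‖A y‖) := by gcongr
      _ = ∫⁻ y in W, ENNReal.ofReal ((1 - τ) ^ (2 * k + 1)) *
            (ENNReal.ofReal J * ENNReal.ofReal (planarKernel k b s ‖A y‖)) := by
          exact (lintegral_const_mul' _ _ ENNReal.ofReal_ne_top).symm
      _ ≤ ∫⁻ y in W, F (x₀ + y) := by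
          refine setLIntegral_mono_ae' hWm (Eventually.of_forall fun y hy => ?_)
          rw [← ENNReal.ofReal_mul (jacobian_nonneg _), ← ENNReal.ofReal_mul hτp]
          exact ENNReal.ofReal_le_ofReal ((hgood y hy).2 s hs)
  have hlim : ContinuousAt (fun s : ℝ => c * ((1 - τ) ^ (2 * k + 1) *
      (2 * Real.pi * ((k + 1) / b * (1 - s ^ 2 / (s ^ 2 + b * ρ ^ (2 * k + 2))))))) 0 := by
    refine ContinuousAt.mul continuousAt_const (ContinuousAt.mul continuousAt_const
      (ContinuousAt.mul continuousAt_const (ContinuousAt.mul continuousAt_const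
        (ContinuousAt.sub continuousAt_const (ContinuousAt.div (by fun_prop) (by fun_prop) ?_)))))
    positivity
  have hev2 := hlim.eventually (lt_mem_nhds (a := κ) (by simpa using hκτ))
  filter_upwards [nhdsWithin_le_nhds hev2, self_mem_nhdsWithin] with s h1 h2
  exact (ENNReal.ofReal_le_ofReal h1.le).trans (hlow s h2)

end LocalModel

/-! ### Local models of branched immersions and the density of the area measure -/

section Density

variable {n : ℕ} {M : Type*} [TopologicalSpace M] [ChartedSpace (EuclideanHalfSpace 2) M]

/-- `u` has a local model of order `m` at `q`, in the preferred chart at `q`. -/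
def HasOrder (u : M → E n) (q : M) (m : ℕ) : Prop :=
  ∃ (ζ : E 2 → ℂ) (P : ℂ →ₗᵢ[ℝ] E n),
    IsLocalModel (u ∘ (extChartAt (𝓡∂ 2) q).symm) (Set.range (𝓡∂ 2)) (extChartAt (𝓡∂ 2) q q) m ζ P

theorem extChartAt_self_mem_range (q : M) : extChartAt (𝓡∂ 2) q q ∈ Set.range (𝓡∂ 2) :=
  extChartAt_target_subset_range q (mem_extChartAt_target q)

theorem exists_isometry_range_eq {D : E 2 →L[ℝ] E n} (hD : Function.Injective D) :
    ∃ P : ℂ →ₗᵢ[ℝ] E n, ∀ h, ∃ w, D h = P w := by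
  set K := LinearMap.range D.toLinearMap with hK
  have hfin : Module.finrank ℝ K = 2 := by
    rw [hK, LinearMap.finrank_range_of_inj hD]
    simp
  let e : ℂ ≃ₗᵢ[ℝ] K := Complex.orthonormalBasisOneI.repr.trans
    ((stdOrthonormalBasis ℝ K).reindex (finCongr hfin)).repr.symm
  refine ⟨K.subtypeₗᵢ.comp e.toLinearIsometry, fun h => ⟨e.symm ⟨D h, ⟨h, rfl⟩⟩, ?_⟩⟩
  simp

/-- The orthogonal projection of `u - u q` to the tangent plane serves as coordinate, so the
remainder is exactly normal. It is `o(|x - x₀|)`, and `|x - x₀|` is comparable to `|ζ|`. Immersed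
points thus share the density estimate of branch points. -/
theorem hasOrder_one_of_injective [IsManifold (𝓡∂ 2) ∞ M] {u : M → E n}
    (hu : ContMDiff (𝓡∂ 2) 𝓘(ℝ, E n) 1 u) {q : M} (hq : Function.Injective (du u q)) :
    HasOrder u q 1 := by
  set x₀ := extChartAt (𝓡∂ 2) q q with hx₀
  set R := Set.range (𝓡∂ 2) with hR
  set v := u ∘ (extChartAt (𝓡∂ 2) q).symm with hv
  have hx₀t : x₀ ∈ (extChartAt (𝓡∂ 2) q).target := mem_extChartAt_target q
  set D := chartDeriv u q x₀ with hDdef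
  have hDv : HasFDerivWithinAt v D R x₀ := hasFDerivWithinAt_chartDeriv hu hx₀t
  have hD : Function.Injective D := by
    rw [hDdef, hx₀, ← du_eq_chartDeriv hu]
    exact hq
  obtain ⟨P, hP⟩ := exists_isometry_range_eq hD
  set Q : E n →L[ℝ] ℂ := ContinuousLinearMap.adjoint P.toContinuousLinearMap with hQ
  have hQin : ∀ w y, inner ℝ w (Q y) = inner ℝ (P w) y := fun w y => by
    rw [hQ, ContinuousLinearMap.adjoint_inner_right]
    rfl
  have hQP : ∀ w, Q (P w) = w := fun w => by
    refine ext_inner_left ℝ fun w' => ?_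
    rw [hQin, P.inner_map_map]
  have hPQ : ∀ h, P (Q (D h)) = D h := fun h => by
    obtain ⟨w, hw⟩ := hP h
    rw [hw, hQP]
  set ζ : E 2 → ℂ := fun x => Q (v x - v x₀) with hζ
  have hcd : ContDiffWithinAt ℝ 1 v R x₀ :=
    (contDiffOn_comp_extChartAt_symm hu q x₀ hx₀t).mono_of_mem_nhdsWithin (eventually_mem_target hx₀t)
  have hζd : HasFDerivWithinAt ζ (Q ∘L D) R x₀ :=
    Q.hasFDerivAt.comp_hasFDerivWithinAt x₀ (hDv.sub_const (v x₀))
  have hQD : Function.Injective (Q ∘L D) := fun a b hab => hD (by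
    have : Q (D a) = Q (D b) := hab
    rw [← hPQ, this, hPQ])
  have hζ0 : ζ x₀ = 0 := by
    simp only [hζ, sub_self, map_zero]
  refine ⟨ζ, P, ?_, hζ0, ?_, ?_, ?_⟩
  · exact Q.contDiff.comp_contDiffWithinAt (hcd.sub contDiffWithinAt_const)
  · rwa [hζd.fderivWithin (uniqueDiffWithinAt_range hx₀t)]
  · refine Eventually.of_forall fun x w => ?_
    rw [pow_one, inner_sub_right, ← hQin, P.inner_map_map, sub_self]
  · have h1 := hDv.isLittleO
    have h2 : (fun x => x - x₀) =O[𝓝[R] x₀] fun x => ‖ζ x‖ ^ 1 := by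
      obtain ⟨C, hC, hle⟩ := exists_norm_le_mul_of_injective hQD
      refine Asymptotics.IsBigO.of_bound (2 * C) ?_
      filter_upwards [eventually_norm_sub_le_of_injective hζd hQD (τ := 1 / 2) (by norm_num)]
        with x hx
      rw [hζ0, sub_zero] at hx
      have h4 := norm_sub_norm_le ((Q ∘L D) (x - x₀)) (ζ x)
      rw [norm_sub_rev] at h4
      rw [pow_one, norm_norm]
      have h5 := hle (x - x₀)
      nlinarith
    have h3 : (fun x => v x - v x₀ - P (ζ x ^ 1)) = fun x =>
        (ContinuousLinearMap.id ℝ (E n) - P.toContinuousLinearMap ∘L Q) (v x - v x₀ - D (x - x₀)) := by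
      ext1 x
      have : P (Q (D (x - x₀))) = D (x - x₀) := hPQ _
      simp only [pow_one, hζ]
      change _ = (v x - v x₀ - D (x - x₀)) - P (Q (v x - v x₀ - D (x - x₀)))
      rw [map_sub Q (v x - v x₀), map_sub P (Q (v x - v x₀)), this]
      abel
    rw [h3]
    exact ((ContinuousLinearMap.isBigO_comp _ _ _).trans_isLittleO h1).trans_isBigO h2

theorem IsBranchPoint.exists_hasOrder {u : M → E n} {q : M} (hq : IsBranchPoint u q) :
    ∃ m, 2 ≤ m ∧ HasOrder u q m := by
  obtain ⟨m, z, P, f, hm, hz, hz0, hinj, horth, hf, hu⟩ := hq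
  refine ⟨m, hm, z ∘ (extChartAt (𝓡∂ 2) q).symm, P, ?_⟩
  have hsymm : Tendsto (extChartAt (𝓡∂ 2) q).symm
      (𝓝[Set.range (𝓡∂ 2)] (extChartAt (𝓡∂ 2) q q)) (𝓝 q) :=
    (map_extChartAt_symm_nhdsWithin_range q).le
  have hcd : ContDiffWithinAt ℝ 1 (z ∘ (extChartAt (𝓡∂ 2) q).symm) (Set.range (𝓡∂ 2))
      (extChartAt (𝓡∂ 2) q q) := (contMDiffAt_iff.1 hz).2
  have hzc : Tendsto (z ∘ (extChartAt (𝓡∂ 2) q).symm)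
      (𝓝[Set.range (𝓡∂ 2)] (extChartAt (𝓡∂ 2) q q)) (𝓝 0) := by
    rw [← hz0]
    exact hz.continuousAt.tendsto.comp hsymm
  have hres : ∀ᶠ x in 𝓝[Set.range (𝓡∂ 2)] (extChartAt (𝓡∂ 2) q q),
      (u ∘ (extChartAt (𝓡∂ 2) q).symm) x -
        (u ∘ (extChartAt (𝓡∂ 2) q).symm) (extChartAt (𝓡∂ 2) q q) -
        P ((z ∘ (extChartAt (𝓡∂ 2) q).symm) x ^ m) =
      f ((z ∘ (extChartAt (𝓡∂ 2) q).symm) x) := by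
    filter_upwards [hsymm.eventually hu] with x hx
    simp only [Function.comp_apply, extChartAt_to_inv]
    rw [hx]
    abel
  refine ⟨hcd, ?_, ?_, ?_, ?_⟩
  · simp only [Function.comp_apply, extChartAt_to_inv, hz0]
  · have h1 : mfderiv (𝓡∂ 2) 𝓘(ℝ, ℂ) z q = fderivWithin ℝ (z ∘ (extChartAt (𝓡∂ 2) q).symm)
        (Set.range (𝓡∂ 2)) (extChartAt (𝓡∂ 2) q q) :=
      (hz.mdifferentiableAt one_ne_zero).mfderiv
    rw [← h1]
    exact hinj
  · filter_upwards [hres] with x hx w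
    rw [hx]
    exact horth _ _
  · exact (hf.comp_tendsto hzc).congr' (hres.mono fun x hx => hx.symm) EventuallyEq.rfl

/-- The displacement of `u` is `O(|x - x₀| ^ m)` with `m ≥ 2`. This serves to show that the conormal
takes the value zero at boundary branch points. -/
theorem du_eq_zero_of_hasOrder {u : M → E n} (hu : ContMDiff (𝓡∂ 2) 𝓘(ℝ, E n) 1 u) {q : M} {m : ℕ}
    (hm : 2 ≤ m) (h : HasOrder u q m) : du u q = 0 := by
  obtain ⟨ζ, P, h⟩ := h
  rw [du_eq_chartDeriv hu]
  set x₀ := extChartAt (𝓡∂ 2) q q with hx₀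
  refine HasFDerivWithinAt.fderivWithin ?_ (uniqueDiffWithinAt_range (mem_extChartAt_target q))
  rw [hasFDerivWithinAt_iff_isLittleO]
  simp only [zero_apply, sub_zero]
  have h1 : ζ =O[𝓝[Set.range (𝓡∂ 2)] x₀] fun x => x - x₀ := by
    have := h.hasFDerivWithinAt.isBigO_sub
    simpa [h.zero] using this
  have h2 : (fun x => (u ∘ (extChartAt (𝓡∂ 2) q).symm) x - (u ∘ (extChartAt (𝓡∂ 2) q).symm) x₀)
      =O[𝓝[Set.range (𝓡∂ 2)] x₀] fun x => ‖ζ x‖ ^ m := by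
    refine Asymptotics.IsBigO.of_bound 2 ?_
    filter_upwards [h.eventually_norm_bounds (τ := 1) one_pos] with x hx
    rw [norm_pow, norm_norm]
    linarith [hx.2.2]
  have h3 : (fun x => ‖ζ x‖ ^ m) =O[𝓝[Set.range (𝓡∂ 2)] x₀] fun x => ‖x - x₀‖ ^ m :=
    h1.norm_norm.pow m
  have h4 : (fun x => ‖x - x₀‖ ^ m) =o[𝓝[Set.range (𝓡∂ 2)] x₀] fun x => x - x₀ := by
    have hlim : Tendsto (fun x => x - x₀) (𝓝[Set.range (𝓡∂ 2)] x₀) (𝓝 0) := by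
      have : Continuous fun x : E 2 => x - x₀ := by fun_prop
      have h := this.tendsto x₀
      rw [sub_self] at h
      exact h.mono_left nhdsWithin_le_nhds
    exact (Asymptotics.isLittleO_norm_pow_id (by omega)).comp_tendsto hlim
  exact (h2.trans h3).trans_isLittleO h4

theorem range_halfSpace_eq : Set.range (𝓡∂ 2) = {y : E 2 | 0 ≤ y 0} :=
  range_modelWithCornersEuclideanHalfSpace 2

theorem extChartAt_self_zero_of_boundary {q : M} (hq : q ∈ (𝓡∂ 2).boundary M) :
    extChartAt (𝓡∂ 2) q q 0 = 0 := by
  have h : extChartAt (𝓡∂ 2) q q ∈ frontier (Set.range (𝓡∂ 2)) := hq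
  rw [frontier_range_modelWithCornersEuclideanHalfSpace] at h
  exact h.symm

variable [IsManifold (𝓡∂ 2) ∞ M] [MeasurableSpace M] [BorelSpace M]

theorem HasOrder.eventually_le_setLIntegral {u : M → E n} (hu : ContMDiff (𝓡∂ 2) 𝓘(ℝ, E n) 1 u)
    {q : M} {k : ℕ} (h : HasOrder u q (k + 1)) {S : Set (E 2)} {c : ℝ} (hS : EvenFraction S c)
    (hc : 0 ≤ c)
    (hSR : ∀ᶠ y in 𝓝 0, y ∈ S → extChartAt (𝓡∂ 2) q q + y ∈ Set.range (𝓡∂ 2)) {U : Set M}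
    (hU : U ∈ 𝓝 q) {κ : ℝ} (hκ : κ < c * (2 * Real.pi * (k + 1))) :
    ∀ᶠ s in 𝓝[>] (0 : ℝ), ENNReal.ofReal κ ≤
      ∫⁻ q' in U, ENNReal.ofReal (2 * s ^ 2 / (s ^ 2 + ‖u q' - u q‖ ^ 2) ^ 2) ∂area u := by
  obtain ⟨ζ, P, h⟩ := h
  obtain ⟨O, hOU, hO, hqO⟩ := mem_nhds_iff.1 hU
  set x₀ := extChartAt (𝓡∂ 2) q q with hx₀
  have hx₀t : x₀ ∈ (extChartAt (𝓡∂ 2) q).target := mem_extChartAt_target q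
  set V := (extChartAt (𝓡∂ 2) q).symm ⁻¹' O ∩ (extChartAt (𝓡∂ 2) q).target with hV
  have hVm : MeasurableSet V := measurableSet_symm_preimage_inter_target q hO.measurableSet
  have hVn : V ∈ 𝓝[Set.range (𝓡∂ 2)] x₀ := by
    refine inter_mem ?_ (eventually_mem_target hx₀t)
    have hsymm : Tendsto (extChartAt (𝓡∂ 2) q).symm (𝓝[Set.range (𝓡∂ 2)] x₀) (𝓝 q) :=
      (map_extChartAt_symm_nhdsWithin_range q).le
    exact hsymm (hO.mem_nhds hqO)
  have hdiff : ∀ᶠ x in 𝓝[Set.range (𝓡∂ 2)] x₀,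
      DifferentiableWithinAt ℝ (u ∘ (extChartAt (𝓡∂ 2) q).symm) (Set.range (𝓡∂ 2)) x :=
    (eventually_mem_target hx₀t).mono fun x hx =>
      (hasFDerivWithinAt_chartDeriv hu hx).differentiableWithinAt
  filter_upwards [h.eventually_le_setLIntegral (𝓡∂ 2).uniqueDiffOn (extChartAt_self_mem_range q)
    hdiff hS hc hSR hVn hκ, self_mem_nhdsWithin] with s hs hs0
  refine hs.trans ?_
  have hs0' : (0 : ℝ) < s := hs0
  set f : M → ℝ≥0∞ := fun q' => ENNReal.ofReal (2 * s ^ 2 / (s ^ 2 + ‖u q' - u q‖ ^ 2) ^ 2) with hf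
  have hfm : Measurable f := by
    have huc := hu.continuous
    have : Continuous fun q' => 2 * s ^ 2 / (s ^ 2 + ‖u q' - u q‖ ^ 2) ^ 2 :=
      continuous_const.div (by fun_prop) fun q' => by positivity
    exact this.measurable.ennreal_ofReal
  have hJm : AEMeasurable (fun x => ENNReal.ofReal (jacobian (chartDeriv u q x)))
      (volume.restrict (extChartAt (𝓡∂ 2) q).target) :=
    ((continuous_jacobian.comp_continuousOn (continuousOn_chartDeriv hu q)).aemeasurable
      (measurableSet_extChartAt_target q)).ennreal_ofReal
  -- A lower bound needs only the chart at `q`, which is one of the measures in the supremum.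
  have hle : ∫⁻ q' in O, f q' ∂chartArea u q ≤ ∫⁻ q' in U, f q' ∂area u :=
    lintegral_mono' (Measure.restrict_mono hOU (le_iSup (chartArea u) q)) le_rfl
  refine le_trans (le_of_eq ?_) hle
  have hind : Measurable (O.indicator f) := hfm.indicator hO.measurableSet
  have hchart : chartArea u q = ((volume.restrict (extChartAt (𝓡∂ 2) q).target).withDensity fun x =>
      ENNReal.ofReal (jacobian (chartDeriv u q x))).map (extChartAt (𝓡∂ 2) q).symm := rfl
  rw [← lintegral_indicator hO.measurableSet, hchart,
    lintegral_map' hind.aemeasurable (aemeasurable_extChartAt_symm q _),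
    lintegral_withDensity_eq_lintegral_mul_non_measurable₀ _ hJm
      (Eventually.of_forall fun x => ENNReal.ofReal_lt_top),
    ← lintegral_indicator hVm, ← lintegral_indicator (measurableSet_extChartAt_target q)]
  congr 1
  ext1 x
  by_cases hxt : x ∈ (extChartAt (𝓡∂ 2) q).target
  · by_cases hxO : (extChartAt (𝓡∂ 2) q).symm x ∈ O
    · rw [Set.indicator_of_mem (show x ∈ V from ⟨hxO, hxt⟩), Set.indicator_of_mem hxt, Pi.mul_apply,
        Set.indicator_of_mem hxO, mul_comm, ENNReal.ofReal_mul (jacobian_nonneg _)]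
      simp only [hf, Function.comp_apply, hx₀, extChartAt_to_inv]
      rfl
    · rw [Set.indicator_of_notMem (fun hx : x ∈ V => hxO hx.1), Set.indicator_of_mem hxt,
        Pi.mul_apply, Set.indicator_of_notMem hxO, mul_zero]
  · rw [Set.indicator_of_notMem (fun hx : x ∈ V => hxt hx.2), Set.indicator_of_notMem hxt]

theorem HasOrder.eventually_le_of_interior {u : M → E n} (hu : ContMDiff (𝓡∂ 2) 𝓘(ℝ, E n) 1 u)
    {q : M} (hq : (𝓡∂ 2).IsInteriorPoint q) {k : ℕ} (h : HasOrder u q (k + 1)) {U : Set M}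
    (hU : U ∈ 𝓝 q) {κ : ℝ} (hκ : κ < 2 * Real.pi * (k + 1)) :
    ∀ᶠ s in 𝓝[>] (0 : ℝ), ENNReal.ofReal κ ≤
      ∫⁻ q' in U, ENNReal.ofReal (2 * s ^ 2 / (s ^ 2 + ‖u q' - u q‖ ^ 2) ^ 2) ∂area u := by
  refine h.eventually_le_setLIntegral hu evenFraction_univ zero_le_one ?_ hU (by rwa [one_mul])
  have hc : Continuous fun y : E 2 => extChartAt (𝓡∂ 2) q q + y := by fun_prop
  have h1 : Set.range (𝓡∂ 2) ∈ 𝓝 (extChartAt (𝓡∂ 2) q q + 0) := by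
    rw [add_zero]
    exact mem_interior_iff_mem_nhds.1 hq
  filter_upwards [hc.continuousAt.eventually h1] with y hy _ using hy

theorem HasOrder.eventually_le_of_boundary {u : M → E n} (hu : ContMDiff (𝓡∂ 2) 𝓘(ℝ, E n) 1 u)
    {q : M} (hq : q ∈ (𝓡∂ 2).boundary M) {k : ℕ} (h : HasOrder u q (k + 1)) {U : Set M}
    (hU : U ∈ 𝓝 q) {κ : ℝ} (hκ : κ < Real.pi * (k + 1)) :
    ∀ᶠ s in 𝓝[>] (0 : ℝ), ENNReal.ofReal κ ≤
      ∫⁻ q' in U, ENNReal.ofReal (2 * s ^ 2 / (s ^ 2 + ‖u q' - u q‖ ^ 2) ^ 2) ∂area u := by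
  refine h.eventually_le_setLIntegral hu evenFraction_halfPlane (by norm_num) ?_ hU (by linarith)
  refine Eventually.of_forall fun y hy => ?_
  rw [range_halfSpace_eq]
  change 0 ≤ (extChartAt (𝓡∂ 2) q q + y) 0
  rw [PiLp.add_apply, extChartAt_self_zero_of_boundary hq, zero_add]
  exact hy

end Density

/-! ### The boundary -/

section Boundary

variable {n : ℕ} {M : Type*} [TopologicalSpace M] [ChartedSpace (EuclideanHalfSpace 2) M]

/-- The boundary line through the image of `q` in the chart at `q`. -/
noncomputable def boundaryLine (q : M) (s : ℝ) : E 2 :=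
  extChartAt (𝓡∂ 2) q q + s • EuclideanSpace.single 1 1

theorem continuous_boundaryLine (q : M) : Continuous (boundaryLine q) := by
  unfold boundaryLine
  fun_prop

@[simp] theorem boundaryLine_zero (q : M) : boundaryLine q 0 = extChartAt (𝓡∂ 2) q q := by
  simp only [boundaryLine, zero_smul, add_zero]

theorem boundaryLine_injective (q : M) : Function.Injective (boundaryLine q) := by
  intro a b hab
  have h := add_left_cancel hab
  have h1 := congrArg (fun y : E 2 => y 1) h
  simpa using h1

theorem hasDerivAt_boundaryLine (q : M) :
    HasDerivAt (boundaryLine q) (EuclideanSpace.single 1 1) 0 := by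
  have h := ((hasDerivAt_id (0 : ℝ)).smul_const (EuclideanSpace.single (1 : Fin 2) (1 : ℝ))).const_add
    (extChartAt (𝓡∂ 2) q q)
  rw [one_smul] at h
  exact h

theorem boundaryLine_apply_zero {q : M} (hq : q ∈ (𝓡∂ 2).boundary M) (s : ℝ) :
    boundaryLine q s 0 = 0 := by
  rw [boundaryLine, PiLp.add_apply, extChartAt_self_zero_of_boundary hq]
  simp

theorem boundaryLine_mem_range {q : M} (hq : q ∈ (𝓡∂ 2).boundary M) (s : ℝ) :
    boundaryLine q s ∈ Set.range (𝓡∂ 2) := by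
  rw [range_halfSpace_eq]
  exact (boundaryLine_apply_zero hq s).ge

theorem tendsto_boundaryLine {q : M} (hq : q ∈ (𝓡∂ 2).boundary M) :
    Tendsto (boundaryLine q) (𝓝 0) (𝓝[Set.range (𝓡∂ 2)] (extChartAt (𝓡∂ 2) q q)) := by
  refine tendsto_nhdsWithin_iff.2 ⟨?_, Eventually.of_forall (boundaryLine_mem_range hq)⟩
  have := (continuous_boundaryLine q).tendsto 0
  rwa [boundaryLine_zero] at this

theorem eventually_boundaryLine_mem_target {q : M} (hq : q ∈ (𝓡∂ 2).boundary M) :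
    ∀ᶠ s in 𝓝 0, boundaryLine q s ∈ (extChartAt (𝓡∂ 2) q).target :=
  (tendsto_boundaryLine hq).eventually (eventually_mem_target (mem_extChartAt_target q))

/-- Boundary points are defined through their own preferred chart; being interior can be read in any
chart of the atlas, here the one at `q`. -/
theorem symm_boundaryLine_mem_boundary [IsManifold (𝓡∂ 2) ∞ M] {q : M}
    (hq : q ∈ (𝓡∂ 2).boundary M) {s : ℝ}
    (hs : boundaryLine q s ∈ (extChartAt (𝓡∂ 2) q).target) :
    (extChartAt (𝓡∂ 2) q).symm (boundaryLine q s) ∈ (𝓡∂ 2).boundary M := by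
  have hsrc := (extChartAt (𝓡∂ 2) q).map_target hs
  rw [extChartAt_source] at hsrc
  by_contra hb
  have hi := (ModelWithCorners.isInteriorPoint_iff_of_mem_atlas (I := 𝓡∂ 2) (n := ∞) (by simp)
    (chart_mem_atlas (EuclideanHalfSpace 2) q) hsrc).1
      ((ModelWithCorners.isInteriorPoint_iff_not_isBoundaryPoint _).2 hb)
  change extChartAt (𝓡∂ 2) q _ ∈ interior (extChartAt (𝓡∂ 2) q).target at hi
  rw [(extChartAt (𝓡∂ 2) q).right_inv hs] at hi
  have h1 := interior_mono (extChartAt_target_subset_range (I := 𝓡∂ 2) q) hi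
  rw [interior_range_modelWithCornersEuclideanHalfSpace] at h1
  exact (ne_of_gt h1) (boundaryLine_apply_zero hq s)

variable {u : M → E n} {γ : ℝ → E n}

theorem eventually_boundaryLine_mem_curve [IsManifold (𝓡∂ 2) ∞ M]
    (hΓ : boundaryCurve u = Set.range γ) {q : M} (hq : q ∈ (𝓡∂ 2).boundary M) :
    ∀ᶠ s in 𝓝 0, u ((extChartAt (𝓡∂ 2) q).symm (boundaryLine q s)) ∈ Set.range γ := by
  filter_upwards [eventually_boundaryLine_mem_target hq] with s hs
  rw [← hΓ]
  exact ⟨_, symm_boundaryLine_mem_boundary hq hs, rfl⟩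

theorem norm_boundaryConormal_le (x : E n) : ‖boundaryConormal u x‖ ≤ 1 := by
  unfold boundaryConormal
  split_ifs with h
  · simp only [conormal, norm_smul, norm_inv, norm_norm]
    exact inv_mul_le_one
  · simp

/-- The conormal is orthogonal to `du(e₁)` by construction. The boundary arc in the chart only runs
inside the range of `γ`, with no reparametrization at hand, so that `du(e₁)` is parallel to `γ'`
comes from the tangency of `C¹` curves. -/
theorem inner_conormal_deriv [IsManifold (𝓡∂ 2) ∞ M] (hu : ContMDiff (𝓡∂ 2) 𝓘(ℝ, E n) 1 u)
    (hγ : IsC1ClosedCurve γ) (hΓ : boundaryCurve u = Set.range γ) {q : M}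
    (hq : q ∈ (𝓡∂ 2).boundary M) {t : ℝ} (ht : u q = γ t) (hinj : Function.Injective (du u q)) :
    inner ℝ (conormal u q) (deriv γ t) = 0 := by
  set a := du u q (EuclideanSpace.single 1 1) with ha
  have ha0 : a ≠ 0 := by
    intro h0
    have h1 := hinj (h0.trans (map_zero (du u q)).symm)
    have h2 := congrArg (fun y : E 2 => y 1) h1
    simp at h2
  set σ : ℝ → E n := fun s => u ((extChartAt (𝓡∂ 2) q).symm (boundaryLine q s)) with hσ
  have hσ0 : σ 0 = γ t := by
    simp only [hσ, boundaryLine_zero, extChartAt_to_inv, ht]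
  have hder : HasDerivAt σ a 0 := by
    have h1 := hasFDerivWithinAt_chartDeriv hu (mem_extChartAt_target (I := 𝓡∂ 2) q)
    rw [← du_eq_chartDeriv hu, ← boundaryLine_zero q] at h1
    exact h1.comp_hasDerivAt 0 (hasDerivAt_boundaryLine q)
      (Eventually.of_forall (boundaryLine_mem_range hq))
  have hQ : (ℝ ∙ deriv γ t)ᗮ.starProjection a = 0 := by
    refine normalProjection_eq_zero_of_tendsto hγ t (k := 1) one_ne_zero
      (eventually_boundaryLine_mem_curve hΓ hq) ?_
    have h1 := hasDerivAt_iff_tendsto_slope.1 hder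
    refine h1.congr fun s => ?_
    rw [slope_def_module, sub_zero, pow_one, hσ0]
  have hmem : a ∈ (ℝ ∙ deriv γ t) := by
    have := (Submodule.starProjection_apply_eq_zero_iff _).1 hQ
    rwa [Submodule.orthogonal_orthogonal] at this
  obtain ⟨c, hc⟩ := Submodule.mem_span_singleton.1 hmem
  have hc0 : c ≠ 0 := by
    rintro rfl
    exact ha0 (by rw [← hc, zero_smul])
  have hγa : deriv γ t = c⁻¹ • a := by rw [← hc, smul_smul, inv_mul_cancel₀ hc0, one_smul]
  have hw : ∀ y, inner ℝ ((ℝ ∙ a)ᗮ.starProjection y) a = 0 := fun y =>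
    (Submodule.mem_orthogonal' _ _).1 (Submodule.starProjection_apply_mem _ y) a
      (Submodule.mem_span_singleton_self a)
  rw [hγa, inner_smul_right]
  simp only [conormal]
  rw [inner_smul_left]
  exact mul_eq_zero_of_right _ (mul_eq_zero_of_right _ (hw _))

theorem inner_boundaryConormal_deriv [IsManifold (𝓡∂ 2) ∞ M] (hu : IsBranchedImmersion u)
    (hγ : IsC1ClosedCurve γ) (hΓ : boundaryCurve u = Set.range γ) (t : ℝ) :
    inner ℝ (boundaryConormal u (γ t)) (deriv γ t) = 0 := by
  unfold boundaryConormal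
  split_ifs with h
  · obtain ⟨hq, ht⟩ := h.choose_spec
    rcases hu.immersed_or_branch h.choose with hi | hb
    · exact inner_conormal_deriv hu.contMDiff hγ hΓ hq ht hi
    · obtain ⟨m, hm, ho⟩ := hb.exists_hasOrder
      have h0 := du_eq_zero_of_hasOrder hu.contMDiff hm ho
      simp [conormal, h0]
  · simp

/-- At a boundary point the order of a branch point is not two: otherwise the boundary curve would
turn back on itself. -/
theorem not_hasOrder_two_of_boundary [IsManifold (𝓡∂ 2) ∞ M]
    (hu : ContMDiff (𝓡∂ 2) 𝓘(ℝ, E n) 1 u)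
    (hinj : Set.InjOn u ((𝓡∂ 2).boundary M))
    (hγ : IsC1ClosedCurve γ) (hΓ : boundaryCurve u = Set.range γ) {q : M}
    (hq : q ∈ (𝓡∂ 2).boundary M) : ¬ HasOrder u q 2 := by
  rintro ⟨ζ, P, h⟩
  obtain ⟨t, ht⟩ : ∃ t, γ t = u q := by
    have : u q ∈ boundaryCurve u := ⟨q, hq, rfl⟩
    rwa [hΓ] at this
  set x₀ := extChartAt (𝓡∂ 2) q q with hx₀
  set T := fderivWithin ℝ ζ (Set.range (𝓡∂ 2)) x₀ with hT
  set b := T (EuclideanSpace.single 1 1) with hb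
  have hb0 : b ≠ 0 := by
    intro h0
    have h1 := h.injective (h0.trans (map_zero T).symm)
    have h2 := congrArg (fun y : E 2 => y 1) h1
    simp at h2
  set σ : ℝ → E n := fun s => u ((extChartAt (𝓡∂ 2) q).symm (boundaryLine q s)) with hσ
  have hσ0 : σ 0 = γ t := by
    simp only [hσ, boundaryLine_zero, extChartAt_to_inv, ht]
  -- second order expansion along the boundary
  have hζd : HasDerivAt (fun s => ζ (boundaryLine q s)) b 0 := by
    have h1 := h.hasFDerivWithinAt
    rw [hx₀, ← boundaryLine_zero q] at h1
    have h2 := h1.comp_hasDerivAt 0 (hasDerivAt_boundaryLine q)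
      (Eventually.of_forall (boundaryLine_mem_range hq))
    rw [boundaryLine_zero] at h2
    exact h2
  have hζlim : Tendsto (fun s : ℝ => s⁻¹ • ζ (boundaryLine q s)) (𝓝[≠] 0) (𝓝 b) := by
    refine (hasDerivAt_iff_tendsto_slope.1 hζd).congr fun s => ?_
    rw [slope_def_module, sub_zero, boundaryLine_zero, ← hx₀, h.zero, sub_zero]
  have hlim : Tendsto (fun s : ℝ => (s ^ 2)⁻¹ • (σ s - γ t)) (𝓝[≠] 0) (𝓝 (P (b ^ 2))) := by
    have h1 : Tendsto (fun s : ℝ => P ((s⁻¹ • ζ (boundaryLine q s)) ^ 2)) (𝓝[≠] 0)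
        (𝓝 (P (b ^ 2))) := (P.continuous.tendsto _).comp (hζlim.pow 2)
    have h2 : Tendsto (fun s : ℝ => (s ^ 2)⁻¹ • (σ s - γ t - P (ζ (boundaryLine q s) ^ 2)))
        (𝓝[≠] 0) (𝓝 0) := by
      have e1 := h.isLittleO.comp_tendsto ((tendsto_boundaryLine hq).mono_left
        (nhdsWithin_le_nhds (s := {(0 : ℝ)}ᶜ)))
      have e2 : (fun s : ℝ => σ s - γ t - P (ζ (boundaryLine q s) ^ 2)) =o[𝓝[≠] 0]
          fun s => ‖ζ (boundaryLine q s)‖ ^ 2 := by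
        refine e1.congr (fun s => ?_) fun s => rfl
        simp only [Function.comp_apply, hσ, hx₀, extChartAt_to_inv, ht]
      have e3 : (fun s => ‖ζ (boundaryLine q s)‖ ^ 2) =O[𝓝[≠] (0 : ℝ)] fun s => s ^ 2 := by
        have := hζd.hasFDerivAt.isBigO_sub
        simp only [boundaryLine_zero, ← hx₀, h.zero, sub_zero] at this
        exact ((this.mono nhdsWithin_le_nhds).norm_left).pow 2
      have e4 := e2.trans_isBigO e3
      exact e4.tendsto_inv_smul_nhds_zero
    have h3 := h1.add h2
    rw [add_zero] at h3
    refine h3.congr fun s => ?_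
    have e : (s⁻¹ • ζ (boundaryLine q s)) ^ 2 = (s ^ 2)⁻¹ • ζ (boundaryLine q s) ^ 2 := by
      rw [smul_pow, inv_pow]
    rw [e, map_smul, ← smul_add]
    congr 1
    abel
  have hQ := normalProjection_eq_zero_of_tendsto hγ t two_ne_zero
    (eventually_boundaryLine_mem_curve hΓ hq) hlim
  obtain ⟨l, hl⟩ : ∃ l : ℝ, l • deriv γ t = P (b ^ 2) := by
    have := (Submodule.starProjection_apply_eq_zero_iff _).1 hQ
    rw [Submodule.orthogonal_orthogonal] at this
    exact Submodule.mem_span_singleton.1 this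
  have hl0 : l ≠ 0 := by
    rintro rfl
    rw [zero_smul] at hl
    exact pow_ne_zero 2 hb0 (P.injective (hl.symm.trans (map_zero P).symm))
  -- the height along the tangent is injective along the boundary, but has a strict extremum
  set g : ℝ → ℝ := fun s => l * inner ℝ (σ s - γ t) (deriv γ t) with hg
  have hg0 : g 0 = 0 := by simp only [hg, hσ0, sub_self, inner_zero_left, mul_zero]
  have hgpos : ∀ᶠ s in 𝓝[≠] 0, 0 < g s := by
    have h1 : Tendsto (fun s : ℝ => (s ^ 2)⁻¹ * g s) (𝓝[≠] 0) (𝓝 (l ^ 2 * ‖deriv γ t‖ ^ 2)) := by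
      have h2 := (hlim.inner (tendsto_const_nhds (x := deriv γ t))).const_mul l
      rw [← hl, inner_smul_left, real_inner_self_eq_norm_sq] at h2
      simp only [inner_smul_left, RCLike.conj_to_real] at h2
      convert h2 using 2
      · ring
      · ring
    have hpos : 0 < l ^ 2 * ‖deriv γ t‖ ^ 2 := by
      have := norm_pos_iff.2 (hγ.regular t)
      positivity
    filter_upwards [h1.eventually (lt_mem_nhds hpos), self_mem_nhdsWithin] with s hs hs0
    have h3 : (0 : ℝ) < (s ^ 2)⁻¹ := by
      have : s ≠ 0 := hs0
      positivity
    exact pos_of_mul_pos_right hs h3.le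
  obtain ⟨r, hr, hinjr⟩ := exists_injOn_inner_deriv hγ t
  have hσc : ∀ᶠ s in 𝓝 0, ContinuousAt σ s := by
    filter_upwards [eventually_boundaryLine_mem_target hq] with s hs
    exact hu.continuous.continuousAt.comp
      ((continuousAt_extChartAt_symm'' hs).comp (continuous_boundaryLine q).continuousAt)
  have hσball : ∀ᶠ s in 𝓝 0, σ s ∈ Metric.ball (γ t) r := by
    have h1 : ContinuousAt σ 0 := hσc.self_of_nhds
    rw [← hσ0]
    exact h1 (Metric.ball_mem_nhds _ hr)
  have hall : ∀ᶠ s in 𝓝 (0 : ℝ), boundaryLine q s ∈ (extChartAt (𝓡∂ 2) q).target ∧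
      σ s ∈ Set.range γ ∩ Metric.ball (γ t) r ∧ ContinuousAt σ s ∧ (s ≠ 0 → 0 < g s) := by
    filter_upwards [eventually_boundaryLine_mem_target hq, eventually_boundaryLine_mem_curve hΓ hq,
      hσball, hσc, eventually_nhdsWithin_iff.1 hgpos] with s h1 h2 h3 h4 h5
    exact ⟨h1, ⟨h2, h3⟩, h4, h5⟩
  obtain ⟨η, hη, hball⟩ := Metric.eventually_nhds_iff.1 hall
  have hgood : ∀ s ∈ Set.Icc (-(η / 2)) (η / 2), _ := fun s hs =>
    hball (y := s) (by rw [Real.dist_eq, sub_zero, abs_lt]; constructor <;> linarith [hs.1, hs.2])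
  have hginj : Set.InjOn g (Set.Icc (-(η / 2)) (η / 2)) := by
    intro s hs s' hs' hss
    have h1 := hgood s hs
    have h2 := hgood s' hs'
    have h3 := hinjr h1.2.1 h2.2.1 (mul_left_cancel₀ hl0 hss)
    have h4 := hinj (symm_boundaryLine_mem_boundary hq h1.1) (symm_boundaryLine_mem_boundary hq h2.1) h3
    exact boundaryLine_injective q ((extChartAt (𝓡∂ 2) q).symm.injOn h1.1 h2.1 h4)
  have hgc : ContinuousOn g (Set.Icc (-(η / 2)) (η / 2)) := by
    intro s hs
    have h1 : ContinuousAt σ s := (hgood s hs).2.2.1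
    exact (continuousAt_const.mul ((h1.sub continuousAt_const).inner
      continuousAt_const)).continuousWithinAt
  have hp1 := (hgood (η / 2) ⟨by linarith, le_rfl⟩).2.2.2 (by positivity)
  have hp2 := (hgood (-(η / 2)) ⟨le_rfl, by linarith⟩).2.2.2 (by
    have : η / 2 ≠ 0 := by positivity
    simpa using this)
  set y := min (g (η / 2)) (g (-(η / 2))) with hy
  have hy0 : 0 < y := lt_min hp1 hp2
  -- A small positive height is attained on both sides of `0`, contradicting injectivity.
  obtain ⟨s₁, hs₁, hgs₁⟩ := intermediate_value_Icc (a := 0) (b := η / 2) (by linarith)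
    (hgc.mono (Set.Icc_subset_Icc (by linarith) le_rfl)) (show y ∈ _ by
      rw [hg0]; exact ⟨hy0.le, min_le_left _ _⟩)
  obtain ⟨s₂, hs₂, hgs₂⟩ := intermediate_value_Icc' (a := -(η / 2)) (b := 0) (by linarith)
    (hgc.mono (Set.Icc_subset_Icc le_rfl (by linarith))) (show y ∈ _ by
      rw [hg0]; exact ⟨hy0.le, min_le_right _ _⟩)
  have heq := hginj ⟨by linarith [hs₁.1], hs₁.2⟩ ⟨hs₂.1, by linarith [hs₂.2]⟩ (hgs₁.trans hgs₂.symm)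
  have hs0 : s₁ = 0 := le_antisymm (heq ▸ hs₂.2) hs₁.1
  rw [hs0, hg0] at hgs₁
  linarith

end Boundary

/-! ### Density at a point -/

theorem IsBranchedImmersion.exists_hasOrder {n : ℕ} {M : Type*} [TopologicalSpace M]
    [ChartedSpace (EuclideanHalfSpace 2) M] {u : M → E n} [IsManifold (𝓡∂ 2) ∞ M]
    (hu : IsBranchedImmersion u) (q : M) : ∃ k, HasOrder u q (k + 1) := by
  rcases hu.immersed_or_branch q with hi | hb
  · exact ⟨0, hasOrder_one_of_injective hu.contMDiff hi⟩
  · obtain ⟨m, hm, h⟩ := hb.exists_hasOrder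
    exact ⟨m - 1, by rwa [Nat.sub_add_cancel (by omega)]⟩

section Density

variable {n : ℕ} {M : Type*} [TopologicalSpace M] [ChartedSpace (EuclideanHalfSpace 2) M]
  [MeasurableSpace M] {u : M → E n}

/-- The part of the surface near `q` contributes at least `c` to the kernel integral centred at
`u q`, as the scale tends to zero. -/
def DensityGE (u : M → E n) (q : M) (c : ℝ) : Prop :=
  ∀ U ∈ 𝓝 q, ∀ κ < c, ∀ᶠ s : ℝ in 𝓝[>] 0, ENNReal.ofReal κ ≤
    ∫⁻ q' in U, ENNReal.ofReal (2 * s ^ 2 / (s ^ 2 + ‖u q' - u q‖ ^ 2) ^ 2) ∂area u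

theorem DensityGE.mono {q : M} {c c' : ℝ} (h : DensityGE u q c) (hc : c' ≤ c) :
    DensityGE u q c' :=
  fun U hU κ hκ => h U hU κ (hκ.trans_le hc)

theorem DensityGE.le {q : M} {c B : ℝ} (h : DensityGE u q c) (hB0 : 0 ≤ B)
    (hB : ∀ s > 0, ∫⁻ q', ENNReal.ofReal (2 * s ^ 2 / (s ^ 2 + ‖u q' - u q‖ ^ 2) ^ 2) ∂area u
      ≤ ENNReal.ofReal B) : c ≤ B := by
  refine le_of_forall_lt_imp_le_of_dense fun κ hκ => ?_
  obtain ⟨s, hs, hs0⟩ := ((h Set.univ univ_mem κ hκ).and self_mem_nhdsWithin).exists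
  rw [Measure.restrict_univ] at hs
  exact (ENNReal.ofReal_le_ofReal_iff hB0).1 (hs.trans (hB s hs0))

/-- Distinct preimages of one point have disjoint neighbourhoods, and their contributions to the
same kernel integral add. -/
theorem DensityGE.add_le [T2Space M] [OpensMeasurableSpace M] {q₁ q₂ : M} {c₁ c₂ B : ℝ}
    (h₁ : DensityGE u q₁ c₁)
    (h₂ : DensityGE u q₂ c₂) (hne : q₁ ≠ q₂) (hu : u q₁ = u q₂) (hB0 : 0 ≤ B)
    (hB : ∀ s > 0, ∫⁻ q', ENNReal.ofReal (2 * s ^ 2 / (s ^ 2 + ‖u q' - u q₁‖ ^ 2) ^ 2) ∂area u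
      ≤ ENNReal.ofReal B) : c₁ + c₂ ≤ B := by
  obtain ⟨U, V, hU, hV, hqU, hqV, hd⟩ := t2_separation hne
  by_contra! hlt
  set d := (c₁ + c₂ - B) / 4 with hdd
  obtain ⟨s, ⟨hs₁, hs₂⟩, hs0⟩ := (((h₁ U (hU.mem_nhds hqU) (c₁ - d) (by linarith)).and
    (h₂ V (hV.mem_nhds hqV) (c₂ - d) (by linarith))).and self_mem_nhdsWithin).exists
  rw [← hu] at hs₂
  have h3 : ENNReal.ofReal (c₁ - d + (c₂ - d)) ≤ ENNReal.ofReal B := by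
    refine ENNReal.ofReal_add_le.trans ((add_le_add hs₁ hs₂).trans ?_)
    rw [← lintegral_union hV.measurableSet hd]
    exact (setLIntegral_le_lintegral _ _).trans (hB s hs0)
  have h4 := (ENNReal.ofReal_le_ofReal_iff hB0).1 h3
  linarith

theorem HasOrder.densityGE_of_interior [IsManifold (𝓡∂ 2) ∞ M] [BorelSpace M]
    (hu : ContMDiff (𝓡∂ 2) 𝓘(ℝ, E n) 1 u) {q : M} (hq : (𝓡∂ 2).IsInteriorPoint q) {k : ℕ}
    (h : HasOrder u q (k + 1)) : DensityGE u q (2 * Real.pi * (k + 1)) :=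
  fun _ hU _ hκ => h.eventually_le_of_interior hu hq hU hκ

theorem HasOrder.densityGE_of_boundary [IsManifold (𝓡∂ 2) ∞ M] [BorelSpace M]
    (hu : ContMDiff (𝓡∂ 2) 𝓘(ℝ, E n) 1 u) {q : M} (hq : q ∈ (𝓡∂ 2).boundary M) {k : ℕ}
    (h : HasOrder u q (k + 1)) : DensityGE u q (Real.pi * (k + 1)) :=
  fun _ hU _ hκ => h.eventually_le_of_boundary hu hq hU hκ

theorem IsBranchedImmersion.densityGE_of_interior [IsManifold (𝓡∂ 2) ∞ M] [BorelSpace M]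
    (hu : IsBranchedImmersion u) {q : M} (hq : (𝓡∂ 2).IsInteriorPoint q) :
    DensityGE u q (2 * Real.pi) := by
  obtain ⟨k, hk⟩ := hu.exists_hasOrder q
  refine (hk.densityGE_of_interior hu.contMDiff hq).mono ?_
  have : 0 ≤ 2 * Real.pi * k := by positivity
  linarith

theorem IsBranchedImmersion.densityGE_of_boundary [IsManifold (𝓡∂ 2) ∞ M] [BorelSpace M]
    (hu : IsBranchedImmersion u) {q : M} (hq : q ∈ (𝓡∂ 2).boundary M) :
    DensityGE u q Real.pi := by
  obtain ⟨k, hk⟩ := hu.exists_hasOrder q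
  refine (hk.densityGE_of_boundary hu.contMDiff hq).mono ?_
  have : 0 ≤ Real.pi * k := by positivity
  linarith

end Density

/-! ### The mean curvature term -/

/-- The only property of `C(p)` needed: it makes the hypothesis at least as strong as smallness of
`‖H‖_p r₀^α`. For finite `p` the two factors are at least `2` and `2 / π`, and `4 / π ≥ 1`. -/
theorem one_le_constC {p : ℝ≥0∞} (hp : 2 < p) : 1 ≤ constC p := by
  unfold constC
  split_ifs with h
  · exact le_rfl
  · have hp2 : 2 < p.toReal := by
      have := (ENNReal.toReal_lt_toReal (by simp) h).2 hp
      simpa using this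
    have h1 : 2 ≤ 2 * p.toReal / (p.toReal - 2) := by
      rw [le_div_iff₀ (by linarith)]
      linarith
    have h2 : 2 / Real.pi ≤ (2 / Real.pi) ^ (1 / p.toReal) := by
      have h3 : 2 / Real.pi ≤ 1 := by
        rw [div_le_one Real.pi_pos]
        linarith [Real.pi_gt_three]
      have h4 : 1 / p.toReal ≤ 1 := by
        rw [div_le_one (by linarith)]
        linarith
      simpa using Real.rpow_le_rpow_of_exponent_ge (by positivity) h3 h4
    have h5 : 1 ≤ 2 * (2 / Real.pi) := by
      rw [← mul_div_assoc, le_div_iff₀ Real.pi_pos]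
      linarith [Real.pi_le_four]
    exact h5.trans (mul_le_mul h1 h2 (by positivity) (by linarith))

theorem expAlpha_mem_Icc {p : ℝ≥0∞} (hp : 2 < p) : expAlpha p ∈ Set.Icc (0 : ℝ) 1 := by
  unfold expAlpha
  split_ifs with h
  · simp
  · have hp2 : 2 < p.toReal := by
      have := (ENNReal.toReal_lt_toReal (by simp) h).2 hp
      simpa using this
    have h1 : 2 / p.toReal ≤ 1 := by
      rw [div_le_one (by linarith)]
      exact hp2.le
    have h2 : 0 ≤ 2 / p.toReal := by positivity
    constructor <;> linarith

theorem expAlpha_eq (p : ℝ≥0∞) : 1 / (2 : ℝ≥0∞).toReal - 1 / p.toReal = expAlpha p / 2 := by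
  unfold expAlpha
  split_ifs with h
  · simp [h]
  · simp only [ENNReal.toReal_ofNat]
    ring

theorem integral_norm_sq_le {α F : Type*} [MeasurableSpace α] [NormedAddCommGroup F]
    {μ : Measure α} [IsFiniteMeasure μ] {H : α → F} {p : ℝ≥0∞} (hp : 2 < p) (hH : MemLp H p μ) :
    ∫ q, ‖H q‖ ^ 2 ∂μ ≤ (eLpNorm H p μ).toReal ^ 2 * μ.real Set.univ ^ expAlpha p := by
  have hH2 : MemLp H 2 μ := hH.mono_exponent hp.le
  have hα := expAlpha_mem_Icc hp
  have h1 := eLpNorm_le_eLpNorm_mul_rpow_measure_univ hp.le hH.aestronglyMeasurable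
  rw [expAlpha_eq] at h1
  have hfin : eLpNorm H p μ * μ Set.univ ^ (expAlpha p / 2) ≠ ⊤ :=
    ENNReal.mul_ne_top hH.eLpNorm_ne_top
      (ENNReal.rpow_ne_top_of_nonneg (by linarith [hα.1]) (measure_ne_top _ _))
  have h2 := ENNReal.toReal_mono hfin h1
  rw [ENNReal.toReal_mul, ← ENNReal.toReal_rpow] at h2
  have h0 : 0 ≤ ∫ q, ‖H q‖ ^ 2 ∂μ := integral_nonneg fun q => by positivity
  have h3 : (eLpNorm H 2 μ).toReal ^ 2 = ∫ q, ‖H q‖ ^ 2 ∂μ := by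
    rw [hH2.eLpNorm_eq_integral_rpow_norm two_ne_zero ENNReal.ofNat_ne_top]
    simp only [ENNReal.toReal_ofNat, Real.rpow_two]
    rw [ENNReal.toReal_ofReal (by positivity), ← Real.rpow_natCast, ← Real.rpow_mul h0]
    norm_num
  rw [← h3]
  refine (pow_le_pow_left₀ ENNReal.toReal_nonneg h2 2).trans_eq ?_
  rw [mul_pow, ← Real.rpow_natCast (_ ^ (expAlpha p / 2)), ← Real.rpow_mul ENNReal.toReal_nonneg]
  congr 2
  push_cast
  ring

/-- Bounding the power linearly, uniformly in the exponent, keeps `δ` independent of `p`. -/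
theorem rpow_le_one_add {a α : ℝ} (ha : 0 ≤ a) (hα : α ∈ Set.Icc (0 : ℝ) 1) :
    a ^ α ≤ 1 + a := by
  rcases le_total a 1 with h | h
  · linarith [Real.rpow_le_one ha h hα.1]
  · have := Real.rpow_le_rpow_of_exponent_le h hα.2
    rw [Real.rpow_one] at this
    linarith

/-! ### The upper bound for the kernel integral -/

theorem diam_range_pos {n : ℕ} {M : Type*} [TopologicalSpace M] [CompactSpace M]
    [ChartedSpace (EuclideanHalfSpace 2) M] {u : M → E n} {γ : ℝ → E n} (hu : Continuous u)
    (hγ : IsC1ClosedCurve γ) (hΓ : boundaryCurve u = Set.range γ) : 0 < Metric.diam (Set.range u) := by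
  have hsub : Set.range γ ⊆ Set.range u := hΓ ▸ Set.image_subset_range _ _
  have hne : γ 0 ≠ γ (1 / 2) := fun h => by
    have := hγ.simple (by norm_num) (by norm_num) h
    norm_num at this
  exact (dist_pos.2 hne).trans_le (Metric.dist_le_diam_of_mem (isCompact_range hu).isBounded
    (hsub ⟨_, rfl⟩) (hsub ⟨_, rfl⟩))

section Upper

variable {n : ℕ} {M : Type*} [TopologicalSpace M] [CompactSpace M]
  [ChartedSpace (EuclideanHalfSpace 2) M] [IsManifold (𝓡∂ 2) ∞ M]
  [MeasurableSpace M] [BorelSpace M] {u H : M → E n} {γ : ℝ → E n}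

theorem integrable_kernel (hu : ContMDiff (𝓡∂ 2) 𝓘(ℝ, E n) 1 u) (x₀ : E n) {s : ℝ} (hs : 0 < s) :
    Integrable (fun q => 2 * s ^ 2 / (s ^ 2 + ‖u q - x₀‖ ^ 2) ^ 2) (area u) := by
  have := isFiniteMeasure_area hu
  have hc : Continuous (fun q => 2 * s ^ 2 / (s ^ 2 + ‖u q - x₀‖ ^ 2) ^ 2) := by
    refine continuous_const.div ?_ fun q => by positivity
    exact (continuous_const.add ((hu.continuous.sub continuous_const).norm.pow 2)).pow 2
  exact hc.integrable_of_hasCompactSupport (HasCompactSupport.of_compactSpace _)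

theorem lintegral_kernel_le (hu : ContMDiff (𝓡∂ 2) 𝓘(ℝ, E n) 1 u) {x₀ : E n} {s B : ℝ}
    (hs : 0 < s) (h : ∫ q, 2 * s ^ 2 / (s ^ 2 + ‖u q - x₀‖ ^ 2) ^ 2 ∂area u ≤ B) :
    ∫⁻ q, ENNReal.ofReal (2 * s ^ 2 / (s ^ 2 + ‖u q - x₀‖ ^ 2) ^ 2) ∂area u
      ≤ ENNReal.ofReal B := by
  rw [← ofReal_integral_eq_lintegral_ofReal (integrable_kernel hu x₀ hs)
    (Eventually.of_forall fun q => by positivity)]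
  exact ENNReal.ofReal_le_ofReal h

theorem integral_kernel_le_totalCurvature (hu : IsBranchedImmersion u) (hH : IsMeanCurvature u H)
    (hdiv : DivergenceIdentity u H) (hH2 : MemLp H 2 (area u)) (hγ : IsC1ClosedCurve γ)
    (hΓ : boundaryCurve u = Set.range γ) {T : ℝ} (hT0 : 0 ≤ T)
    (hT : totalCurvature γ ≤ ENNReal.ofReal T) (x₀ : E n) {s : ℝ} (hs : 0 < s) :
    ∫ q, 2 * s ^ 2 / (s ^ 2 + ‖u q - x₀‖ ^ 2) ^ 2 ∂area u
      ≤ T + 1 / 8 * ∫ q, ‖H q‖ ^ 2 ∂area u := by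
  have h1 := integral_kernel_le hu.contMDiff hH hdiv hH2 x₀ hs
  have h2 := boundary_integral_le hγ (boundaryConormal u) norm_boundaryConormal_le
    (inner_boundaryConormal_deriv hu hγ hΓ) x₀ hs
  have h3 := integral_angularSpeed_le hγ hT0 hT x₀ hs (t₀ := 0) (by simp)
  have h4 : (0 : ℝ) ≤ if γ 0 = x₀ then Real.pi else 0 := by
    split_ifs
    exacts [Real.pi_pos.le, le_rfl]
  rw [hΓ] at h1
  linarith

theorem integral_kernel_le_totalCurvature_sub_pi (hu : IsBranchedImmersion u)
    (hH : IsMeanCurvature u H)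
    (hdiv : DivergenceIdentity u H) (hH2 : MemLp H 2 (area u)) (hγ : IsC1ClosedCurve γ)
    (hΓ : boundaryCurve u = Set.range γ) {T : ℝ} (hT0 : 0 ≤ T)
    (hT : totalCurvature γ ≤ ENNReal.ofReal T) {q₀ : M} (hq₀ : q₀ ∈ (𝓡∂ 2).boundary M) {s : ℝ}
    (hs : 0 < s) :
    ∫ q, 2 * s ^ 2 / (s ^ 2 + ‖u q - u q₀‖ ^ 2) ^ 2 ∂area u
      ≤ T - Real.pi + 1 / 8 * ∫ q, ‖H q‖ ^ 2 ∂area u := by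
  have h1 := integral_kernel_le hu.contMDiff hH hdiv hH2 (u q₀) hs
  have h2 := boundary_integral_le hγ (boundaryConormal u) norm_boundaryConormal_le
    (inner_boundaryConormal_deriv hu hγ hΓ) (u q₀) hs
  obtain ⟨t, ht⟩ : u q₀ ∈ Set.range γ := hΓ ▸ Set.mem_image_of_mem u hq₀
  obtain ⟨t₀, ht₀, htt⟩ := hγ.periodic.exists_mem_Ico₀ one_pos t
  have h3 := integral_angularSpeed_le hγ hT0 hT (u q₀) hs ht₀
  rw [if_pos (htt.symm.trans ht)] at h3
  rw [hΓ] at h1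
  linarith

/-- At the scale `s = r₀` the kernel is at least `1 / (2 r₀²)` on the whole surface, so the kernel
inequality doubles as an area bound. -/
theorem area_div_le (hu : ContMDiff (𝓡∂ 2) 𝓘(ℝ, E n) 1 u) (q₀ : M)
    (hr : 0 < Metric.diam (Set.range u)) :
    (area u).real Set.univ / (2 * Metric.diam (Set.range u) ^ 2) ≤
      ∫ q, 2 * Metric.diam (Set.range u) ^ 2 /
        (Metric.diam (Set.range u) ^ 2 + ‖u q - u q₀‖ ^ 2) ^ 2 ∂area u := by
  have := isFiniteMeasure_area hu
  set r := Metric.diam (Set.range u)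
  have h1 : ∫ _q : M, 1 / (2 * r ^ 2) ∂area u = (area u).real Set.univ / (2 * r ^ 2) := by
    rw [integral_const, smul_eq_mul, mul_one_div]
  rw [← h1]
  refine integral_mono (integrable_const _) (integrable_kernel hu (u q₀) hr) fun q => ?_
  have h2 : ‖u q - u q₀‖ ≤ r := by
    rw [← dist_eq_norm]
    exact Metric.dist_le_diam_of_mem (isCompact_range hu.continuous).isBounded ⟨_, rfl⟩ ⟨_, rfl⟩
  have h3 : r ^ 2 + ‖u q - u q₀‖ ^ 2 ≤ 2 * r ^ 2 := by
    linarith [pow_le_pow_left₀ (norm_nonneg _) h2 2]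
  calc 1 / (2 * r ^ 2) = 2 * r ^ 2 / (2 * r ^ 2) ^ 2 := by field_simp
    _ ≤ _ := div_le_div_of_nonneg_left (by positivity) (by positivity)
      (pow_le_pow_left₀ (by positivity) h3 2)

/-- Smallness of the scale-invariant norm of the mean curvature controls its Willmore energy. -/
theorem willmore_energy_le (hu : IsBranchedImmersion u)
    (hH : IsMeanCurvature u H) (hdiv : DivergenceIdentity u H) (hγ : IsC1ClosedCurve γ)
    (hΓ : boundaryCurve u = Set.range γ) {T : ℝ} (hT0 : 0 ≤ T) (hT4 : T ≤ 4 * Real.pi)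
    (hT : totalCurvature γ ≤ ENNReal.ofReal T) {p : ℝ≥0∞} (hp : 2 < p)
    (hHp : MemLp H p (area u)) {δ : ℝ} (hδ : δ ≤ 1 / 2)
    (hsmall : constC p * (eLpNorm H p (area u)).toReal * Metric.diam (Set.range u) ^ expAlpha p < δ) :
    1 / 8 * ∫ q, ‖H q‖ ^ 2 ∂area u ≤ 4 * δ ^ 2 := by
  have := isFiniteMeasure_area hu.contMDiff
  have hH2 : MemLp H 2 (area u) := hHp.mono_exponent hp.le
  have hα := expAlpha_mem_Icc hp
  have hr := diam_range_pos hu.contMDiff.continuous hγ hΓ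
  obtain ⟨q₀, -⟩ : (u ⁻¹' {γ 0}).Nonempty := by
    obtain ⟨q, -, hq⟩ : γ 0 ∈ boundaryCurve u := hΓ ▸ ⟨0, rfl⟩
    exact ⟨q, hq⟩
  have h1 := area_div_le hu.contMDiff q₀ hr
  have h2 := integral_kernel_le_totalCurvature hu hH hdiv hH2 hγ hΓ hT0 hT (u q₀) hr
  have h3 := integral_norm_sq_le hp hHp
  set r := Metric.diam (Set.range u)
  set A := (area u).real Set.univ
  set W := ∫ q, ‖H q‖ ^ 2 ∂area u
  set N := (eLpNorm H p (area u)).toReal with hN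
  have hN0 : 0 ≤ N := ENNReal.toReal_nonneg
  have hA0 : 0 ≤ A := measureReal_nonneg
  set a := A / r ^ 2 with ha
  have ha0 : 0 ≤ a := by positivity
  set h := N * r ^ expAlpha p with hh
  have hh0 : 0 ≤ h := by positivity
  have hhδ : h < δ := by
    rw [mul_assoc] at hsmall
    exact (le_mul_of_one_le_left hh0 (one_le_constC hp)).trans_lt hsmall
  -- Hölder's inequality in scale-invariant form: `‖H‖_p² A^α = h² a^α` with `h = ‖H‖_p r₀^α` and `a
  -- = A / r₀²`.
  have hW : W ≤ δ ^ 2 * (1 + a) := by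
    have h4 : N ^ 2 * A ^ expAlpha p = h ^ 2 * a ^ expAlpha p := by
      have h5 : A = r ^ 2 * a := by rw [ha]; field_simp
      rw [hh, mul_pow, mul_assoc, h5, Real.mul_rpow (by positivity) ha0]
      congr 2
      rw [← Real.rpow_natCast, ← Real.rpow_natCast, ← Real.rpow_mul hr.le, ← Real.rpow_mul hr.le,
        mul_comm]
    rw [h4] at h3
    refine h3.trans (mul_le_mul (pow_le_pow_left₀ hh0 hhδ.le 2) (rpow_le_one_add ha0 hα)
      (by positivity) (by positivity))
  have h6 : a / 2 ≤ T + 1 / 8 * W := by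
    have : A / (2 * r ^ 2) = a / 2 := by rw [ha]; field_simp
    linarith
  have hδ2 : δ ^ 2 ≤ 1 / 4 := by nlinarith
  -- Since `δ² ≤ 1/4`, the energy term `W` is absorbed in `a / 2 ≤ 4π + W / 8`. The bound `31` gives
  -- `1 + a ≤ 32`, hence the constant `32 / 8 = 4`.
  have h7 : a ≤ 31 := by
    have : δ ^ 2 * (1 + a) ≤ 1 / 4 * (1 + a) := mul_le_mul_of_nonneg_right hδ2 (by linarith)
    linarith [Real.pi_lt_d2]
  have h8 : δ ^ 2 * (1 + a) ≤ δ ^ 2 * 32 := mul_le_mul_of_nonneg_left (by linarith) (by positivity)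
  linarith

end Upper

end BranchedSurface

/-! ### Embeddedness -/

open BranchedSurface in
theorem corollary3p5 (ε : ℝ) (hε₀ : 0 < ε) (hε₂ : ε ≤ 2) :
    ∃ δ : ℝ, 0 < δ ∧ δ < 1 ∧
      ∀ (n : ℕ) (M : Type*) [TopologicalSpace M] [T2Space M] [CompactSpace M]
        [ChartedSpace (EuclideanHalfSpace 2) M] [IsManifold (𝓡∂ 2) ∞ M]
        [MeasurableSpace M] [BorelSpace M]
        (γ : ℝ → E n) (u : M → E n) (H : M → E n) (p : ℝ≥0∞),
        IsC1ClosedCurve γ →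
        totalCurvature γ ≤ ENNReal.ofReal ((4 - ε) * Real.pi) →
        IsBranchedImmersion u →
        Set.InjOn u ((𝓡∂ 2).boundary M) →
        boundaryCurve u = Set.range γ →
        IsMeanCurvature u H →
        DivergenceIdentity u H →
        2 < p →
        MemLp H p (area u) →
        constC p * (eLpNorm H p (area u)).toReal * Metric.diam (Set.range u) ^ expAlpha p < δ →
        IsEmbedded u := by
  -- With this choice `4 δ² = ε² / 4 ≤ ε / 2 < ε π`, so the energy term stays below the gap `ε π` in
  -- the total curvature.
  refine ⟨ε / 4, by linarith, by linarith, ?_⟩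
  intro n M _ _ _ _ _ _ _ γ u H p hγ hT hu hinj hΓ hH hdiv hp hHp hsmall
  have := isFiniteMeasure_area hu.contMDiff
  have hπ := Real.pi_gt_three
  have hεπ : ε * 3 < ε * Real.pi := mul_lt_mul_of_pos_left hπ hε₀
  have hT0 : 0 ≤ (4 - ε) * Real.pi := mul_nonneg (by linarith) Real.pi_pos.le
  have hH2 : MemLp H 2 (area u) := hHp.mono_exponent hp.le
  have hW := willmore_energy_le hu hH hdiv hγ hΓ hT0
    (mul_le_mul_of_nonneg_right (by linarith) Real.pi_pos.le) hT hp hHp (by linarith) hsmall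
  have hW0 : 0 ≤ 1 / 8 * ∫ q, ‖H q‖ ^ 2 ∂area u :=
    mul_nonneg (by norm_num) (integral_nonneg fun q => by positivity)
  set W := 1 / 8 * ∫ q, ‖H q‖ ^ 2 ∂area u with hWdef
  have hWε : W < ε * Real.pi := by nlinarith
  have hup : ∀ x₀ : E n, ∀ s > 0, ∫⁻ q, ENNReal.ofReal
      (2 * s ^ 2 / (s ^ 2 + ‖u q - x₀‖ ^ 2) ^ 2) ∂area u
        ≤ ENNReal.ofReal ((4 - ε) * Real.pi + W) := fun x₀ s hs =>
    lintegral_kernel_le hu.contMDiff hs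
      (integral_kernel_le_totalCurvature hu hH hdiv hH2 hγ hΓ hT0 hT x₀ hs)
  have hupΓ : ∀ q₀ ∈ (𝓡∂ 2).boundary M, ∀ s > 0, ∫⁻ q, ENNReal.ofReal
      (2 * s ^ 2 / (s ^ 2 + ‖u q - u q₀‖ ^ 2) ^ 2) ∂area u
        ≤ ENNReal.ofReal ((4 - ε) * Real.pi - Real.pi + W) := fun q₀ hq₀ s hs =>
    lintegral_kernel_le hu.contMDiff hs
      (integral_kernel_le_totalCurvature_sub_pi hu hH hdiv hH2 hγ hΓ hT0 hT hq₀ hs)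
  have hB0 : 0 ≤ (4 - ε) * Real.pi + W := by linarith
  have hBΓ0 : 0 ≤ (4 - ε) * Real.pi - Real.pi + W := by nlinarith
  have hint : ∀ q : M, q ∉ (𝓡∂ 2).boundary M → (𝓡∂ 2).IsInteriorPoint q := fun q hq =>
    (ModelWithCorners.isInteriorPoint_iff_not_isBoundaryPoint _).2 hq
  have hmixed : ∀ q₁ q₂ : M, q₁ ∈ (𝓡∂ 2).boundary M → q₂ ∉ (𝓡∂ 2).boundary M → u q₁ ≠ u q₂ := by
    intro q₁ q₂ h₁ h₂ h
    -- Densities `π` and `2π` at a point of `Γ`, where the upper bound is below `3π`.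
    have := (hu.densityGE_of_boundary h₁).add_le (hu.densityGE_of_interior (hint q₂ h₂))
      (fun h' => h₂ (h' ▸ h₁)) h hBΓ0 (hupΓ q₁ h₁)
    linarith
  have hinjective : Function.Injective u := by
    intro q₁ q₂ h
    by_contra hne
    by_cases h₁ : q₁ ∈ (𝓡∂ 2).boundary M <;> by_cases h₂ : q₂ ∈ (𝓡∂ 2).boundary M
    · exact hne (hinj h₁ h₂ h)
    · exact hmixed q₁ q₂ h₁ h₂ h
    · exact hmixed q₂ q₁ h₂ h₁ h.symm
    -- Two interior sheets carry `4π`, against an upper bound below `4π`.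
    · have := (hu.densityGE_of_interior (hint q₁ h₁)).add_le
        (hu.densityGE_of_interior (hint q₂ h₂)) hne h hB0 (hup (u q₁))
      linarith
  refine ⟨(hu.contMDiff.continuous.isClosedEmbedding hinjective).isEmbedding, fun q => ?_⟩
  refine (hu.immersed_or_branch q).resolve_right fun hb => ?_
  obtain ⟨m, hm, ho⟩ := hb.exists_hasOrder
  by_cases hq : q ∈ (𝓡∂ 2).boundary M
  · have hm2 : m ≠ 2 := by
      rintro rfl
      exact not_hasOrder_two_of_boundary hu.contMDiff hinj hγ hΓ hq ho
    -- With order two excluded the order is at least three, so the boundary density is at least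
    -- `3π`. Order two alone would give only `2π`, which the density bound does not rule out.
    obtain ⟨k, rfl⟩ : ∃ k, m = k + 2 + 1 := ⟨m - 3, by omega⟩
    have h3 : Real.pi * 3 ≤ Real.pi * (((k + 2 : ℕ) : ℝ) + 1) := by
      refine mul_le_mul_of_nonneg_left ?_ Real.pi_pos.le
      push_cast
      linarith [(Nat.cast_nonneg k : (0 : ℝ) ≤ k)]
    have := ((ho.densityGE_of_boundary hu.contMDiff hq).mono h3).le hBΓ0 (hupΓ q hq)
    linarith
  · obtain ⟨k, rfl⟩ : ∃ k, m = k + 1 + 1 := ⟨m - 2, by omega⟩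
    have h3 : 2 * Real.pi * 2 ≤ 2 * Real.pi * (((k + 1 : ℕ) : ℝ) + 1) := by
      refine mul_le_mul_of_nonneg_left ?_ (by positivity)
      push_cast
      linarith [(Nat.cast_nonneg k : (0 : ℝ) ≤ k)]
    have := ((ho.densityGE_of_interior hu.contMDiff (hint q hq)).mono h3).le hB0 (hup (u q))
    linarith
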